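/- A \emph{commutative DG ring} is a DG ring $A=\bigoplus_{i\le 0}A^i$ (associative, unital, graded, with a differential of degree $1$ satisfying the graded Leibniz rule) such that $ba=(-1)^{ij}ab$ for $a\in A^i$, $b\in A^j$, and $a\cdot a=0$ for $a\in A^i$ with $i$ odd. Write $\bar A:=\mathrm{H}^0(A)$, a commutative ring, viewed as a DG ring concentrated in degree $0$; there is a canonical DG ring homomorphism $A\to\bar A$. Let $\mathsf{D}(A)$ be the derived category of DG $A$-modules (DG modules with quasi-isomorphisms inverted). A DG $A$-module $P$ is \emph{tilting} if $P\otimes^{\mathrm L}_A Q\cong A$ in $\mathsf{D}(A)$ for some DG $A$-module $Q$. Let $\mathrm{DPic}(A)$ be the set of isomorphism classes in $\mathsf{D}(A)$ of tilting DG $A$-modules; it is an abelian group under the operation induced by $-\otimes^{\mathrm L}_A-$, with unit the class of $A$. \textbf{Theorem.} Let $A$ be a commutative DG ring such that $\operatorname{Spec}\bar A$ has finitely many connected components. Then $P\mapsto \bar A\otimes^{\mathrm L}_A P$ induces a well-defined map $$\mathrm{DPic}(A)\longrightarrow \mathrm{DPic}(\bar A),$$ and this map is an isomorphism of groups. -/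

import Mathlib

universe u

namespace DG

open CategoryTheory
open scoped TensorProduct

section Grading

variable {X : Type u} [AddCommGroup X] {G : ℤ → AddSubgroup X}

/-- For an internally graded abelian group `X = ⨁ G i`, the homomorphism sending `x` to the family
of its homogeneous components. -/
noncomputable def components (h : DirectSum.IsInternal G) : X →+ (ℤ →₀ X) :=
  (DirectSum.toAddMonoid fun i => (Finsupp.singleAddHom i).comp (G i).subtype).comp
    (AddEquiv.ofBijective (DirectSum.coeAddMonoidHom G) h).symm.toAddMonoidHom

lemma components_of_mem (h : DirectSum.IsInternal G) {i : ℤ} {x : X} (hx : x ∈ G i) :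
    components h x = Finsupp.single i x := by
  have : (AddEquiv.ofBijective (DirectSum.coeAddMonoidHom G) h).symm x
      = DirectSum.of (fun i => G i) i ⟨x, hx⟩ := by
    rw [AddEquiv.symm_apply_eq]
    exact (DirectSum.coeAddMonoidHom_of G i ⟨x, hx⟩).symm
  simp [components, this]

lemma hom_ext {Y : Type*} [AddCommGroup Y] (h : DirectSum.IsInternal G) {f g : X →+ Y}
    (hfg : ∀ i, ∀ x ∈ G i, f x = g x) : f = g := by
  have key : f.comp (DirectSum.coeAddMonoidHom G) = g.comp (DirectSum.coeAddMonoidHom G) := by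
    ext i x
    simpa using hfg i x x.2
  ext x
  obtain ⟨y, rfl⟩ := h.2 x
  exact DFunLike.congr_fun key y

lemma isInternal_of_components (p : X →+ (ℤ →₀ X))
    (hp : ∀ i, ∀ x ∈ G i, p x = Finsupp.single i x) (hG : ⨆ i, G i = ⊤) :
    DirectSum.IsInternal G := by
  constructor
  · have key : p.comp (DirectSum.coeAddMonoidHom G)
        = DirectSum.toAddMonoid fun i => (Finsupp.singleAddHom i).comp (G i).subtype := by
      ext i x : 2
      simpa using hp i x x.2
    have key2 : ∀ (y : DirectSum ℤ fun i => G i) (n : ℤ),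
        (DirectSum.toAddMonoid (fun i => (Finsupp.singleAddHom i).comp (G i).subtype) y) n
          = (y n : X) := by
      intro y n
      induction y using DirectSum.induction_on with
      | zero => simp
      | of i x =>
        by_cases hin : i = n
        · subst hin; simp
        · simp [hin, DirectSum.of_eq_of_ne (β := fun i => G i) i n x (Ne.symm hin)]
      | add x y hx hy => simp [hx, hy]
    intro y z hyz
    refine DFinsupp.ext fun n => Subtype.ext ?_
    rw [← key2 y n, ← key2 z n, ← key]
    simp [hyz]
  · intro x
    have hx : x ∈ ⨆ i, G i := hG ▸ AddSubgroup.mem_top x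
    induction hx using AddSubgroup.iSup_induction' with
    | hp i x hx => exact ⟨DirectSum.of (fun i => G i) i ⟨x, hx⟩, by simp⟩
    | h1 => exact ⟨0, by simp⟩
    | hadd x y _ _ hx hy =>
      obtain ⟨a, rfl⟩ := hx
      obtain ⟨b, rfl⟩ := hy
      exact ⟨a + b, by simp⟩

/-- The automorphism of a graded abelian group that is multiplication by `(-1) ^ i` in
degree `i`. -/
noncomputable def signed (h : DirectSum.IsInternal G) : X →+ X :=
  (Finsupp.liftAddHom fun i : ℤ =>
    (DistribSMul.toAddMonoidHom X (i.negOnePow : ℤˣ) : X →+ X)).comp (components h)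

lemma signed_of_mem (h : DirectSum.IsInternal G) {i : ℤ} {x : X} (hx : x ∈ G i) :
    signed h x = i.negOnePow • x := by
  simp [signed, components_of_mem h hx]

end Grading

/-- A commutative DG ring: a nonpositively graded strongly commutative DG ring, with cohomological
grading. The grading is internal. -/
structure CommDGRing : Type (u + 1) where
  carrier : Type u
  [ring : Ring carrier]
  grading : ℤ → AddSubgroup carrier
  isInternal : DirectSum.IsInternal grading
  one_mem : (1 : carrier) ∈ grading 0
  mul_mem : ∀ {i j : ℤ} {a b : carrier}, a ∈ grading i → b ∈ grading j → a * b ∈ grading (i + j)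
  d : carrier →+ carrier
  d_mem : ∀ {i : ℤ} {a : carrier}, a ∈ grading i → d a ∈ grading (i + 1)
  d_d : ∀ a : carrier, d (d a) = 0
  leibniz : ∀ {i : ℤ} {a : carrier}, a ∈ grading i → ∀ b : carrier,
    d (a * b) = d a * b + i.negOnePow • (a * d b)
  nonpos : ∀ {i : ℤ}, 0 < i → grading i = ⊥
  mul_comm_sign : ∀ {i j : ℤ} {a b : carrier}, a ∈ grading i → b ∈ grading j →
    b * a = (i * j).negOnePow • (a * b)
  mul_self_of_odd : ∀ {i : ℤ} {a : carrier}, Odd i → a ∈ grading i → a * a = 0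

instance : CoeSort CommDGRing.{u} (Type u) := ⟨CommDGRing.carrier⟩

attribute [instance] CommDGRing.ring

/-- Homomorphisms of DG rings. -/
structure CommDGRing.Hom (A B : CommDGRing.{u}) where
  toRingHom : A →+* B
  map_mem : ∀ {i : ℤ} {a : A}, a ∈ A.grading i → toRingHom a ∈ B.grading i
  map_d : ∀ a : A, toRingHom (A.d a) = B.d (toRingHom a)

/-- The identity homomorphism of a DG ring. -/
def CommDGRing.Hom.id (A : CommDGRing.{u}) : CommDGRing.Hom A A where
  toRingHom := RingHom.id A
  map_mem h := h
  map_d _ := rfl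

/-- A (left) DG module over a commutative DG ring. -/
structure DGModule (A : CommDGRing.{u}) : Type (u + 1) where
  carrier : Type u
  [addCommGroup : AddCommGroup carrier]
  [module : Module A carrier]
  grading : ℤ → AddSubgroup carrier
  isInternal : DirectSum.IsInternal grading
  smul_mem : ∀ {i j : ℤ} {a : A} {m : carrier}, a ∈ A.grading i → m ∈ grading j →
    a • m ∈ grading (i + j)
  d : carrier →+ carrier
  d_mem : ∀ {i : ℤ} {m : carrier}, m ∈ grading i → d m ∈ grading (i + 1)
  d_d : ∀ m : carrier, d (d m) = 0
  leibniz : ∀ {i : ℤ} {a : A}, a ∈ A.grading i → ∀ m : carrier,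
    d (a • m) = A.d a • m + i.negOnePow • (a • d m)

namespace DGModule

instance (A : CommDGRing.{u}) : CoeSort (DGModule A) (Type u) := ⟨DGModule.carrier⟩

attribute [instance] DGModule.addCommGroup DGModule.module

variable {A B : CommDGRing.{u}}

/-- Homomorphisms of DG modules: linear maps of degree `0` commuting with the differentials. -/
@[ext]
structure Hom (M N : DGModule A) where
  toLinearMap : M →ₗ[A] N
  map_mem : ∀ {i : ℤ} {m : M}, m ∈ M.grading i → toLinearMap m ∈ N.grading i
  map_d : ∀ m : M, toLinearMap (M.d m) = N.d (toLinearMap m)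

/-- The category of DG modules over a commutative DG ring. -/
instance : Category (DGModule A) where
  Hom := Hom
  id M := ⟨LinearMap.id, fun h => h, fun _ => rfl⟩
  comp f g := ⟨g.toLinearMap.comp f.toLinearMap, fun h => g.map_mem (f.map_mem h),
    fun m => by simp [f.map_d, g.map_d]⟩

/-- The cocycles of degree `i`. -/
def cocycles (M : DGModule A) (i : ℤ) : AddSubgroup M := M.grading i ⊓ M.d.ker

/-- The coboundaries of degree `i`. -/
def coboundaries (M : DGModule A) (i : ℤ) : AddSubgroup M := (M.grading (i - 1)).map M.d

/-- The cohomology `Hⁱ(M)`. -/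
abbrev cohomology (M : DGModule A) (i : ℤ) : Type u :=
  M.cocycles i ⧸ (M.coboundaries i).addSubgroupOf (M.cocycles i)

/-- The homomorphism that a homomorphism of DG modules induces on cocycles. -/
def cocyclesMap {M N : DGModule A} (f : M ⟶ N) (i : ℤ) : M.cocycles i →+ N.cocycles i :=
  (f.toLinearMap.toAddMonoidHom.comp (M.cocycles i).subtype).codRestrict (N.cocycles i)
    fun x => ⟨f.map_mem x.2.1, by
      have hx : M.d x = 0 := x.2.2
      change N.d (f.toLinearMap x) = 0
      rw [← f.map_d, hx, map_zero]⟩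

/-- The homomorphism `Hⁱ(f)`. -/
def cohomologyMap {M N : DGModule A} (f : M ⟶ N) (i : ℤ) : M.cohomology i →+ N.cohomology i :=
  QuotientAddGroup.map _ _ (cocyclesMap f i) (by
    rintro ⟨x, hx⟩ ⟨y, hy, hxy⟩
    exact ⟨f.toLinearMap y, f.map_mem hy, by
      rw [← f.map_d, hxy]; rfl⟩)

/-- A DG module is acyclic if all its cohomology vanishes. -/
def Acyclic (M : DGModule A) : Prop := ∀ i : ℤ, Subsingleton (M.cohomology i)

variable (A) in
/-- The quasi-isomorphisms of DG modules. -/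
def quasiIso : MorphismProperty (DGModule A) :=
  fun _ _ f => ∀ i : ℤ, Function.Bijective (cohomologyMap f i)

variable (A) in
/-- The derived category `D(A)`: the localization of the category of DG modules with respect to the
quasi-isomorphisms. -/
abbrev DerivedCat := (quasiIso A).Localization

/-- A DG module viewed as an object of `D(A)`. -/
abbrev toDerived (M : DGModule A) : DerivedCat A := (quasiIso A).Q.obj M

/-- The DG ring `A` as a DG module over itself. -/
def self (A : CommDGRing.{u}) : DGModule A where
  carrier := A
  grading := A.grading
  isInternal := A.isInternal
  smul_mem := A.mul_mem
  d := A.d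
  d_mem := A.d_mem
  d_d := A.d_d
  leibniz := A.leibniz

section Tensor

variable (f : CommDGRing.Hom A B) (M : DGModule B) (N : DGModule A)

/-- The relations `(m · a) ⊗ n = m ⊗ (a · n)`, where the right action of `A` on `M` is
`m · a = (-1) ^ (i * j) • (f a • m)` for `a` of degree `i` and `m` of degree `j`. -/
def tensorRel : Set (M ⊗[ℤ] N) :=
  {x | ∃ (i j : ℤ) (a : A) (m : M) (n : N), a ∈ A.grading i ∧ m ∈ M.grading j ∧
    x = ((i * j).negOnePow • (f.toRingHom a • m)) ⊗ₜ[ℤ] n - m ⊗ₜ[ℤ] (a • n)}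

lemma tensorRel_smul (b : B) {x : M ⊗[ℤ] N} (hx : x ∈ AddSubgroup.closure (tensorRel f M N)) :
    b • x ∈ AddSubgroup.closure (tensorRel f M N) := by
  have hb : ∀ (b : B), b ∈ ⨆ i, B.grading i := fun b => by
    obtain ⟨y, rfl⟩ := B.isInternal.2 b
    induction y using DirectSum.induction_on with
    | zero => simp
    | of i x => simpa using AddSubgroup.mem_iSup_of_mem i x.2
    | add x y hx hy => rw [map_add]; exact add_mem hx hy
  induction hx using AddSubgroup.closure_induction with
  | zero => simp
  | add x y _ _ hx hy => rw [smul_add]; exact add_mem hx hy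
  | neg x _ hx => rw [smul_neg]; exact neg_mem hx
  | mem x hx =>
    obtain ⟨i, j, a, m, n, ha, hm, rfl⟩ := hx
    have hbb := hb b
    induction hbb using AddSubgroup.iSup_induction' with
    | h1 => simp
    | hadd x y _ _ hx hy => rw [add_smul]; exact add_mem hx hy
    | hp k b hbk =>
      refine AddSubgroup.subset_closure
        ⟨i, k + j, a, b • m, n, ha, M.smul_mem hbk hm, ?_⟩
      have h := B.mul_comm_sign (f.map_mem ha) hbk
      rw [smul_sub, TensorProduct.smul_tmul', TensorProduct.smul_tmul', smul_comm b, smul_smul b,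
        h, Units.smul_def, Units.smul_def, Units.smul_def, smul_assoc, smul_smul, smul_smul,
        mul_add, Int.negOnePow_add, Units.val_mul, mul_comm]

/-- The subgroup of `M ⊗ N` generated by the relations; it is stable under the action of `B`. -/
def tensorRelSubmodule : Submodule B (M ⊗[ℤ] N) where
  carrier := AddSubgroup.closure (tensorRel f M N)
  add_mem' := add_mem
  zero_mem' := zero_mem _
  smul_mem' b _ hx := tensorRel_smul f M N b hx

/-- The underlying `B`-module of `M ⊗_A N`. -/
abbrev TensorCarrier : Type u := (M ⊗[ℤ] N) ⧸ tensorRelSubmodule f M N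

/-- The class of `m ⊗ n` in `M ⊗_A N`. -/
def tmul (m : M) (n : N) : TensorCarrier f M N := (tensorRelSubmodule f M N).mkQ (m ⊗ₜ[ℤ] n)

variable {f M N}

lemma tensor_induction {p : TensorCarrier f M N → Prop} (hz : p 0)
    (ht : ∀ (i j : ℤ) (m : M) (n : N), m ∈ M.grading i → n ∈ N.grading j → p (tmul f M N m n))
    (ha : ∀ x y, p x → p y → p (x + y)) (x : TensorCarrier f M N) : p x := by
  have h0 : ∀ (m : M) (n : N), p (tmul f M N m n) := fun m n => by
    obtain ⟨m, rfl⟩ := M.isInternal.2 m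
    obtain ⟨n, rfl⟩ := N.isInternal.2 n
    induction m using DirectSum.induction_on with
    | zero => simpa [tmul] using hz
    | add x y hx hy =>
      rw [map_add, tmul, TensorProduct.add_tmul, map_add]; exact ha _ _ hx hy
    | of i m =>
      induction n using DirectSum.induction_on with
      | zero => simpa [tmul] using hz
      | add x y hx hy =>
        rw [map_add, tmul, TensorProduct.tmul_add, map_add]; exact ha _ _ hx hy
      | of j n => simpa using ht i j m n m.2 n.2
  obtain ⟨x, rfl⟩ := (tensorRelSubmodule f M N).mkQ_surjective x
  induction x using TensorProduct.induction_on with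
  | zero => simpa using hz
  | tmul m n => exact h0 m n
  | add x y hx hy => rw [map_add]; exact ha _ _ hx hy

lemma tmul_rel {i j : ℤ} {a : A} {m : M} (n : N) (ha : a ∈ A.grading i) (hm : m ∈ M.grading j) :
    tmul f M N m (a • n) = (i * j).negOnePow • tmul f M N (f.toRingHom a • m) n := by
  have h : ((i * j).negOnePow • (f.toRingHom a • m)) ⊗ₜ[ℤ] n - m ⊗ₜ[ℤ] (a • n)
      ∈ tensorRelSubmodule f M N := AddSubgroup.subset_closure ⟨i, j, a, m, n, ha, hm, rfl⟩
  have h2 := (Submodule.Quotient.eq _).2 h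
  rw [Units.smul_def, ← TensorProduct.smul_tmul'] at h2
  exact h2.symm.trans (((tensorRelSubmodule f M N).mkQ.toAddMonoidHom).map_zsmul _ _)

/-- Additive maps out of `M ⊗_A N`. -/
def tensorLift {Y : Type u} [AddCommGroup Y] (φ : M ⊗[ℤ] N →+ Y)
    (h : ∀ x ∈ tensorRel f M N, φ x = 0) : TensorCarrier f M N →+ Y :=
  QuotientAddGroup.lift (tensorRelSubmodule f M N).toAddSubgroup φ (fun x hx => by
    have hle : AddSubgroup.closure (tensorRel f M N) ≤ φ.ker :=
      (AddSubgroup.closure_le _).2 h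
    exact hle hx)

lemma tensorLift_tmul {Y : Type u} [AddCommGroup Y] (φ : M ⊗[ℤ] N →+ Y)
    (h : ∀ x ∈ tensorRel f M N, φ x = 0) (m : M) (n : N) :
    tensorLift φ h (tmul f M N m n) = φ (m ⊗ₜ[ℤ] n) := rfl

lemma tmul_add_left (m m' : M) (n : N) :
    tmul f M N (m + m') n = tmul f M N m n + tmul f M N m' n := by
  simp [tmul, TensorProduct.add_tmul]

lemma tmul_add_right (m : M) (n n' : N) :
    tmul f M N m (n + n') = tmul f M N m n + tmul f M N m n' := by
  simp [tmul, TensorProduct.tmul_add]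

lemma tmul_unit_left (e : ℤˣ) (m : M) (n : N) :
    tmul f M N (e • m) n = e • tmul f M N m n := by
  rcases Int.units_eq_one_or e with rfl | rfl <;> simp [tmul, TensorProduct.neg_tmul, -neg_smul,
    Units.smul_def, neg_one_smul]

lemma tmul_unit_right (e : ℤˣ) (m : M) (n : N) :
    tmul f M N m (e • n) = e • tmul f M N m n := by
  rcases Int.units_eq_one_or e with rfl | rfl <;> simp [tmul, TensorProduct.tmul_neg, -neg_smul,
    Units.smul_def, neg_one_smul]

lemma smul_tmul (b : B) (m : M) (n : N) : b • tmul f M N m n = tmul f M N (b • m) n := rfl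

variable (f M N)

/-- The degree `k` component of `M ⊗_A N`: generated by `m ⊗ n` with `deg m + deg n = k`. -/
def tensorGrading (k : ℤ) : AddSubgroup (TensorCarrier f M N) :=
  AddSubgroup.closure {x | ∃ (i j : ℤ) (m : M) (n : N), i + j = k ∧ m ∈ M.grading i ∧
    n ∈ N.grading j ∧ x = tmul f M N m n}

variable {f M N} in
lemma tmul_mem {i j k : ℤ} (h : i + j = k) {m : M} {n : N} (hm : m ∈ M.grading i)
    (hn : n ∈ N.grading j) : tmul f M N m n ∈ tensorGrading f M N k :=
  AddSubgroup.subset_closure ⟨i, j, m, n, h, hm, hn, rfl⟩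

/-- Auxiliary: `m ⊗ n` is sent to the family of homogeneous components of its class. -/
noncomputable def preTensorComponents : M ⊗[ℤ] N →+ (ℤ →₀ TensorCarrier f M N) :=
  (((Finsupp.mapRange.addMonoidHom (tensorRelSubmodule f M N).mkQ.toAddMonoidHom).comp
    (Finsupp.mapDomain.addMonoidHom fun p : ℤ × ℤ => p.1 + p.2)).comp
    (finsuppTensorFinsupp ℤ ℤ M N ℤ ℤ).toLinearMap.toAddMonoidHom).comp
    (TensorProduct.map (components M.isInternal).toIntLinearMap
      (components N.isInternal).toIntLinearMap).toAddMonoidHom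

lemma preTensorComponents_tmul {i j : ℤ} {m : M} {n : N} (hm : m ∈ M.grading i)
    (hn : n ∈ N.grading j) :
    preTensorComponents f M N (m ⊗ₜ[ℤ] n) = Finsupp.single (i + j) (tmul f M N m n) := by
  simp [preTensorComponents, components_of_mem M.isInternal hm, components_of_mem N.isInternal hn,
    Finsupp.mapDomain_single, tmul]

lemma preTensorComponents_rel (x : M ⊗[ℤ] N) (hx : x ∈ tensorRel f M N) :
    preTensorComponents f M N x = 0 := by
  obtain ⟨i, j, a, m, n, ha, hm, rfl⟩ := hx
  obtain ⟨n, rfl⟩ := N.isInternal.2 n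
  rw [map_sub, sub_eq_zero]
  induction n using DirectSum.induction_on with
  | zero => simp
  | add x y hx hy => simp only [map_add, TensorProduct.tmul_add, smul_add, hx, hy]
  | of k n =>
    have hm' : (i * j).negOnePow • (f.toRingHom a • m) ∈ M.grading (i + j) := by
      rw [Units.smul_def]
      exact zsmul_mem (M.smul_mem (f.map_mem ha) hm) _
    rw [DirectSum.coeAddMonoidHom_of, preTensorComponents_tmul f M N hm' n.2,
      preTensorComponents_tmul f M N hm (N.smul_mem ha n.2), tmul_rel _ ha hm, tmul_unit_left]
    congr 1
    ring

lemma tensor_isInternal : DirectSum.IsInternal (tensorGrading f M N) := by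
  refine isInternal_of_components
    (tensorLift (preTensorComponents f M N) (preTensorComponents_rel f M N)) ?_ ?_
  · intro k x hx
    induction hx using AddSubgroup.closure_induction with
    | zero => simp
    | add x y _ _ hx hy => simp [hx, hy]
    | neg x _ hx => simp [hx]
    | mem x hx =>
      obtain ⟨i, j, m, n, rfl, hm, hn, rfl⟩ := hx
      rw [tensorLift_tmul, preTensorComponents_tmul f M N hm hn]
  · rw [eq_top_iff]
    intro x _
    induction x using tensor_induction with
    | hz => exact zero_mem _
    | ha x y hx hy => exact add_mem (hx trivial) (hy trivial)
    | ht i j m n hm hn => exact AddSubgroup.mem_iSup_of_mem (i + j) (tmul_mem rfl hm hn)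

/-- Auxiliary: the differential on `M ⊗ N`, with values in `M ⊗_A N`:
`m ⊗ n` is sent to `d m ⊗ n + (-1) ^ i • (m ⊗ d n)` for `m` of degree `i`. -/
noncomputable def preTensorD : M ⊗[ℤ] N →+ TensorCarrier f M N :=
  (tensorRelSubmodule f M N).mkQ.toAddMonoidHom.comp
    (TensorProduct.map M.d.toIntLinearMap LinearMap.id +
      TensorProduct.map (signed M.isInternal).toIntLinearMap N.d.toIntLinearMap).toAddMonoidHom

lemma preTensorD_tmul {i : ℤ} {m : M} (hm : m ∈ M.grading i) (n : N) :
    preTensorD f M N (m ⊗ₜ[ℤ] n) = tmul f M N (M.d m) n + i.negOnePow • tmul f M N m (N.d n) := by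
  rw [← tmul_unit_left, ← signed_of_mem M.isInternal hm]
  rfl

lemma preTensorD_rel (x : M ⊗[ℤ] N) (hx : x ∈ tensorRel f M N) : preTensorD f M N x = 0 := by
  obtain ⟨i, j, a, m, n, ha, hm, rfl⟩ := hx
  have hm' : (i * j).negOnePow • (f.toRingHom a • m) ∈ M.grading (i + j) := by
    rw [Units.smul_def]
    exact zsmul_mem (M.smul_mem (f.map_mem ha) hm) _
  have hd : M.d ((i * j).negOnePow • (f.toRingHom a • m))
      = (i * j).negOnePow • M.d (f.toRingHom a • m) := by
    rw [Units.smul_def, map_zsmul]; rfl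
  have hj : ((j.negOnePow : ℤˣ) : ℤ) * (j.negOnePow : ℤˣ) = 1 := by
    rw [← Units.val_mul, Int.units_mul_self, Units.val_one]
  rw [map_sub, preTensorD_tmul f M N hm', preTensorD_tmul f M N hm, hd,
    M.leibniz (f.map_mem ha), N.leibniz ha, ← f.map_d, tmul_add_right, tmul_unit_right,
    tmul_rel _ ha (M.d_mem hm), tmul_rel _ (A.d_mem ha) hm, tmul_rel _ ha hm,
    tmul_unit_left, tmul_unit_left, tmul_add_left, tmul_unit_left]
  simp only [Units.smul_def, mul_add, add_mul, one_mul, mul_one, Int.negOnePow_add, Units.val_mul]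
  generalize ((j.negOnePow : ℤˣ) : ℤ) = e at *
  match_scalars <;>
    first
    | ring1
    | linear_combination (((i * j).negOnePow : ℤˣ) : ℤ) * hj
    | linear_combination (-(((i * j).negOnePow : ℤˣ) : ℤ)) * hj

/-- For a homomorphism `f : A → B` of commutative DG rings, a DG `B`-module `M` and a DG
`A`-module `N`, the DG `B`-module `M ⊗_A N`. For `f` the identity this is the tensor product of
DG `A`-modules; for `M = B` it is the base change `B ⊗_A N`. -/
noncomputable def tensor : DGModule B where
  carrier := TensorCarrier f M N
  grading := tensorGrading f M N
  isInternal := tensor_isInternal f M N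
  smul_mem := by
    intro i k b x hb hx
    induction hx using AddSubgroup.closure_induction with
    | zero => simp
    | add x y _ _ hx hy => rw [smul_add]; exact add_mem hx hy
    | neg x _ hx => rw [smul_neg]; exact neg_mem hx
    | mem x hx =>
      obtain ⟨p, q, m, n, rfl, hm, hn, rfl⟩ := hx
      rw [smul_tmul]
      exact tmul_mem (by ring) (M.smul_mem hb hm) hn
  d := tensorLift (preTensorD f M N) (preTensorD_rel f M N)
  d_mem := by
    intro k x hx
    induction hx using AddSubgroup.closure_induction with
    | zero => simp
    | add x y _ _ hx hy => rw [map_add]; exact add_mem hx hy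
    | neg x _ hx => rw [map_neg]; exact neg_mem hx
    | mem x hx =>
      obtain ⟨p, q, m, n, rfl, hm, hn, rfl⟩ := hx
      rw [tensorLift_tmul, preTensorD_tmul f M N hm, Units.smul_def]
      exact add_mem (tmul_mem (by ring) (M.d_mem hm) hn)
        (zsmul_mem (tmul_mem (by ring) hm (N.d_mem hn)) _)
  d_d := by
    intro x
    induction x using tensor_induction with
    | hz => simp
    | ha x y hx hy => rw [map_add, map_add, hx, hy, add_zero]
    | ht i j m n hm hn =>
      rw [tensorLift_tmul, preTensorD_tmul f M N hm, map_add, Units.smul_def, map_zsmul,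
        tensorLift_tmul, tensorLift_tmul, preTensorD_tmul f M N hm,
        preTensorD_tmul f M N (M.d_mem hm), M.d_d, N.d_d, Int.negOnePow_succ]
      simp [tmul, Units.smul_def]
  leibniz := by
    intro i b hb x
    induction x using tensor_induction with
    | hz => simp
    | ha x y hx hy => simp only [map_add, smul_add, hx, hy]; abel
    | ht p q m n hm hn =>
      rw [smul_tmul, tensorLift_tmul, tensorLift_tmul, preTensorD_tmul f M N hm,
        preTensorD_tmul f M N (M.smul_mem hb hm), M.leibniz hb, tmul_add_left, tmul_unit_left,
        smul_add, smul_add, smul_comm b, smul_tmul, smul_tmul, smul_tmul, smul_smul,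
        Int.negOnePow_add, add_assoc]

end Tensor

/-- A DG `A`-module `P` is K-flat if `N ⊗_A P` is acyclic for every acyclic DG module `N`. -/
def KFlat (P : DGModule A) : Prop :=
  ∀ N : DGModule A, N.Acyclic → (tensor (CommDGRing.Hom.id A) N P).Acyclic

/-- `IsDerivedTensor f M N T`: the DG `B`-module `T` is isomorphic in `D(B)` to the derived tensor
product `M ⊗ᴸ_A N`, that is, to `M ⊗_A N'` for a K-flat resolution `N' → N` over `A`. -/
def IsDerivedTensor (f : CommDGRing.Hom A B) (M : DGModule B) (N : DGModule A)
    (T : DGModule B) : Prop :=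
  ∃ (N' : DGModule A) (s : N' ⟶ N), N'.KFlat ∧ quasiIso A s ∧
    Nonempty ((tensor f M N').toDerived ≅ T.toDerived)

/-- `P` is a tilting DG module if `P ⊗ᴸ_A Q ≅ A` in `D(A)` for some DG module `Q`. -/
def IsTilting (P : DGModule A) : Prop :=
  ∃ Q : DGModule A, IsDerivedTensor (CommDGRing.Hom.id A) P Q (self A)

variable (A) in
/-- Isomorphism in `D(A)`, as an equivalence relation on the tilting DG modules. -/
def tiltingSetoid : Setoid {P : DGModule A // P.IsTilting} where
  r P Q := Nonempty (P.1.toDerived ≅ Q.1.toDerived)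
  iseqv := ⟨fun _ => ⟨Iso.refl _⟩, fun ⟨e⟩ => ⟨e.symm⟩, fun ⟨e⟩ ⟨e'⟩ => ⟨e ≪≫ e'⟩⟩

end DGModule

/-- The set underlying the commutative derived Picard group: the isomorphism classes in `D(A)` of
tilting DG `A`-modules. -/
def DPic (A : CommDGRing.{u}) : Type (u + 1) := Quotient (DGModule.tiltingSetoid A)

/-- The class of a tilting DG module. -/
def DPic.mk {A : CommDGRing.{u}} (P : DGModule A) (hP : P.IsTilting) : DPic A :=
  Quotient.mk (DGModule.tiltingSetoid A) ⟨P, hP⟩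

/-- The group structure on `DPic A` is the one with multiplication induced by `⊗ᴸ_A` and with unit
the class of `A`. -/
structure IsDPicGroup (A : CommDGRing.{u}) (g : CommGroup (DPic A)) : Prop where
  mul_iff : ∀ (P Q R : DGModule A) (hP : P.IsTilting) (hQ : Q.IsTilting) (hR : R.IsTilting),
    DPic.mk P hP * DPic.mk Q hQ = DPic.mk R hR ↔
      DGModule.IsDerivedTensor (CommDGRing.Hom.id A) P Q R
  one_iff : ∀ (P : DGModule A) (hP : P.IsTilting),
    1 = DPic.mk P hP ↔ Nonempty (P.toDerived ≅ (DGModule.self A).toDerived)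

namespace CommDGRing

/-- A commutative ring, as a DG ring concentrated in degree `0`. -/
def ofCommRing (R : Type u) [CommRing R] : CommDGRing.{u} where
  carrier := R
  grading i := if i = 0 then ⊤ else ⊥
  isInternal := by
    refine isInternal_of_components (Finsupp.singleAddHom 0) ?_ ?_
    · intro i x hx
      by_cases hi : i = 0
      · subst hi; rfl
      · rw [if_neg hi, AddSubgroup.mem_bot] at hx
        simp [hx]
    · rw [eq_top_iff]
      exact le_iSup_of_le 0 (by simp)
  one_mem := by simp
  mul_mem := by
    intro i j a b ha hb
    by_cases hi : i = 0
    · by_cases hj : j = 0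
      · simp [hi, hj]
      · rw [if_neg hj, AddSubgroup.mem_bot] at hb
        rw [hb, mul_zero]; exact zero_mem _
    · rw [if_neg hi, AddSubgroup.mem_bot] at ha
      rw [ha, zero_mul]; exact zero_mem _
  d := 0
  d_mem _ := zero_mem _
  d_d _ := rfl
  leibniz := by simp
  nonpos hi := if_neg hi.ne'
  mul_comm_sign := by
    intro i j a b ha hb
    by_cases hi : i = 0
    · simp [hi, mul_comm]
    · rw [if_neg hi, AddSubgroup.mem_bot] at ha
      simp [ha]
  mul_self_of_odd := by
    intro i a hi ha
    have : i ≠ 0 := by rintro rfl; simp at hi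
    rw [if_neg this, AddSubgroup.mem_bot] at ha
    simp [ha]

variable (A : CommDGRing.{u})

lemma d_one : A.d 1 = 0 := by
  simpa using A.leibniz A.one_mem 1

/-- The ring of cocycles of degree `0`. -/
def Z0 : Subring A where
  carrier := {a | a ∈ A.grading 0 ∧ A.d a = 0}
  mul_mem' := by
    rintro a b ⟨ha, ha'⟩ ⟨hb, hb'⟩
    exact ⟨by simpa using A.mul_mem ha hb, by rw [A.leibniz ha, ha', hb']; simp⟩
  one_mem' := ⟨A.one_mem, A.d_one⟩
  add_mem' := by
    rintro a b ⟨ha, ha'⟩ ⟨hb, hb'⟩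
    exact ⟨add_mem ha hb, by rw [map_add, ha', hb', add_zero]⟩
  zero_mem' := ⟨zero_mem _, map_zero _⟩
  neg_mem' := by
    rintro a ⟨ha, ha'⟩
    exact ⟨neg_mem ha, by rw [map_neg, ha', neg_zero]⟩

instance : CommRing A.Z0 :=
  { (inferInstance : Ring A.Z0) with
    mul_comm := by
      rintro ⟨a, ha⟩ ⟨b, hb⟩
      refine Subtype.ext ?_
      simpa using A.mul_comm_sign hb.1 ha.1 }

/-- The ideal of coboundaries of degree `0`. -/
def B0 : Ideal A.Z0 where
  carrier := {z | ∃ b ∈ A.grading (-1), A.d b = z}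
  add_mem' := by
    rintro x y ⟨a, ha, hax⟩ ⟨b, hb, hby⟩
    exact ⟨a + b, add_mem ha hb, by rw [map_add, hax, hby]; rfl⟩
  zero_mem' := ⟨0, zero_mem _, by simp⟩
  smul_mem' := by
    rintro z x ⟨b, hb, hbx⟩
    refine ⟨z * b, by simpa using A.mul_mem z.2.1 hb, ?_⟩
    rw [A.leibniz z.2.1, z.2.2, hbx]
    simp

/-- The commutative ring `Ā = H⁰(A)`. -/
abbrev H0 : Type u := A.Z0 ⧸ A.B0

/-- The ring `Ā`, as a DG ring. -/
abbrev bar : CommDGRing.{u} := ofCommRing A.H0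

/-- The projection of `A` to its degree `0` component. -/
noncomputable def proj0 : A →+ A := (Finsupp.applyAddHom 0).comp (components A.isInternal)

lemma proj0_of_mem_zero {a : A} (ha : a ∈ A.grading 0) : A.proj0 a = a := by
  simp [proj0, components_of_mem A.isInternal ha]

lemma proj0_of_mem_ne {i : ℤ} (hi : i ≠ 0) {a : A} (ha : a ∈ A.grading i) : A.proj0 a = 0 := by
  simp [proj0, components_of_mem A.isInternal ha, hi]

lemma hom_induction {p : A → Prop} (hz : p 0) (hm : ∀ i, ∀ a ∈ A.grading i, p a)
    (ha : ∀ a b, p a → p b → p (a + b)) (a : A) : p a := by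
  obtain ⟨y, rfl⟩ := A.isInternal.2 a
  induction y using DirectSum.induction_on with
  | zero => simpa using hz
  | of i x => simpa using hm i x x.2
  | add x y hx hy => rw [map_add]; exact ha _ _ hx hy

lemma proj0_mem (a : A) : A.proj0 a ∈ A.Z0 := by
  induction a using hom_induction with
  | hz => rw [map_zero]; exact zero_mem _
  | ha a b ha hb => rw [map_add]; exact add_mem ha hb
  | hm i a ha =>
    by_cases hi : i = 0
    · subst hi
      rw [A.proj0_of_mem_zero ha]
      have h1 := A.d_mem ha
      rw [zero_add, A.nonpos one_pos, AddSubgroup.mem_bot] at h1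
      exact ⟨ha, h1⟩
    · rw [A.proj0_of_mem_ne hi ha]; exact zero_mem _

lemma proj0_mul (a b : A) : A.proj0 (a * b) = A.proj0 a * A.proj0 b := by
  induction a using hom_induction with
  | hz => simp
  | ha x y hx hy => rw [add_mul, map_add, hx, hy, map_add, add_mul]
  | hm i a ha =>
    induction b using hom_induction with
    | hz => simp
    | ha x y hx hy => rw [mul_add, map_add, hx, hy, map_add, mul_add]
    | hm j b hb =>
      rcases lt_or_ge 0 i with hi | hi
      · rw [A.nonpos hi, AddSubgroup.mem_bot] at ha
        simp [ha]
      rcases lt_or_ge 0 j with hj | hj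
      · rw [A.nonpos hj, AddSubgroup.mem_bot] at hb
        simp [hb]
      by_cases hi0 : i = 0
      · subst hi0
        by_cases hj0 : j = 0
        · subst hj0
          rw [A.proj0_of_mem_zero ha, A.proj0_of_mem_zero hb,
            A.proj0_of_mem_zero (by simpa using A.mul_mem ha hb)]
        · rw [A.proj0_of_mem_ne hj0 hb, A.proj0_of_mem_ne (by omega) (A.mul_mem ha hb), mul_zero]
      · rw [A.proj0_of_mem_ne hi0 ha, A.proj0_of_mem_ne (by omega) (A.mul_mem ha hb), zero_mul]

/-- The canonical homomorphism `A → Ā`: it is zero in negative degrees, and sends an element of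
degree `0` (automatically a cocycle) to its cohomology class. -/
noncomputable def toBar : Hom A A.bar where
  toRingHom := (Ideal.Quotient.mk A.B0).comp
    { toFun := fun a => ⟨A.proj0 a, A.proj0_mem a⟩
      map_one' := Subtype.ext (A.proj0_of_mem_zero A.one_mem)
      map_mul' := fun a b => Subtype.ext (A.proj0_mul a b)
      map_zero' := Subtype.ext (map_zero _)
      map_add' := fun a b => Subtype.ext (map_add _ a b) }
  map_mem := by
    intro i a ha
    by_cases hi : i = 0
    · subst hi; exact AddSubgroup.mem_top _
    · have h : (⟨A.proj0 a, A.proj0_mem a⟩ : A.Z0) = 0 := Subtype.ext (A.proj0_of_mem_ne hi ha)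
      change Ideal.Quotient.mk A.B0 ⟨A.proj0 a, A.proj0_mem a⟩ ∈ _
      rw [h, map_zero]
      exact zero_mem _
  map_d := by
    intro a
    change Ideal.Quotient.mk A.B0 ⟨A.proj0 (A.d a), A.proj0_mem (A.d a)⟩ = 0
    rw [Ideal.Quotient.eq_zero_iff_mem]
    change ∃ b ∈ A.grading (-1), A.d b = A.proj0 (A.d a)
    induction a using hom_induction with
    | hz => exact ⟨0, zero_mem _, by simp⟩
    | ha x y hx hy =>
      obtain ⟨b, hb, hbx⟩ := hx
      obtain ⟨c, hc, hcy⟩ := hy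
      exact ⟨b + c, add_mem hb hc, by rw [map_add, map_add, map_add, hbx, hcy]⟩
    | hm i a ha =>
      by_cases hi : i = -1
      · subst hi
        exact ⟨a, ha, (A.proj0_of_mem_zero (by simpa using A.d_mem ha)).symm⟩
      · exact ⟨0, zero_mem _, by
          rw [A.proj0_of_mem_ne (i := i + 1) (by omega) (A.d_mem ha), map_zero]⟩

end CommDGRing

end DG

/-! Isomorphism classes in `D(A)` form a commutative monoid `DMon A` under the derived tensor
product, and `DPic A` is its group of units (`DMon.isTilting_iff`, `DPic.equivUnits`). Derived base
change along `A → Ā` is a homomorphism of these monoids, so a homomorphism of unit groups comes for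
free. The content is its bijectivity, `DMon.units_baseChange_bijective`.

Two facts carry both halves. First, an invertible `M` has finitely generated cohomology
(`exists_finite_generation`): if `M ⊗ Q ≅ A`, a generator of the cohomology of `M ⊗ Q` involves only
finitely many elements of `M`, and the DG submodule they generate already surjects onto the
cohomology of `M`. As `A` lives in nonpositive degrees, the cohomology of `M` is then bounded above
(`exists_exactAt_of_isUnit`). Second, derived Nakayama: if `M` lives in degrees at most `k`, then
`Ā` acts on `H^k(M)`, and this action gives a map from `Ā ⊗ M` to `H^k(M)` that sends `1 ⊗ m` to the
class of `m` and kills coboundaries. So `H^k(M)` injects into `H^k(Ā ⊗ M)`, and descending induction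
on the degree bounds the cohomology of `M` by that of its base change.

Injectivity: if `M` is bounded above and reduces to `Ā`, a generator of `H^0(Ā ⊗ M)` lifts to a
cocycle of `M` of degree `0`. The cone of the resulting map `A → M` is bounded above with acyclic
base change, hence acyclic (`deq_self_of_ltensor_toBar`).

Surjectivity: let `M` be invertible over a commutative ring `R`, with inverse `N`. Over a local
ring, the top cohomologies of `M` and `N` are finite and nonzero, so a product of top classes
survives in the residue field; hence their degrees are opposite and the product is nonzero modulo
the maximal ideal. Localizing, the unit class of `N ⊗ M` is a sum of products of cocycles
(`exists_sum_cocycleProducts`). The dual basis argument turns this sum into finitely many generators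
of `H(M)` and a matrix over `R` that kills the relations between the generators and fixes the
generators modulo coboundaries (`exists_projector`). Such an `M` is the telescope, that is the
homotopy colimit, of the matrix acting on a finite free graded module (`Projector.deq_telescope`).

A telescope makes sense for every degree-preserving matrix, idempotent or not, and commutes with
base change. So for `R = Ā` it suffices to lift the entries of the matrix to cocycles of `A`
(`DMon.exists_lift`). Lifts of `M` and of its inverse have a tensor product that is bounded above
and reduces to `Ā`, hence is isomorphic to `A`, so the lift of `M` is invertible.

The foundations serve to make sense of this in a bare localization. Functorial semi-free resolutions
compute derived tensor products, and natural endomorphisms of the total cohomology show that degrees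
and multiplication by cocycles are respected by isomorphisms in `D(A)`. -/

namespace DG
open CategoryTheory
open scoped TensorProduct

/-! ### Internally graded groups: homogeneous components and signs. -/

section Graded

variable {X Y : Type u} [AddCommGroup X] [AddCommGroup Y] {G : ℤ → AddSubgroup X}
  {G' : ℤ → AddSubgroup Y}

lemma map_unit_smul {X Y F : Type*} [AddCommGroup X] [AddCommGroup Y] [FunLike F X Y]
    [AddMonoidHomClass F X Y] (φ : F) (e : ℤˣ) (x : X) : φ (e • x) = e • φ x := by
  rw [Units.smul_def, Units.smul_def, map_zsmul]

lemma unit_smul_mem {X S : Type*} [AddCommGroup X] [SetLike S X] [AddSubgroupClass S X] (H : S)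
    (e : ℤˣ) {x : X} (hx : x ∈ H) : e • x ∈ H := by
  rw [Units.smul_def]; exact zsmul_mem hx _

lemma graded_induction (h : DirectSum.IsInternal G) {p : X → Prop} (hz : p 0)
    (hm : ∀ i, ∀ x ∈ G i, p x) (ha : ∀ x y, p x → p y → p (x + y)) (x : X) : p x := by
  obtain ⟨y, rfl⟩ := h.2 x
  induction y using DirectSum.induction_on with
  | zero => simpa using hz
  | of i x => simpa using hm i x x.2
  | add x y hx hy => rw [map_add]; exact ha _ _ hx hy

/-- The homogeneous component of degree `i`. -/
noncomputable def comp (h : DirectSum.IsInternal G) (i : ℤ) : X →+ X :=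
  (Finsupp.applyAddHom i).comp (components h)

lemma comp_of_mem (h : DirectSum.IsInternal G) {i : ℤ} {x : X} (hx : x ∈ G i) :
    comp h i x = x := by
  simp [comp, components_of_mem h hx]

lemma comp_of_mem_ne (h : DirectSum.IsInternal G) {i j : ℤ} {x : X} (hx : x ∈ G i) (hij : i ≠ j) :
    comp h j x = 0 := by
  simp [comp, components_of_mem h hx, hij]

lemma comp_mem (h : DirectSum.IsInternal G) (i : ℤ) (x : X) : comp h i x ∈ G i := by
  induction x using graded_induction h with
  | hz => rw [map_zero]; exact zero_mem _
  | ha x y hx hy => rw [map_add]; exact add_mem hx hy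
  | hm j x hx =>
    by_cases hij : j = i
    · subst hij; rwa [comp_of_mem h hx]
    · rw [comp_of_mem_ne h hx hij]; exact zero_mem _

lemma sum_components (h : DirectSum.IsInternal G) (x : X) :
    (components h x).sum (fun _ y => y) = x := by
  have : (Finsupp.liftAddHom fun _ : ℤ => AddMonoidHom.id X).comp (components h)
      = AddMonoidHom.id X := by
    refine hom_ext h fun i x hx => ?_
    simp [components_of_mem h hx]
  exact DFunLike.congr_fun this x

lemma map_comp (h : DirectSum.IsInternal G) (h' : DirectSum.IsInternal G') (φ : X →+ Y) (k : ℤ)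
    (hφ : ∀ i, ∀ x ∈ G i, φ x ∈ G' (i + k)) (i : ℤ) (x : X) :
    comp h' (i + k) (φ x) = φ (comp h i x) := by
  have : (comp h' (i + k)).comp φ = φ.comp (comp h i) := by
    refine hom_ext h fun j x hx => ?_
    by_cases hij : j = i
    · subst hij
      simp [comp_of_mem h hx, comp_of_mem h' (hφ _ _ hx)]
    · simp [comp_of_mem_ne h hx hij, comp_of_mem_ne h' (hφ _ _ hx) (j := i + k) (by omega)]
  exact DFunLike.congr_fun this x

lemma map_comp_zero (h : DirectSum.IsInternal G) (h' : DirectSum.IsInternal G') (φ : X →+ Y)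
    (hφ : ∀ i, ∀ x ∈ G i, φ x ∈ G' i) (i : ℤ) (x : X) :
    comp h' i (φ x) = φ (comp h i x) := by
  have := map_comp h h' φ 0 (by simpa using hφ) i x
  rwa [add_zero] at this

/-- The automorphism that is multiplication by `(-1) ^ (k * i)` in degree `i`. -/
noncomputable def sgn (h : DirectSum.IsInternal G) (k : ℤ) : X →+ X :=
  (Finsupp.liftAddHom fun i : ℤ =>
    (DistribSMul.toAddMonoidHom X ((k * i).negOnePow : ℤˣ) : X →+ X)).comp (components h)

lemma sgn_of_mem (h : DirectSum.IsInternal G) (k : ℤ) {i : ℤ} {x : X} (hx : x ∈ G i) :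
    sgn h k x = (k * i).negOnePow • x := by
  simp [sgn, components_of_mem h hx]

lemma negOnePow_eq {m n : ℤ} (c : ℤ) (h : m - n = 2 * c) : m.negOnePow = n.negOnePow := by
  rw [Int.negOnePow_eq_iff]; exact ⟨c, by rw [h]; ring⟩

lemma signed_mem (h : DirectSum.IsInternal G) {i : ℤ} {x : X} (hx : x ∈ G i) :
    signed h x ∈ G i := by
  rw [signed_of_mem h hx]; exact unit_smul_mem _ _ hx

lemma signed_signed (h : DirectSum.IsInternal G) (x : X) : signed h (signed h x) = x := by
  have : (signed h).comp (signed h) = AddMonoidHom.id X := by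
    refine hom_ext h fun i x hx => ?_
    simp [signed_of_mem h hx, smul_smul]
  exact DFunLike.congr_fun this x

/-- Independence of the pieces can be tested in `X`, where the component projections exist; only
generation has to be supplied. Used for DG submodules. -/
lemma isInternal_of_injective {X Y : Type u} [AddCommGroup X] [AddCommGroup Y]
    {G : ℤ → AddSubgroup X} {G' : ℤ → AddSubgroup Y} (h : DirectSum.IsInternal G) (φ : Y →+ X)
    (hφ : Function.Injective φ) (hG : ∀ i, ∀ y ∈ G' i, φ y ∈ G i) (ht : ⨆ i, G' i = ⊤) :
    DirectSum.IsInternal G' := by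
  constructor
  · have key : ∀ (y : DirectSum ℤ fun i => G' i) (n : ℤ),
        comp h n (φ (DirectSum.coeAddMonoidHom G' y)) = φ (y n) := by
      intro y n
      induction y using DirectSum.induction_on with
      | zero => simp
      | of i x =>
        by_cases hin : i = n
        · subst hin; simp [comp_of_mem h (hG _ _ x.2)]
        · simp [comp_of_mem_ne h (hG _ _ x.2) hin,
            DirectSum.of_eq_of_ne (β := fun i => G' i) i n x (Ne.symm hin)]
      | add x y hx hy => simp [hx, hy]
    intro y z hyz
    refine DFinsupp.ext fun n => Subtype.ext (hφ ?_)
    rw [← key y n, ← key z n, hyz]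
  · intro x
    have hx : x ∈ ⨆ i, G' i := ht ▸ AddSubgroup.mem_top x
    induction hx using AddSubgroup.iSup_induction' with
    | hp i x hx => exact ⟨DirectSum.of (fun i => G' i) i ⟨x, hx⟩, by simp⟩
    | h1 => exact ⟨0, by simp⟩
    | hadd x y _ _ hx hy =>
      obtain ⟨a, rfl⟩ := hx
      obtain ⟨b, rfl⟩ := hy
      exact ⟨a + b, by simp⟩

end Graded

/-! ### Acyclicity and quasi-isomorphisms in terms of elements. -/

namespace DGModule

variable {A B : CommDGRing.{u}}

lemma comp_d (M : DGModule A) (i : ℤ) (x : M) :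
    M.d (comp M.isInternal i x) = comp M.isInternal (i + 1) (M.d x) :=
  (map_comp M.isInternal M.isInternal M.d 1 (fun _ _ h => M.d_mem h) i x).symm

lemma comp_map {M N : DGModule A} (f : M ⟶ N) (i : ℤ) (x : M) :
    comp N.isInternal i (f.toLinearMap x) = f.toLinearMap (comp M.isInternal i x) :=
  map_comp_zero M.isInternal N.isInternal f.toLinearMap.toAddMonoidHom
    (fun _ _ h => f.map_mem h) i x

/-- Since `d` has degree `1`, the component of degree `i - 1` of any primitive is again a primitive.
Degrees of primitives can therefore be ignored below. -/
lemma exists_homogeneous_primitive (M : DGModule A) {i : ℤ} {x w : M} (hx : x ∈ M.grading i)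
    (hw : M.d w = x) : ∃ v ∈ M.grading (i - 1), M.d v = x := by
  refine ⟨comp M.isInternal (i - 1) w, comp_mem _ _ _, ?_⟩
  rw [comp_d, hw, sub_add_cancel, comp_of_mem _ hx]

/-- A cocycle is the finite sum of its homogeneous components, each of them a cocycle, so exactness
can be tested without reference to degrees. -/
lemma acyclic_iff (M : DGModule A) : M.Acyclic ↔ ∀ x, M.d x = 0 → ∃ w, M.d w = x := by
  constructor
  · intro h x hx
    have key : ∀ i, ∃ w, M.d w = comp M.isInternal i x := by
      intro i
      have hc : comp M.isInternal i x ∈ M.cocycles i :=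
        ⟨comp_mem _ _ _, by
          change M.d _ = 0
          rw [comp_d, hx, map_zero]⟩
      have := (h i).elim (QuotientAddGroup.mk ⟨_, hc⟩) 0
      rw [QuotientAddGroup.eq_zero_iff, AddSubgroup.mem_addSubgroupOf] at this
      obtain ⟨w, _, hw⟩ := this
      exact ⟨w, hw⟩
    rw [← sum_components M.isInternal x]
    exact AddMonoidHom.mem_range.1 (sum_mem fun i _ => AddMonoidHom.mem_range.2 (key i))
  · intro h i
    refine ⟨fun a b => ?_⟩
    have : ∀ a : M.cohomology i, a = 0 := by
      intro a
      induction a using QuotientAddGroup.induction_on with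
      | H x =>
        rw [QuotientAddGroup.eq_zero_iff, AddSubgroup.mem_addSubgroupOf]
        obtain ⟨w, hw⟩ := h x x.2.2
        obtain ⟨v, hv, hvx⟩ := M.exists_homogeneous_primitive x.2.1 hw
        exact ⟨v, hv, hvx⟩
    rw [this a, this b]

/-- Elementwise form of being a quasi-isomorphism, for ungraded cocycles. -/
structure IsQI {M N : DGModule A} (f : M ⟶ N) : Prop where
  inj : ∀ x, M.d x = 0 → (∃ w, N.d w = f.toLinearMap x) → ∃ v, M.d v = x
  surj : ∀ y, N.d y = 0 → ∃ x, M.d x = 0 ∧ ∃ w, y = f.toLinearMap x + N.d w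

lemma cohomologyMap_injective_iff {M N : DGModule A} (f : M ⟶ N) (i : ℤ) :
    Function.Injective (cohomologyMap f i) ↔ ∀ x ∈ M.grading i, M.d x = 0 →
      (∃ w, N.d w = f.toLinearMap x) → ∃ v, M.d v = x := by
  rw [injective_iff_map_eq_zero]
  constructor
  · intro h x hx hdx ⟨w, hw⟩
    have := h (QuotientAddGroup.mk ⟨x, hx, hdx⟩) (by
      change QuotientAddGroup.mk (cocyclesMap f i ⟨x, hx, hdx⟩) = 0
      rw [QuotientAddGroup.eq_zero_iff, AddSubgroup.mem_addSubgroupOf]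
      obtain ⟨v, hv, hvx⟩ := N.exists_homogeneous_primitive (f.map_mem hx) hw
      exact ⟨v, hv, hvx⟩)
    rw [QuotientAddGroup.eq_zero_iff, AddSubgroup.mem_addSubgroupOf] at this
    obtain ⟨w, _, hw⟩ := this
    exact ⟨w, hw⟩
  · intro h a ha
    induction a using QuotientAddGroup.induction_on with
    | H x =>
      change QuotientAddGroup.mk (cocyclesMap f i x) = 0 at ha
      rw [QuotientAddGroup.eq_zero_iff, AddSubgroup.mem_addSubgroupOf] at ha ⊢
      obtain ⟨w, _, hw⟩ := ha
      obtain ⟨v, hv⟩ := h x x.2.1 x.2.2 ⟨w, hw⟩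
      obtain ⟨v, hv, hvx⟩ := M.exists_homogeneous_primitive x.2.1 hv
      exact ⟨v, hv, hvx⟩

lemma cohomologyMap_surjective_iff {M N : DGModule A} (f : M ⟶ N) (i : ℤ) :
    Function.Surjective (cohomologyMap f i) ↔ ∀ y ∈ N.grading i, N.d y = 0 →
      ∃ x ∈ M.grading i, M.d x = 0 ∧ ∃ w, y = f.toLinearMap x + N.d w := by
  constructor
  · intro h y hy hdy
    obtain ⟨a, ha⟩ := h (QuotientAddGroup.mk ⟨y, hy, hdy⟩)
    induction a using QuotientAddGroup.induction_on with
    | H x =>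
      change QuotientAddGroup.mk (cocyclesMap f i x) = _ at ha
      rw [QuotientAddGroup.eq, AddSubgroup.mem_addSubgroupOf] at ha
      obtain ⟨w, _, hw⟩ := ha
      refine ⟨x, x.2.1, x.2.2, w, ?_⟩
      rw [hw]
      exact (add_neg_cancel_left (f.toLinearMap (x : M)) y).symm
  · intro h a
    induction a using QuotientAddGroup.induction_on with
    | H y =>
      obtain ⟨x, hx, hdx, w, hw⟩ := h y y.2.1 y.2.2
      refine ⟨QuotientAddGroup.mk ⟨x, hx, hdx⟩, ?_⟩
      change QuotientAddGroup.mk (cocyclesMap f i ⟨x, hx, hdx⟩) = _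
      rw [QuotientAddGroup.eq, AddSubgroup.mem_addSubgroupOf]
      have hw' : N.d w = -f.toLinearMap x + y := by rw [hw]; abel
      obtain ⟨v, hv, hvx⟩ := N.exists_homogeneous_primitive
        (add_mem (neg_mem (f.map_mem hx)) y.2.1) hw'
      exact ⟨v, hv, hvx⟩

lemma quasiIso_iff {M N : DGModule A} (f : M ⟶ N) : quasiIso A f ↔ IsQI f := by
  constructor
  · intro h
    have hi := fun i => (cohomologyMap_injective_iff f i).1 (h i).1
    have hs := fun i => (cohomologyMap_surjective_iff f i).1 (h i).2
    constructor
    · rintro x hx ⟨w, hw⟩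
      rw [← sum_components M.isInternal x]
      refine AddMonoidHom.mem_range.1 (sum_mem fun i _ => AddMonoidHom.mem_range.2 ?_)
      refine hi i _ (comp_mem _ _ _) ?_ ⟨comp N.isInternal (i - 1) w, ?_⟩
      · change M.d (comp M.isInternal i x) = 0
        rw [comp_d, hx, map_zero]
      · rw [comp_d, sub_add_cancel, hw, comp_map]; rfl
    · intro y hy
      -- Being of the form cocycle image plus coboundary is membership in a subgroup, so it can be
      -- checked on the homogeneous components of `y`.
      let S : AddSubgroup N := (M.d.ker).map f.toLinearMap.toAddMonoidHom ⊔ N.d.range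
      have : y ∈ S := by
        rw [← sum_components N.isInternal y]
        refine sum_mem fun i _ => ?_
        obtain ⟨x, _, hdx, w, hw⟩ := hs i (comp N.isInternal i y) (comp_mem _ _ _)
          (by rw [comp_d, hy, map_zero])
        change comp N.isInternal i y ∈ S
        rw [hw]
        exact AddSubgroup.add_mem_sup ⟨x, hdx, rfl⟩ ⟨w, rfl⟩
      obtain ⟨_, ⟨x, hx, rfl⟩, _, ⟨w, rfl⟩, h⟩ := AddSubgroup.mem_sup.1 this
      exact ⟨x, hx, w, h.symm⟩
  · intro h i
    refine ⟨(cohomologyMap_injective_iff f i).2 fun x _ => h.inj x,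
      (cohomologyMap_surjective_iff f i).2 fun y hy hdy => ?_⟩
    obtain ⟨x, hx, w, hw⟩ := h.surj y hdy
    refine ⟨comp M.isInternal i x, comp_mem _ _ _, by rw [comp_d, hx, map_zero],
      comp N.isInternal (i - 1) w, ?_⟩
    rw [comp_d, sub_add_cancel, ← comp_map, ← map_add, ← hw, comp_of_mem _ hy]

lemma comp_toLinearMap {M N P : DGModule A} (f : M ⟶ N) (g : N ⟶ P) (x : M) :
    (f ≫ g).toLinearMap x = g.toLinearMap (f.toLinearMap x) := rfl

lemma id_toLinearMap {M : DGModule A} (x : M) : (𝟙 M : M ⟶ M).toLinearMap x = x := rfl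

lemma hom_eq {M N : DGModule A} {f g : M ⟶ N} (h : ∀ x, f.toLinearMap x = g.toLinearMap x) :
    f = g := Hom.ext (LinearMap.ext h)

namespace IsQI

variable {M N P : DGModule A} {f : M ⟶ N} {g : N ⟶ P}

lemma of_bijective (h : Function.Bijective f.toLinearMap) : IsQI f where
  inj := by
    rintro x _ ⟨w, hw⟩
    obtain ⟨v, rfl⟩ := h.2 w
    exact ⟨v, h.1 (by rw [f.map_d, hw])⟩
  surj := by
    intro y hy
    obtain ⟨x, rfl⟩ := h.2 y
    exact ⟨x, h.1 (by rw [f.map_d, hy, map_zero]), 0, by simp⟩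

lemma comp (hf : IsQI f) (hg : IsQI g) : IsQI (f ≫ g) where
  inj x hx h := hf.inj x hx (hg.inj _ (by rw [← f.map_d, hx, map_zero]) h)
  surj y hy := by
    obtain ⟨x, hx, w, rfl⟩ := hg.surj y hy
    obtain ⟨x', hx', v, rfl⟩ := hf.surj x hx
    exact ⟨x', hx', g.toLinearMap v + w, by
      rw [map_add, map_add, comp_toLinearMap, g.map_d, add_assoc]⟩

lemma of_comp_right (hg : IsQI g) (h : IsQI (f ≫ g)) : IsQI f where
  inj x hx hw := h.inj x hx (by
    obtain ⟨w, hw⟩ := hw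
    exact ⟨g.toLinearMap w, by rw [← g.map_d, hw]; rfl⟩)
  surj y hy := by
    obtain ⟨x, hx, w, hw⟩ := h.surj (g.toLinearMap y) (by rw [← g.map_d, hy, map_zero])
    obtain ⟨v, hv⟩ := hg.inj (y - f.toLinearMap x)
      (by rw [map_sub, ← f.map_d, hy, hx, map_zero, sub_zero])
      ⟨w, by rw [map_sub, hw]; exact (add_sub_cancel_left _ _).symm⟩
    exact ⟨x, hx, v, by rw [hv]; abel⟩

lemma of_comp_left (hf : IsQI f) (h : IsQI (f ≫ g)) : IsQI g where
  inj y hy hw := by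
    obtain ⟨x, hx, w, rfl⟩ := hf.surj y hy
    obtain ⟨u, hu⟩ := hw
    obtain ⟨v, hv⟩ := h.inj x hx ⟨u - g.toLinearMap w, by
      rw [map_sub, hu, map_add, ← g.map_d]; exact add_sub_cancel_right _ _⟩
    exact ⟨f.toLinearMap v + w, by rw [map_add, ← f.map_d, hv]⟩
  surj z hz := by
    obtain ⟨x, hx, w, hw⟩ := h.surj z hz
    exact ⟨f.toLinearMap x, by rw [← f.map_d, hx, map_zero], w, hw⟩

lemma acyclic (hf : IsQI f) (h : N.Acyclic) : M.Acyclic := by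
  rw [acyclic_iff] at *
  intro x hx
  exact hf.inj x hx (h _ (by rw [← f.map_d, hx, map_zero]))

lemma acyclic' (hf : IsQI f) (h : M.Acyclic) : N.Acyclic := by
  rw [acyclic_iff] at *
  intro y hy
  obtain ⟨x, hx, w, rfl⟩ := hf.surj y hy
  obtain ⟨v, rfl⟩ := h x hx
  exact ⟨f.toLinearMap v + w, by rw [map_add, ← f.map_d]⟩

end IsQI

/-- Vanishing of the cohomology in degree `i`, elementwise. -/
def ExactAt (M : DGModule A) (i : ℤ) : Prop := ∀ x ∈ M.grading i, M.d x = 0 → ∃ w, M.d w = x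

lemma acyclic_iff_exactAt (M : DGModule A) : M.Acyclic ↔ ∀ i, M.ExactAt i := by
  rw [acyclic_iff]
  refine ⟨fun h i x _ => h x, fun h x hx => ?_⟩
  rw [← sum_components M.isInternal x]
  refine AddMonoidHom.mem_range.1 (sum_mem fun i _ => AddMonoidHom.mem_range.2 ?_)
  exact h i (comp M.isInternal i x) (comp_mem _ _ _) (by rw [comp_d, hx, map_zero])

end DGModule
end DG

/-! ### Tensor products: universal property, unit, symmetry, restriction of scalars, associativity.
-/

namespace DG
open CategoryTheory
open scoped TensorProduct

/-- The half-difference `c` of the exponents is an explicit argument, so that comparing two Koszul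
signs becomes a `ring` identity. -/
lemma sign_smul_congr {X : Type*} [AddCommGroup X] {m n : ℤ} (c : ℤ) (h : m - n = 2 * c) (x : X) :
    m.negOnePow • x = n.negOnePow • x := by
  rw [negOnePow_eq c h]

namespace DGModule

variable {A B C : CommDGRing.{u}}

section Tensor

variable (f : CommDGRing.Hom A B) (M : DGModule B) (N : DGModule A)

/-- The biadditive map `M × N → M ⊗_A N`. -/
noncomputable def tm : M →+ N →+ tensor f M N :=
  AddMonoidHom.mk' (fun m => AddMonoidHom.mk' (fun n => (tmul f M N m n : TensorCarrier f M N))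
    fun n n' => tmul_add_right m n n')
    fun m m' => AddMonoidHom.ext fun n => tmul_add_left m m' n

variable {f M N}

lemma tm_smul_right {i j : ℤ} {a : A} {m : M} (n : N) (ha : a ∈ A.grading i)
    (hm : m ∈ M.grading j) :
    tm f M N m (a • n) = (i * j).negOnePow • tm f M N (f.toRingHom a • m) n :=
  tmul_rel n ha hm

lemma tm_smul_left {i j : ℤ} {a : A} {m : M} (n : N) (ha : a ∈ A.grading i)
    (hm : m ∈ M.grading j) :
    tm f M N (f.toRingHom a • m) n = (i * j).negOnePow • tm f M N m (a • n) := by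
  rw [tm_smul_right n ha hm, smul_smul, Int.units_mul_self, one_smul]

lemma smul_tm (b : B) (m : M) (n : N) : b • tm f M N m n = tm f M N (b • m) n := rfl

lemma tm_mem {i j k : ℤ} (h : i + j = k) {m : M} {n : N} (hm : m ∈ M.grading i)
    (hn : n ∈ N.grading j) : tm f M N m n ∈ (tensor f M N).grading k :=
  tmul_mem h hm hn

lemma d_tm {i : ℤ} {m : M} (hm : m ∈ M.grading i) (n : N) :
    (tensor f M N).d (tm f M N m n)
      = tm f M N (M.d m) n + i.negOnePow • tm f M N m (N.d n) :=
  (tensorLift_tmul (preTensorD f M N) (preTensorD_rel f M N) m n).trans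
    (preTensorD_tmul f M N hm n)

lemma tensor_ind {p : tensor f M N → Prop} (hz : p 0)
    (ht : ∀ (i j : ℤ) (m : M) (n : N), m ∈ M.grading i → n ∈ N.grading j → p (tm f M N m n))
    (ha : ∀ x y, p x → p y → p (x + y)) (x : tensor f M N) : p x :=
  tensor_induction (f := f) (M := M) (N := N) (p := p) hz ht ha x

lemma tensor_grading_ind {k : ℤ} {p : ∀ x, x ∈ (tensor f M N).grading k → Prop}
    (hz : p 0 (zero_mem _))
    (ht : ∀ (i j : ℤ) (m : M) (n : N) (h : i + j = k) (hm : m ∈ M.grading i)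
      (hn : n ∈ N.grading j), p (tm f M N m n) (tm_mem h hm hn))
    (ha : ∀ x y hx hy, p x hx → p y hy → p (x + y) (add_mem hx hy))
    (hn : ∀ x hx, p x hx → p (-x) (neg_mem hx))
    {x : tensor f M N} (hx : x ∈ (tensor f M N).grading k) : p x hx := by
  refine AddSubgroup.closure_induction (G := TensorCarrier f M N) (p := p) ?_ hz ha hn hx
  rintro x ⟨i, j, m, n, h, hm, hn, rfl⟩
  exact ht i j m n h hm hn

lemma tensor_hom_ext {Y : Type*} [AddCommGroup Y] {φ ψ : tensor f M N →+ Y}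
    (h : ∀ (i j : ℤ) (m : M) (n : N), m ∈ M.grading i → n ∈ N.grading j →
      φ (tm f M N m n) = ψ (tm f M N m n)) : φ = ψ := by
  ext x
  induction x using tensor_ind with
  | hz => simp
  | ha x y hx hy => rw [map_add, map_add, hx, hy]
  | ht i j m n hm hn => exact h i j m n hm hn

/-- The additive map out of `M ⊗_A N` given by a balanced biadditive map. -/
noncomputable def tlift {Y : Type u} [AddCommGroup Y] (φ : M →+ N →+ Y)
    (h : ∀ (i j k : ℤ) (a : A) (m : M) (n : N), a ∈ A.grading i → m ∈ M.grading j →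
      n ∈ N.grading k → φ (f.toRingHom a • m) n = (i * j).negOnePow • φ m (a • n)) :
    tensor f M N →+ Y :=
  tensorLift (TensorProduct.liftAddHom φ fun r m n => by simp) (by
    rintro _ ⟨i, j, a, m, n, ha, hm, rfl⟩
    rw [map_sub, sub_eq_zero, TensorProduct.liftAddHom_tmul, TensorProduct.liftAddHom_tmul]
    induction n using graded_induction N.isInternal with
    | hz => simp
    | ha x y hx hy => rw [map_add, hx, hy, smul_add, map_add]
    | hm k n hn =>
      rw [map_unit_smul, AddMonoidHom.smul_apply, h i j k a m n ha hm hn, smul_smul,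
        Int.units_mul_self, one_smul])

@[simp]
lemma tlift_tm {Y : Type u} [AddCommGroup Y] (φ : M →+ N →+ Y)
    (h : ∀ (i j k : ℤ) (a : A) (m : M) (n : N), a ∈ A.grading i → m ∈ M.grading j →
      n ∈ N.grading k → φ (f.toRingHom a • m) n = (i * j).negOnePow • φ m (a • n))
    (m : M) (n : N) : tlift φ h (tm f M N m n) = φ m n :=
  (tensorLift_tmul _ _ m n).trans (TensorProduct.liftAddHom_tmul _ _ _ _)

/-- The DG module homomorphism given by an additive map with the right values on homogeneous
tensors. -/
noncomputable def homOfTensor {Y : DGModule B} (φ : tensor f M N →+ Y)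
    (hs : ∀ (k i j : ℤ) (b : B) (m : M) (n : N), b ∈ B.grading k → m ∈ M.grading i →
      n ∈ N.grading j → φ (tm f M N (b • m) n) = b • φ (tm f M N m n))
    (hm : ∀ (i j : ℤ) (m : M) (n : N), m ∈ M.grading i → n ∈ N.grading j →
      φ (tm f M N m n) ∈ Y.grading (i + j))
    (hd : ∀ (i j : ℤ) (m : M) (n : N), m ∈ M.grading i → n ∈ N.grading j →
      φ (tm f M N (M.d m) n) + i.negOnePow • φ (tm f M N m (N.d n)) = Y.d (φ (tm f M N m n))) :
    tensor f M N ⟶ Y where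
  toLinearMap :=
    { toFun := φ
      map_add' := map_add φ
      map_smul' := by
        intro b x
        induction x using tensor_ind with
        | hz => simp
        | ha x y hx hy => simp only [smul_add, map_add, hx, hy]
        | ht i j m n hm hn =>
          induction b using B.hom_induction with
          | hz => simp
          | ha b c hb hc => simp only [add_smul, map_add, hb, hc]
          | hm k b hb => exact hs k i j b m n hb hm hn }
  map_mem := by
    intro k x hx
    change φ x ∈ _
    induction hx using tensor_grading_ind with
    | hz => rw [map_zero]; exact zero_mem _
    | ha x y _ _ hx hy => rw [map_add]; exact add_mem hx hy
    | hn x _ hx => rw [map_neg]; exact neg_mem hx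
    | ht i j m n h hm' hn => subst h; exact hm i j m n hm' hn
  map_d := by
    intro x
    change φ _ = Y.d (φ x)
    induction x using tensor_ind with
    | hz => simp
    | ha x y hx hy => simp only [map_add, hx, hy]
    | ht i j m n hm hn => rw [d_tm hm, map_add, map_unit_smul, hd i j m n hm hn]

lemma homOfTensor_apply {Y : DGModule B} (φ : tensor f M N →+ Y) (hs hm hd)
    (x : tensor f M N) : (homOfTensor φ hs hm hd).toLinearMap x = φ x := rfl

section Map

variable {M' : DGModule B} {N' : DGModule A}

/-- Functoriality of the tensor product. -/
noncomputable def tensorMap (f : CommDGRing.Hom A B) (φ : M ⟶ M') (ψ : N ⟶ N') :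
    tensor f M N ⟶ tensor f M' N' :=
  homOfTensor
    (tlift (((tm f M' N').compl₂ ψ.toLinearMap.toAddMonoidHom).comp φ.toLinearMap.toAddMonoidHom)
      (by
        intro i j k a m n ha hm hn
        change tm f M' N' (φ.toLinearMap (f.toRingHom a • m)) (ψ.toLinearMap n)
          = _ • tm f M' N' (φ.toLinearMap m) (ψ.toLinearMap (a • n))
        rw [LinearMap.map_smul φ.toLinearMap, LinearMap.map_smul ψ.toLinearMap,
          tm_smul_left _ ha (φ.map_mem hm)]))
    (by
      intro k i j b m n _ _ _
      rw [tlift_tm, tlift_tm]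
      change tm f M' N' (φ.toLinearMap (b • m)) (ψ.toLinearMap n)
        = b • tm f M' N' (φ.toLinearMap m) (ψ.toLinearMap n)
      rw [LinearMap.map_smul φ.toLinearMap, smul_tm])
    (by
      intro i j m n hm hn
      rw [tlift_tm]
      exact tm_mem rfl (φ.map_mem hm) (ψ.map_mem hn))
    (by
      intro i j m n hm hn
      rw [tlift_tm, tlift_tm, tlift_tm]
      change tm f M' N' (φ.toLinearMap (M.d m)) (ψ.toLinearMap n)
        + _ • tm f M' N' (φ.toLinearMap m) (ψ.toLinearMap (N.d n))
        = (tensor f M' N').d (tm f M' N' (φ.toLinearMap m) (ψ.toLinearMap n))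
      rw [d_tm (φ.map_mem hm), φ.map_d, ψ.map_d])

lemma tensorMap_tm (φ : M ⟶ M') (ψ : N ⟶ N') (m : M) (n : N) :
    (tensorMap f φ ψ).toLinearMap (tm f M N m n)
      = tm f M' N' (φ.toLinearMap m) (ψ.toLinearMap n) := by
  rw [tensorMap, homOfTensor_apply, tlift_tm]; rfl

lemma tensor_dgHom_ext {Y : DGModule B} {φ ψ : tensor f M N ⟶ Y}
    (h : ∀ (i j : ℤ) (m : M) (n : N), m ∈ M.grading i → n ∈ N.grading j →
      φ.toLinearMap (tm f M N m n) = ψ.toLinearMap (tm f M N m n)) : φ = ψ :=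
  hom_eq fun x => DFunLike.congr_fun
    (tensor_hom_ext (φ := φ.toLinearMap.toAddMonoidHom) (ψ := ψ.toLinearMap.toAddMonoidHom) h) x

lemma tensorMap_comp {M'' : DGModule B} {N'' : DGModule A} (φ : M ⟶ M') (ψ : N ⟶ N')
    (φ' : M' ⟶ M'') (ψ' : N' ⟶ N'') :
    tensorMap f (φ ≫ φ') (ψ ≫ ψ') = tensorMap f φ ψ ≫ tensorMap f φ' ψ' :=
  tensor_dgHom_ext fun i j m n _ _ => by
    simp only [tensorMap_tm, comp_toLinearMap]

lemma tensorMap_id : tensorMap f (𝟙 M) (𝟙 N) = 𝟙 _ :=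
  tensor_dgHom_ext fun i j m n _ _ => by
    simp only [tensorMap_tm, id_toLinearMap]

end Map

variable (f) in
/-- `M ↦ M ⊗_A N`. -/
noncomputable def tensorLeftFunctor (N : DGModule A) : DGModule B ⥤ DGModule B where
  obj M := tensor f M N
  map φ := tensorMap f φ (𝟙 N)
  map_id _ := tensorMap_id
  map_comp φ φ' := by rw [← tensorMap_comp, Category.comp_id]

variable (f) in
/-- `N ↦ M ⊗_A N`. -/
noncomputable def tensorRightFunctor (M : DGModule B) : DGModule A ⥤ DGModule B where
  obj N := tensor f M N
  map ψ := tensorMap f (𝟙 M) ψ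
  map_id _ := tensorMap_id
  map_comp ψ ψ' := by rw [← tensorMap_comp, Category.comp_id]

end Tensor

section Unit

variable (f : CommDGRing.Hom A B) (X : DGModule B)

/-- The identification of the underlying group of `self A` with `A`. -/
def ofRing (A : CommDGRing.{u}) : A →+ self A := AddMonoidHom.id A

lemma ofRing_surjective : Function.Surjective (ofRing A) := fun a => ⟨a, rfl⟩

lemma ofRing_injective : Function.Injective (ofRing A) := fun _ _ h => h

/-- The identification of the underlying group of `self A` with `A`. -/
def unRing (A : CommDGRing.{u}) : self A →+ A := AddMonoidHom.id A

lemma unRing_ofRing (a : A) : unRing A (ofRing A a) = a := rfl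

lemma ofRing_mem {i : ℤ} {a : A} : ofRing A a ∈ (self A).grading i ↔ a ∈ A.grading i := Iff.rfl

lemma smul_ofRing (a b : A) : a • ofRing A b = ofRing A (a * b) := rfl

lemma d_ofRing (a : A) : (self A).d (ofRing A a) = ofRing A (A.d a) := rfl

/-- The isomorphism `X → X ⊗_A A`. -/
noncomputable def unitHom : X ⟶ tensor f X (self A) where
  toLinearMap :=
    { toFun := fun x => tm f X (self A) x (ofRing A 1)
      map_add' := fun x y => by rw [map_add]; rfl
      map_smul' := fun b x => rfl }
  map_mem := fun h => tm_mem (add_zero _) h A.one_mem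
  map_d := by
    intro x
    change tm f X (self A) (X.d x) (ofRing A 1)
      = (tensor f X (self A)).d (tm f X (self A) x (ofRing A 1))
    induction x using graded_induction X.isInternal with
    | hz => simp
    | ha x y hx hy => simp only [map_add, AddMonoidHom.add_apply, hx, hy]
    | hm i x hx => rw [d_tm hx, d_ofRing, A.d_one, map_zero, map_zero, smul_zero, add_zero]

lemma unitHom_apply (x : X) : (unitHom f X).toLinearMap x = tm f X (self A) x (ofRing A 1) := rfl

/-- The right action `x ⊗ a ↦ (-1) ^ (i * j) • a x`. -/
noncomputable def rightAction : X →+ self A →+ X :=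
  (Finsupp.liftAddHom fun i : ℤ =>
    ((AddMonoidHom.smul : B →+ X →+ X).flip.compl₂
      ((f.toRingHom.toAddMonoidHom.comp (unRing A)).comp (sgn (self A).isInternal i)))).comp
    (components X.isInternal)

lemma rightAction_apply {i j : ℤ} {x : X} {a : A} (hx : x ∈ X.grading i) (ha : a ∈ A.grading j) :
    rightAction f X x (ofRing A a) = (i * j).negOnePow • f.toRingHom a • x := by
  simp [rightAction, components_of_mem X.isInternal hx,
    sgn_of_mem (self A).isInternal i (ofRing_mem.2 ha), unRing_ofRing]

/-- Injectivity: the signed right action `x ⊗ a ↦ ± a x` is a retraction. Surjectivity: `x ⊗ a`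
becomes a tensor with right factor `1` once `a` is moved across the tensor sign. -/
lemma unitHom_bijective : Function.Bijective (unitHom f X).toLinearMap := by
  constructor
  · let ρ : tensor f X (self A) →+ X := tlift (rightAction f X) (by
      intro i j k a x b ha hx hb
      obtain ⟨b, rfl⟩ := ofRing_surjective b
      rw [ofRing_mem] at hb
      have e : f.toRingHom b • f.toRingHom a • x = (i * k).negOnePow • f.toRingHom (a * b) • x := by
        rw [smul_smul, ← map_mul, A.mul_comm_sign ha hb, map_unit_smul, smul_assoc]
      rw [smul_ofRing, rightAction_apply f X (X.smul_mem (f.map_mem ha) hx) hb,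
        rightAction_apply f X hx (A.mul_mem ha hb), e, smul_smul, smul_smul, ← Int.negOnePow_add,
        ← Int.negOnePow_add]
      exact sign_smul_congr (i * k - i * j) (by ring) _)
    have hρ : ∀ x, ρ ((unitHom f X).toLinearMap x) = x := by
      intro x
      rw [unitHom_apply, tlift_tm]
      induction x using graded_induction X.isInternal with
      | hz => simp
      | ha x y hx hy => simp only [map_add, AddMonoidHom.add_apply, hx, hy]
      | hm i x hx => rw [rightAction_apply f X hx A.one_mem]; simp
    exact Function.LeftInverse.injective hρ
  · intro y
    induction y using tensor_ind with
    | hz => exact ⟨0, map_zero _⟩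
    | ha x y hx hy =>
      obtain ⟨x, rfl⟩ := hx
      obtain ⟨y, rfl⟩ := hy
      exact ⟨x + y, map_add _ _ _⟩
    | ht i j x a hx ha =>
      obtain ⟨a, rfl⟩ := ofRing_surjective a
      rw [ofRing_mem] at ha
      refine ⟨(j * i).negOnePow • f.toRingHom a • x, ?_⟩
      rw [map_unit_smul, unitHom_apply, tm_smul_left _ ha hx, smul_smul, Int.units_mul_self,
        one_smul, smul_ofRing, mul_one]

lemma unitHom_natural {X Y : DGModule B} (φ : X ⟶ Y) :
    unitHom f X ≫ tensorMap f φ (𝟙 _) = φ ≫ unitHom f Y :=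
  hom_eq fun x => by
    rw [comp_toLinearMap, comp_toLinearMap, unitHom_apply, unitHom_apply, tensorMap_tm,
      id_toLinearMap]

end Unit

section Swap

variable (M N : DGModule A)

/-- The biadditive map `(m, n) ↦ (-1) ^ (i * j) • n ⊗ m`. -/
noncomputable def swapBi : M →+ N →+ tensor (CommDGRing.Hom.id A) N M :=
  (Finsupp.liftAddHom fun i : ℤ =>
    ((tm (CommDGRing.Hom.id A) N M).flip.compl₂ (sgn N.isInternal i))).comp
    (components M.isInternal)

lemma swapBi_apply {i j : ℤ} {m : M} {n : N} (hm : m ∈ M.grading i) (hn : n ∈ N.grading j) :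
    swapBi M N m n = (i * j).negOnePow • tm (CommDGRing.Hom.id A) N M n m := by
  simp [swapBi, components_of_mem M.isInternal hm, sgn_of_mem N.isInternal i hn]

/-- The symmetry `M ⊗_A N → N ⊗_A M`. -/
noncomputable def swapHom :
    tensor (CommDGRing.Hom.id A) M N ⟶ tensor (CommDGRing.Hom.id A) N M :=
  homOfTensor (tlift (swapBi M N) (by
      intro i j k a m n ha hm hn
      change swapBi M N (a • m) n = (i * j).negOnePow • swapBi M N m (a • n)
      rw [swapBi_apply M N (M.smul_mem ha hm) hn, swapBi_apply M N hm (N.smul_mem ha hn),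
        tm_smul_right _ ha hn, smul_smul, smul_smul, ← Int.negOnePow_add, ← Int.negOnePow_add]
      exact sign_smul_congr (i * k - i * j) (by ring) _))
    (by
      intro k i j b m n hb hm hn
      rw [tlift_tm, tlift_tm, swapBi_apply M N (M.smul_mem hb hm) hn, swapBi_apply M N hm hn,
        tm_smul_right _ hb hn, smul_smul, smul_comm b, smul_tm, ← Int.negOnePow_add]
      exact sign_smul_congr (k * j) (by ring) _)
    (by
      intro i j m n hm hn
      rw [tlift_tm, swapBi_apply M N hm hn]
      exact unit_smul_mem _ _ (tm_mem (add_comm _ _) hn hm))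
    (by
      intro i j m n hm hn
      rw [tlift_tm, tlift_tm, tlift_tm, swapBi_apply M N (M.d_mem hm) hn, swapBi_apply M N hm hn,
        swapBi_apply M N hm (N.d_mem hn), map_unit_smul, d_tm hn, smul_add, smul_smul, smul_smul,
        ← Int.negOnePow_add, ← Int.negOnePow_add, add_comm]
      congr 1
      · exact sign_smul_congr i (by ring) _
      · exact sign_smul_congr 0 (by ring) _)

lemma swapHom_tm {i j : ℤ} {m : M} {n : N} (hm : m ∈ M.grading i) (hn : n ∈ N.grading j) :
    (swapHom M N).toLinearMap (tm _ M N m n) = (i * j).negOnePow • tm _ N M n m := by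
  rw [swapHom, homOfTensor_apply, tlift_tm, swapBi_apply M N hm hn]

lemma swapHom_swapHom : swapHom M N ≫ swapHom N M = 𝟙 _ :=
  tensor_dgHom_ext fun i j m n hm hn => by
    rw [comp_toLinearMap, swapHom_tm M N hm hn, map_unit_smul, swapHom_tm N M hn hm, smul_smul,
      ← Int.negOnePow_add, sign_smul_congr (n := 0) (i * j) (by ring)]
    simp [id_toLinearMap]

lemma swapHom_bijective : Function.Bijective (swapHom M N).toLinearMap := by
  have h : ∀ M N : DGModule A, Function.LeftInverse (swapHom N M).toLinearMap
      (swapHom M N).toLinearMap := fun M N x => by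
    rw [← comp_toLinearMap, swapHom_swapHom, id_toLinearMap]
  exact ⟨(h M N).injective, (h N M).surjective⟩

lemma swapHom_natural {M' N' : DGModule A} (φ : M ⟶ M') (ψ : N ⟶ N') :
    tensorMap _ φ ψ ≫ swapHom M' N' = swapHom M N ≫ tensorMap _ ψ φ :=
  tensor_dgHom_ext fun i j m n hm hn => by
    rw [comp_toLinearMap, comp_toLinearMap, tensorMap_tm, swapHom_tm _ _ hm hn, map_unit_smul,
      tensorMap_tm, swapHom_tm _ _ (φ.map_mem hm) (ψ.map_mem hn)]

end Swap

section Res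

/-- Restriction of scalars. -/
def res (f : CommDGRing.Hom A B) (M : DGModule B) : DGModule A where
  carrier := M
  module := Module.compHom M f.toRingHom
  grading := M.grading
  isInternal := M.isInternal
  smul_mem ha hm := M.smul_mem (f.map_mem ha) hm
  d := M.d
  d_mem := M.d_mem
  d_d := M.d_d
  leibniz := by
    intro i a ha m
    change M.d (f.toRingHom a • m) = f.toRingHom (A.d a) • m + _ • (f.toRingHom a • M.d m)
    rw [M.leibniz (f.map_mem ha), f.map_d]

/-- The identification of the underlying groups of `M` and of `res f M`. -/
def toRes (f : CommDGRing.Hom A B) (M : DGModule B) : M ≃+ res f M := AddEquiv.refl M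

section

variable (f : CommDGRing.Hom A B) (M : DGModule B)

lemma toRes_mem {i : ℤ} {m : M} : toRes f M m ∈ (res f M).grading i ↔ m ∈ M.grading i := Iff.rfl

lemma smul_toRes (a : A) (m : M) : a • toRes f M m = toRes f M (f.toRingHom a • m) := rfl

lemma d_toRes (m : M) : (res f M).d (toRes f M m) = toRes f M (M.d m) := rfl

lemma acyclic_res_iff : (res f M).Acyclic ↔ M.Acyclic := by
  rw [acyclic_iff, acyclic_iff]; rfl

end

/-- Restriction of scalars of a homomorphism. -/
def resMap (f : CommDGRing.Hom A B) {M N : DGModule B} (φ : M ⟶ N) : res f M ⟶ res f N where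
  toLinearMap :=
    { toFun := fun m => toRes f N (φ.toLinearMap ((toRes f M).symm m))
      map_add' := fun x y => by simp only [map_add]
      map_smul' := fun a m => φ.toLinearMap.map_smul (f.toRingHom a) m }
  map_mem := φ.map_mem
  map_d := φ.map_d

lemma resMap_toRes (f : CommDGRing.Hom A B) {M N : DGModule B} (φ : M ⟶ N) (m : M) :
    (resMap f φ).toLinearMap (toRes f M m) = toRes f N (φ.toLinearMap m) := rfl

lemma isQI_resMap_iff (f : CommDGRing.Hom A B) {M N : DGModule B} (φ : M ⟶ N) :
    IsQI (resMap f φ) ↔ IsQI φ :=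
  ⟨fun h => ⟨h.inj, h.surj⟩, fun h => ⟨h.inj, h.surj⟩⟩

variable (f : CommDGRing.Hom A B) (M : DGModule B) (N : DGModule A)

/-- Auxiliary: `m ⊗ n ↦ m ⊗ n`. -/
noncomputable def fromResTensor : tensor (CommDGRing.Hom.id A) (res f M) N →+ tensor f M N :=
  tlift ((tm f M N).comp (toRes f M).symm.toAddMonoidHom) (by
    intro i j k a m n ha hm hn
    obtain ⟨m, rfl⟩ := (toRes f M).surjective m
    rw [toRes_mem] at hm
    change tm f M N (f.toRingHom a • m) n = (i * j).negOnePow • tm f M N m (a • n)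
    exact tm_smul_left n ha hm)

lemma fromResTensor_tm (m : M) (n : N) :
    fromResTensor f M N (tm (CommDGRing.Hom.id A) (res f M) N (toRes f M m) n) = tm f M N m n :=
  tlift_tm _ _ (toRes f M m) n

/-- Auxiliary: `m ⊗ n ↦ m ⊗ n`. -/
noncomputable def toResTensor : tensor f M N →+ tensor (CommDGRing.Hom.id A) (res f M) N :=
  tlift ((tm (CommDGRing.Hom.id A) (res f M) N).comp (toRes f M).toAddMonoidHom) (by
    intro i j k a m n ha hm hn
    change tm (CommDGRing.Hom.id A) (res f M) N (a • toRes f M m) n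
      = (i * j).negOnePow • tm (CommDGRing.Hom.id A) (res f M) N (toRes f M m) (a • n)
    exact tm_smul_left (f := CommDGRing.Hom.id A) (M := res f M) (m := toRes f M m) n ha hm)

lemma toResTensor_tm (m : M) (n : N) :
    toResTensor f M N (tm f M N m n) = tm (CommDGRing.Hom.id A) (res f M) N (toRes f M m) n :=
  tlift_tm _ _ m n

lemma fromResTensor_bijective : Function.Bijective (fromResTensor f M N) := by
  have h1 : (toResTensor f M N).comp (fromResTensor f M N) = AddMonoidHom.id _ :=
    tensor_hom_ext fun i j m n _ _ => by
      obtain ⟨m, rfl⟩ := (toRes f M).surjective m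
      rw [AddMonoidHom.comp_apply, fromResTensor_tm, toResTensor_tm]; rfl
  have h2 : (fromResTensor f M N).comp (toResTensor f M N) = AddMonoidHom.id _ :=
    tensor_hom_ext fun i j m n _ _ => by
      rw [AddMonoidHom.comp_apply, toResTensor_tm, fromResTensor_tm]; rfl
  exact ⟨Function.LeftInverse.injective (DFunLike.congr_fun h1),
    Function.RightInverse.surjective (DFunLike.congr_fun h2)⟩

/-- The comparison of `M ⊗_A N` for `M` a DG `A`-module by restriction of scalars with the DG
`B`-module `M ⊗_A N`. -/
noncomputable def resTensorHom :
    tensor (CommDGRing.Hom.id A) (res f M) N ⟶ res f (tensor f M N) :=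
  homOfTensor ((toRes f (tensor f M N)).toAddMonoidHom.comp (fromResTensor f M N))
    (fun k i j b m n _ _ _ => by
      obtain ⟨m, rfl⟩ := (toRes f M).surjective m
      rw [AddMonoidHom.comp_apply, AddMonoidHom.comp_apply, smul_toRes, fromResTensor_tm,
        fromResTensor_tm]
      rfl)
    (fun i j m n hm hn => by
      obtain ⟨m, rfl⟩ := (toRes f M).surjective m
      rw [AddMonoidHom.comp_apply, fromResTensor_tm]
      exact tm_mem (f := f) rfl hm hn)
    (fun i j m n hm hn => by
      obtain ⟨m, rfl⟩ := (toRes f M).surjective m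
      rw [AddMonoidHom.comp_apply, AddMonoidHom.comp_apply, AddMonoidHom.comp_apply, d_toRes,
        fromResTensor_tm, fromResTensor_tm, fromResTensor_tm]
      exact (d_tm (f := f) hm n).symm)

lemma resTensorHom_tm (m : M) (n : N) :
    (resTensorHom f M N).toLinearMap (tm (CommDGRing.Hom.id A) (res f M) N (toRes f M m) n)
      = toRes f _ (tm f M N m n) :=
  congrArg (toRes f (tensor f M N)) (fromResTensor_tm f M N m n)

lemma resTensorHom_bijective : Function.Bijective (resTensorHom f M N).toLinearMap :=
  (toRes f (tensor f M N)).bijective.comp (fromResTensor_bijective f M N)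

variable {M N} in
lemma resTensorHom_natural {M' : DGModule B} {N' : DGModule A} (φ : M ⟶ M') (ψ : N ⟶ N') :
    tensorMap _ (resMap f φ) ψ ≫ resTensorHom f M' N'
      = resTensorHom f M N ≫ resMap f (tensorMap f φ ψ) :=
  tensor_dgHom_ext fun i j m n _ _ => by
    obtain ⟨m, rfl⟩ := (toRes f M).surjective m
    rw [comp_toLinearMap, comp_toLinearMap, tensorMap_tm, resMap_toRes, resTensorHom_tm,
      resTensorHom_tm, resMap_toRes, tensorMap_tm]

-- Reduces statements about base change along `f` to tensor products over `A`, where the symmetry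
-- and the definition of K-flatness apply.
variable {M N} in
lemma isQI_res_tensorMap_iff {M' : DGModule B} {N' : DGModule A} (φ : M ⟶ M') (ψ : N ⟶ N') :
    IsQI (tensorMap (CommDGRing.Hom.id A) (resMap f φ) ψ) ↔ IsQI (tensorMap f φ ψ) := by
  have h1 := IsQI.of_bijective (resTensorHom_bijective f M N)
  have h2 := IsQI.of_bijective (resTensorHom_bijective f M' N')
  rw [← isQI_resMap_iff f (tensorMap f φ ψ)]
  constructor
  · intro h
    exact IsQI.of_comp_left h1 (resTensorHom_natural f φ ψ ▸ h.comp h2)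
  · intro h
    exact IsQI.of_comp_right h2 (resTensorHom_natural f φ ψ ▸ h1.comp h)

lemma acyclic_res_tensor_iff :
    (tensor (CommDGRing.Hom.id A) (res f M) N).Acyclic ↔ (tensor f M N).Acyclic := by
  rw [← acyclic_res_iff f (tensor f M N)]
  exact ⟨(IsQI.of_bijective (resTensorHom_bijective f M N)).acyclic',
    (IsQI.of_bijective (resTensorHom_bijective f M N)).acyclic⟩

end Res

section Assoc

variable (f : CommDGRing.Hom A B) (g : CommDGRing.Hom B C) (h : CommDGRing.Hom A C)
  (X : DGModule C) (M : DGModule B) (N : DGModule A)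

/-- Auxiliary: `x ⊗ m` is sent to `n ↦ x ⊗ (m ⊗ n)`. -/
noncomputable def assocBi : tensor g X M →+ N →+ tensor g X (tensor f M N) :=
  tlift (AddMonoidHom.mk' (fun x => (tm f M N).compr₂ (tm g X (tensor f M N) x))
      fun x y => by ext m n; simp)
    (by
      intro i j k b x m hb hx hm
      ext n
      simp only [AddMonoidHom.mk'_apply, AddMonoidHom.compr₂_apply, AddMonoidHom.smul_apply]
      rw [tm_smul_left _ hb hx, smul_tm])

lemma assocBi_tm (x : X) (m : M) (n : N) :
    assocBi f g X M N (tm g X M x m) n = tm g X (tensor f M N) x (tm f M N m n) := by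
  rw [assocBi, tlift_tm]; rfl

/-- The associativity `(X ⊗_B M) ⊗_A N → X ⊗_B (M ⊗_A N)`. -/
noncomputable def assocHom (hh : ∀ a, h.toRingHom a = g.toRingHom (f.toRingHom a)) :
    tensor h (tensor g X M) N ⟶ tensor g X (tensor f M N) :=
  homOfTensor (tlift (assocBi f g X M N) (by
      intro i j k a w n ha hw hn
      induction hw using tensor_grading_ind with
      | hz => simp
      | ha x y _ _ hx hy => simp only [smul_add, map_add, AddMonoidHom.add_apply, hx, hy]
      | hn x _ hx => simp only [smul_neg, map_neg, AddMonoidHom.neg_apply, hx]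
      | ht p q x m hpq hx hm =>
        rw [smul_tm, assocBi_tm, assocBi_tm, hh, tm_smul_left _ (f.map_mem ha) hx, smul_tm,
          tm_smul_left _ ha hm, map_unit_smul, smul_smul, ← Int.negOnePow_add]
        exact sign_smul_congr 0 (by rw [← hpq]; ring) _))
    (by
      intro k i j b w n hb hw hn
      rw [tlift_tm, tlift_tm]
      induction hw using tensor_grading_ind with
      | hz => simp
      | ha x y _ _ hx hy => simp only [smul_add, map_add, AddMonoidHom.add_apply, hx, hy]
      | hn x _ hx => simp only [smul_neg, map_neg, AddMonoidHom.neg_apply, hx]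
      | ht p q x m hpq hx hm => rw [smul_tm, assocBi_tm, assocBi_tm, smul_tm])
    (by
      intro i j w n hw hn
      rw [tlift_tm]
      induction hw using tensor_grading_ind with
      | hz => rw [map_zero]; exact zero_mem _
      | ha x y _ _ hx hy => rw [map_add]; exact add_mem hx hy
      | hn x _ hx => rw [map_neg]; exact neg_mem hx
      | ht p q x m hpq hx hm =>
        rw [assocBi_tm]
        exact tm_mem (by rw [← hpq]; ring) hx (tm_mem rfl hm hn))
    (by
      intro i j w n hw hn
      rw [tlift_tm, tlift_tm, tlift_tm]
      induction hw using tensor_grading_ind with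
      | hz => simp
      | ha x y _ _ hx hy =>
        simp only [map_add, AddMonoidHom.add_apply, smul_add, ← hx, ← hy]; abel
      | hn x _ hx => simp only [map_neg, AddMonoidHom.neg_apply, smul_neg, ← hx]; abel
      | ht p q x m hpq hx hm =>
        rw [d_tm hx, map_add, AddMonoidHom.add_apply, map_unit_smul, AddMonoidHom.smul_apply,
          assocBi_tm, assocBi_tm, assocBi_tm, assocBi_tm, d_tm hx, d_tm hm, map_add, map_unit_smul,
          smul_add, smul_smul, ← Int.negOnePow_add, hpq, add_assoc])

variable (hh : ∀ a, h.toRingHom a = g.toRingHom (f.toRingHom a))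

lemma assocHom_tm (x : X) (m : M) (n : N) :
    (assocHom f g h X M N hh).toLinearMap (tm h (tensor g X M) N (tm g X M x m) n)
      = tm g X (tensor f M N) x (tm f M N m n) := by
  rw [assocHom, homOfTensor_apply, tlift_tm, assocBi_tm]

/-- Auxiliary: `x` is sent to the map `m ⊗ n ↦ (x ⊗ m) ⊗ n`. -/
noncomputable def assocInvBi (hh : ∀ a, h.toRingHom a = g.toRingHom (f.toRingHom a)) :
    X →+ tensor f M N →+ tensor h (tensor g X M) N :=
  AddMonoidHom.mk' (fun x => tlift ((tm h (tensor g X M) N).comp (tm g X M x)) (by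
      intro i j k a m n ha hm hn
      change tm h (tensor g X M) N (tm g X M x (f.toRingHom a • m)) n
        = (i * j).negOnePow • tm h (tensor g X M) N (tm g X M x m) (a • n)
      induction x using graded_induction X.isInternal with
      | hz => simp
      | ha x y hx hy => simp only [map_add, AddMonoidHom.add_apply, smul_add, hx, hy]
      | hm p x hx =>
        rw [tm_smul_right _ (f.map_mem ha) hx, ← hh, ← smul_tm, map_unit_smul,
          AddMonoidHom.smul_apply, tm_smul_left _ ha (tm_mem rfl hx hm), smul_smul,
          ← Int.negOnePow_add]
        exact sign_smul_congr (i * p) (by ring) _))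
      (fun x y => tensor_hom_ext fun i j m n hm hn => by
        simp only [tlift_tm, AddMonoidHom.add_apply, map_add, AddMonoidHom.comp_apply])

lemma assocInvBi_tm (x : X) (m : M) (n : N) :
    assocInvBi f g h X M N hh x (tm f M N m n) = tm h (tensor g X M) N (tm g X M x m) n := by
  rw [assocInvBi, AddMonoidHom.mk'_apply, tlift_tm]; rfl

/-- The inverse `x ⊗ (m ⊗ n) ↦ (x ⊗ m) ⊗ n` is needed only as an additive map, since a bijective DG
homomorphism is already a quasi-isomorphism. -/
lemma assocHom_bijective : Function.Bijective (assocHom f g h X M N hh).toLinearMap := by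
  let ρ : tensor g X (tensor f M N) →+ tensor h (tensor g X M) N :=
    tlift (assocInvBi f g h X M N hh) (by
      intro i j k b x w hb hx hw
      induction hw using tensor_grading_ind with
      | hz => simp
      | ha x y _ _ hx hy => simp only [smul_add, map_add, hx, hy]
      | hn x _ hx => simp only [smul_neg, map_neg, hx]
      | ht p q m n hpq hm hn =>
        rw [smul_tm, assocInvBi_tm, assocInvBi_tm, tm_smul_left _ hb hx, map_unit_smul,
          AddMonoidHom.smul_apply])
  have h1 : ρ.comp (assocHom f g h X M N hh).toLinearMap.toAddMonoidHom = AddMonoidHom.id _ := by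
    refine tensor_hom_ext fun i j w n hw _ => ?_
    clear hw
    induction w using tensor_ind with
    | hz => simp
    | ha x y hx hy => simp only [map_add, AddMonoidHom.add_apply, hx, hy]
    | ht p q x m hx hm =>
      rw [AddMonoidHom.comp_apply, LinearMap.toAddMonoidHom_coe, assocHom_tm, tlift_tm,
        assocInvBi_tm, AddMonoidHom.id_apply]
  have h2 : (assocHom f g h X M N hh).toLinearMap.toAddMonoidHom.comp ρ = AddMonoidHom.id _ := by
    refine tensor_hom_ext fun i j x w _ hw => ?_
    clear hw
    induction w using tensor_ind with
    | hz => simp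
    | ha x y hx hy => simp only [map_add, hx, hy]
    | ht p q m n hm hn =>
      change (assocHom f g h X M N hh).toLinearMap (ρ _) = _
      rw [tlift_tm, assocInvBi_tm, assocHom_tm]; rfl
  exact ⟨Function.LeftInverse.injective (DFunLike.congr_fun h1),
    Function.RightInverse.surjective (DFunLike.congr_fun h2)⟩

end Assoc

end DGModule
end DG

/-! ### Mapping cones and K-flat DG modules. -/

namespace DG
open CategoryTheory
open scoped TensorProduct

/-- The ring automorphism of `A` that is `(-1) ^ i` in degree `i`. -/
noncomputable def CommDGRing.signedHom (A : CommDGRing.{u}) : A →+* A where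
  toFun := signed A.isInternal
  map_one' := by rw [signed_of_mem _ A.one_mem]; simp
  map_mul' a b := by
    induction a using A.hom_induction with
    | hz => simp
    | ha x y hx hy => simp only [add_mul, map_add, hx, hy]
    | hm i a ha =>
      induction b using A.hom_induction with
      | hz => simp
      | ha x y hx hy => simp only [mul_add, map_add, hx, hy]
      | hm j b hb =>
        rw [signed_of_mem _ ha, signed_of_mem _ hb, signed_of_mem _ (A.mul_mem ha hb),
          smul_mul_smul_comm, ← Int.negOnePow_add]
  map_zero' := map_zero _
  map_add' := map_add _

lemma CommDGRing.signedHom_of_mem {A : CommDGRing.{u}} {i : ℤ} {a : A} (ha : a ∈ A.grading i) :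
    A.signedHom a = i.negOnePow • a := signed_of_mem _ ha

namespace DGModule

variable {A B : CommDGRing.{u}}

section Cone

variable {X Y : DGModule A} (f : X ⟶ Y)

lemma cone_isInternal : DirectSum.IsInternal
    fun i : ℤ => (Y.grading i).prod (X.grading (i + 1)) := by
  refine isInternal_of_components
    (((Finsupp.mapRange.addMonoidHom (AddMonoidHom.inl Y X)).comp
        ((components Y.isInternal).comp (AddMonoidHom.fst Y X))) +
      ((Finsupp.mapDomain.addMonoidHom fun i : ℤ => i - 1).comp
        ((Finsupp.mapRange.addMonoidHom (AddMonoidHom.inr Y X)).comp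
          ((components X.isInternal).comp (AddMonoidHom.snd Y X))))) ?_ ?_
  · rintro i ⟨y, x⟩ ⟨hy, hx⟩
    simp [components_of_mem Y.isInternal hy, components_of_mem X.isInternal hx,
      Finsupp.mapDomain_single, ← Finsupp.single_add]
  · rw [eq_top_iff]
    rintro ⟨y, x⟩ -
    have h1 : (y, (0 : X)) ∈ ⨆ i : ℤ, (Y.grading i).prod (X.grading (i + 1)) := by
      induction y using graded_induction Y.isInternal with
      | hz => exact zero_mem _
      | ha y z hy hz => simpa using add_mem hy hz
      | hm i y hy => exact AddSubgroup.mem_iSup_of_mem i ⟨hy, zero_mem _⟩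
    have h2 : ((0 : Y), x) ∈ ⨆ i : ℤ, (Y.grading i).prod (X.grading (i + 1)) := by
      induction x using graded_induction X.isInternal with
      | hz => exact zero_mem _
      | ha y z hy hz => simpa using add_mem hy hz
      | hm i x hx =>
        exact AddSubgroup.mem_iSup_of_mem (i - 1) ⟨zero_mem _, by simpa using hx⟩
    simpa using add_mem h1 h2

/-- The mapping cone. -/
noncomputable def cone : DGModule A where
  carrier := Y × X
  -- The summand `X` is shifted by one degree, so `A` acts on it through its sign automorphism; this
  -- is what the Leibniz rule requires for the differential `-X.d`.
  module := @Prod.instModule A Y X _ _ _ _ (Module.compHom X A.signedHom)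
  grading i := (Y.grading i).prod (X.grading (i + 1))
  isInternal := cone_isInternal
  smul_mem := by
    rintro i j a ⟨y, x⟩ ha ⟨hy, hx⟩
    refine ⟨Y.smul_mem ha hy, ?_⟩
    change A.signedHom a • x ∈ X.grading (i + j + 1)
    rw [CommDGRing.signedHom_of_mem ha, smul_assoc, add_assoc]
    exact unit_smul_mem _ _ (X.smul_mem ha hx)
  d := AddMonoidHom.mk' (fun c => (Y.d c.1 + f.toLinearMap c.2, -X.d c.2)) (by
    rintro ⟨y, x⟩ ⟨y', x'⟩
    ext <;> simp <;> abel)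
  d_mem := by
    rintro i ⟨y, x⟩ ⟨hy, hx⟩
    exact ⟨add_mem (Y.d_mem hy) (f.map_mem hx),
      (neg_mem (X.d_mem hx) : -X.d x ∈ X.grading (i + 1 + 1))⟩
  d_d := by
    rintro ⟨y, x⟩
    ext
    · simp [Y.d_d, f.map_d]
    · simp [X.d_d]
  leibniz := by
    rintro i a ha ⟨y, x⟩
    refine Prod.ext ?_ ?_
    · change Y.d (a • y) + f.toLinearMap (A.signedHom a • x) =
        A.d a • y + i.negOnePow • (a • (Y.d y + f.toLinearMap x))
      rw [Y.leibniz ha, CommDGRing.signedHom_of_mem ha, smul_assoc, map_unit_smul, map_smul,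
        smul_add, smul_add, add_assoc]
    · change -X.d (A.signedHom a • x) = A.signedHom (A.d a) • x
        + i.negOnePow • (A.signedHom a • (-X.d x))
      rw [CommDGRing.signedHom_of_mem ha, CommDGRing.signedHom_of_mem (A.d_mem ha), smul_assoc,
        smul_assoc, smul_assoc, map_unit_smul, X.leibniz ha, Int.negOnePow_succ]
      simp only [smul_add, neg_add, smul_neg, Units.neg_smul]

/-- The element of the cone of `f : X ⟶ Y` with components `y` and `x`. -/
def coneMk : Y × X →+ cone f := AddMonoidHom.id _

/-- The first component of an element of the cone. -/
def coneFst : cone f →+ Y := AddMonoidHom.fst _ _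

/-- The second component of an element of the cone. -/
def coneSnd : cone f →+ X := AddMonoidHom.snd _ _

lemma coneFst_mk (c : Y × X) : coneFst f (coneMk f c) = c.1 := rfl

lemma coneSnd_mk (c : Y × X) : coneSnd f (coneMk f c) = c.2 := rfl

lemma coneMk_bijective : Function.Bijective (coneMk f) := Function.bijective_id

lemma coneMk_mem {i : ℤ} (c : Y × X) :
    coneMk f c ∈ (cone f).grading i ↔ c.1 ∈ Y.grading i ∧ c.2 ∈ X.grading (i + 1) := Iff.rfl

lemma smul_coneMk (a : A) (c : Y × X) :
    a • coneMk f c = coneMk f (a • c.1, A.signedHom a • c.2) := rfl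

lemma d_coneMk (c : Y × X) :
    (cone f).d (coneMk f c) = coneMk f (Y.d c.1 + f.toLinearMap c.2, -X.d c.2) := rfl

/-- A cocycle `(y, x)` of the cone is a cocycle `x` together with a primitive `-y` of its image.
Injectivity on cohomology makes `x` a coboundary, and surjectivity then deals with what remains of
`y`. -/
lemma acyclic_cone_iff : (cone f).Acyclic ↔ IsQI f := by
  rw [acyclic_iff]
  constructor
  · intro h
    constructor
    · rintro x hx ⟨w, hw⟩
      obtain ⟨c, hc⟩ := h (coneMk f (-w, x)) (by rw [d_coneMk]; simp [hw, hx]; rfl)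
      obtain ⟨c, rfl⟩ := (coneMk_bijective f).2 c
      rw [d_coneMk] at hc
      have := congrArg Prod.snd ((coneMk_bijective f).1 hc)
      exact ⟨-c.2, by simpa using this⟩
    · intro y hy
      obtain ⟨c, hc⟩ := h (coneMk f (y, 0)) (by rw [d_coneMk]; simp [hy]; rfl)
      obtain ⟨c, rfl⟩ := (coneMk_bijective f).2 c
      rw [d_coneMk] at hc
      have h1 := congrArg Prod.fst ((coneMk_bijective f).1 hc)
      have h2 := congrArg Prod.snd ((coneMk_bijective f).1 hc)
      exact ⟨c.2, by simpa using h2, c.1, by rw [add_comm]; exact h1.symm⟩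
  · intro h c hc
    obtain ⟨⟨y, x⟩, rfl⟩ := (coneMk_bijective f).2 c
    rw [d_coneMk] at hc
    have hc := (coneMk_bijective f).1 (hc.trans (map_zero (coneMk f)).symm)
    have h1 : Y.d y + f.toLinearMap x = 0 := congrArg Prod.fst hc
    have h2 : X.d x = 0 := by simpa using congrArg Prod.snd hc
    obtain ⟨v, rfl⟩ := h.inj x h2 ⟨-y, by rw [map_neg]; exact neg_eq_of_add_eq_zero_right h1⟩
    obtain ⟨x', hx', w, hw⟩ := h.surj (y + f.toLinearMap v) (by rw [map_add, ← f.map_d, h1])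
    refine ⟨coneMk f (w, -v + x'), ?_⟩
    rw [d_coneMk]
    congr 1
    ext
    · change Y.d w + f.toLinearMap (-v + x') = y
      rw [map_add, map_neg, eq_sub_of_add_eq hw]; abel
    · change -X.d (-v + x') = X.d v
      rw [map_add, hx', add_zero, map_neg, neg_neg]

variable (P : DGModule A)

local notation "ι" => CommDGRing.Hom.id A

/-- Auxiliary: `(y, x) ⊗ p ↦ (y ⊗ p, x ⊗ p)`. -/
noncomputable def coneTensorBi : cone f →+ P →+ cone (tensorMap ι f (𝟙 P)) :=
  ((tm ι Y P).compr₂ ((coneMk (tensorMap ι f (𝟙 P))).comp (AddMonoidHom.inl _ _))).comp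
      (coneFst f) +
    ((tm ι X P).compr₂ ((coneMk (tensorMap ι f (𝟙 P))).comp (AddMonoidHom.inr _ _))).comp
      (coneSnd f)

lemma coneTensorBi_mk (c : Y × X) (p : P) :
    coneTensorBi f P (coneMk f c) p
      = coneMk (tensorMap ι f (𝟙 P)) (tm ι Y P c.1 p, tm ι X P c.2 p) := by
  change coneMk (tensorMap ι f (𝟙 P)) (tm ι Y P c.1 p, 0)
    + coneMk (tensorMap ι f (𝟙 P)) (0, tm ι X P c.2 p) = _
  rw [← map_add, Prod.mk_add_mk, add_zero, zero_add]

lemma signedHom_smul_tm {i j k : ℤ} {a : A} {x : X} (p : P) (ha : a ∈ A.grading i)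
    (hx : x ∈ X.grading j) (hk : j = k + 1) :
    tm ι X P (A.signedHom a • x) p = (i * k).negOnePow • tm ι X P x (a • p) := by
  subst hk
  rw [CommDGRing.signedHom_of_mem ha, smul_assoc, map_unit_smul, AddMonoidHom.smul_apply,
    tm_smul_right _ ha hx, smul_smul, ← Int.negOnePow_add]
  exact sign_smul_congr (-i * k) (by ring) _

/-- The isomorphism `cone f ⊗_A P → cone (f ⊗_A P)`. -/
noncomputable def coneTensorHom : tensor ι (cone f) P ⟶ cone (tensorMap ι f (𝟙 P)) :=
  homOfTensor (tlift (coneTensorBi f P) (by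
      intro i j k a c p ha hc hp
      obtain ⟨⟨y, x⟩, rfl⟩ := (coneMk_bijective f).2 c
      rw [coneMk_mem] at hc
      change coneTensorBi f P (a • _) p = _
      rw [smul_coneMk, coneTensorBi_mk, coneTensorBi_mk, ← map_unit_smul]
      congr 1
      ext
      · exact tm_smul_left (f := ι) p ha hc.1
      · exact signedHom_smul_tm P p ha hc.2 rfl))
    (by
      intro k i j b c p hb hc hp
      obtain ⟨⟨y, x⟩, rfl⟩ := (coneMk_bijective f).2 c
      rw [tlift_tm, tlift_tm, smul_coneMk, coneTensorBi_mk, coneTensorBi_mk, smul_coneMk]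
      rfl)
    (by
      intro i j c p hc hp
      obtain ⟨⟨y, x⟩, rfl⟩ := (coneMk_bijective f).2 c
      rw [coneMk_mem] at hc
      rw [tlift_tm, coneTensorBi_mk, coneMk_mem]
      exact ⟨tm_mem rfl hc.1 hp, tm_mem (by ring) hc.2 hp⟩)
    (by
      intro i j c p hc hp
      obtain ⟨⟨y, x⟩, rfl⟩ := (coneMk_bijective f).2 c
      rw [coneMk_mem] at hc
      rw [tlift_tm, tlift_tm, tlift_tm, d_coneMk, coneTensorBi_mk, coneTensorBi_mk,
        coneTensorBi_mk, d_coneMk, ← map_unit_smul, ← map_add]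
      congr 1
      ext
      · change tm ι Y P (Y.d y + f.toLinearMap x) p + i.negOnePow • tm ι Y P y (P.d p)
          = (tensor ι Y P).d (tm ι Y P y p) + (tensorMap ι f (𝟙 P)).toLinearMap (tm ι X P x p)
        rw [d_tm hc.1, tensorMap_tm, id_toLinearMap, map_add, AddMonoidHom.add_apply]
        abel
      · change tm ι X P (-X.d x) p + i.negOnePow • tm ι X P x (P.d p)
          = -(tensor ι X P).d (tm ι X P x p)
        rw [d_tm hc.2, map_neg, AddMonoidHom.neg_apply, Int.negOnePow_succ, Units.neg_smul]
        abel)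

lemma coneTensorHom_tm (c : Y × X) (p : P) :
    (coneTensorHom f P).toLinearMap (tm ι (cone f) P (coneMk f c) p)
      = coneMk (tensorMap ι f (𝟙 P)) (tm ι Y P c.1 p, tm ι X P c.2 p) := by
  rw [coneTensorHom, homOfTensor_apply, tlift_tm, coneTensorBi_mk]

/-- The inverse of `coneTensorHom`. -/
noncomputable def coneTensorInv : cone (tensorMap ι f (𝟙 P)) →+ tensor ι (cone f) P :=
  (tlift ((tm ι (cone f) P).comp ((coneMk f).comp (AddMonoidHom.inl _ _))) (by
      intro i j k a y p ha hy hp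
      have : coneMk f (a • y, 0) = a • coneMk f (y, 0) := by rw [smul_coneMk, smul_zero]
      change tm ι (cone f) P (coneMk f (a • y, 0)) p
        = (i * j).negOnePow • tm ι (cone f) P (coneMk f (y, 0)) (a • p)
      rw [this]
      exact tm_smul_left (f := ι) p ha ((coneMk_mem f _).2 ⟨hy, zero_mem _⟩))).comp
    (coneFst (tensorMap ι f (𝟙 P))) +
  (tlift ((tm ι (cone f) P).comp ((coneMk f).comp (AddMonoidHom.inr _ _))) (by
      intro i j k a x p ha hx hp
      have : coneMk f (0, a • x) = i.negOnePow • a • coneMk f (0, x) := by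
        rw [smul_coneMk, smul_zero, CommDGRing.signedHom_of_mem ha, ← map_unit_smul,
          Prod.smul_mk, smul_zero, smul_assoc, smul_smul, Int.units_mul_self, one_smul]
      change tm ι (cone f) P (coneMk f (0, a • x)) p
        = (i * j).negOnePow • tm ι (cone f) P (coneMk f (0, x)) (a • p)
      rw [this, map_unit_smul, AddMonoidHom.smul_apply, tm_smul_right (j := j - 1) (f := ι) p ha
        ((coneMk_mem f _).2 ⟨zero_mem _, by simpa using hx⟩), smul_smul, ← Int.negOnePow_add]
      exact sign_smul_congr (i - i * j) (by ring) _)).comp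
    (coneSnd (tensorMap ι f (𝟙 P)))

lemma coneTensorHom_bijective : Function.Bijective (coneTensorHom f P).toLinearMap := by
  have h1 : ∀ x, coneTensorInv f P ((coneTensorHom f P).toLinearMap x) = x := by
    intro x
    induction x using tensor_ind with
    | hz => simp
    | ha x y hx hy => simp only [map_add, hx, hy]
    | ht i j c p hc hp =>
      obtain ⟨⟨y, x⟩, rfl⟩ := (coneMk_bijective f).2 c
      rw [coneTensorHom_tm, coneTensorInv]
      simp only [AddMonoidHom.add_apply, AddMonoidHom.comp_apply, coneFst_mk, coneSnd_mk, tlift_tm]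
      rw [← AddMonoidHom.add_apply, ← map_add, ← map_add]
      simp
  have h2 : ∀ y, (coneTensorHom f P).toLinearMap (coneTensorInv f P y) = y := by
    intro y
    obtain ⟨⟨y, x⟩, rfl⟩ := (coneMk_bijective _).2 y
    have e : coneMk (tensorMap ι f (𝟙 P)) (y, x) = coneMk (tensorMap ι f (𝟙 P)) (y, 0)
        + coneMk (tensorMap ι f (𝟙 P)) (0, x) := by rw [← map_add]; simp
    rw [e, map_add, map_add]
    congr 1
    · simp only [coneTensorInv, AddMonoidHom.add_apply, AddMonoidHom.comp_apply, coneFst_mk,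
        coneSnd_mk, map_zero, add_zero]
      induction y using tensor_ind with
      | hz => simp only [map_zero]; rfl
      | ha y z hy hz =>
        rw [map_add, map_add, hy (by rw [← map_add]; simp), hz (by rw [← map_add]; simp),
          ← map_add, Prod.mk_add_mk, add_zero]
      | ht i j y p _ _ =>
        rw [tlift_tm]
        refine (coneTensorHom_tm f P (y, 0) p).trans ?_
        simp
    · simp only [coneTensorInv, AddMonoidHom.add_apply, AddMonoidHom.comp_apply, coneFst_mk,
        coneSnd_mk, map_zero, zero_add]
      induction x using tensor_ind with
      | hz => simp only [map_zero]; rfl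
      | ha y z hy hz =>
        rw [map_add, map_add, hy (by rw [← map_add]; simp), hz (by rw [← map_add]; simp),
          ← map_add, Prod.mk_add_mk, add_zero]
      | ht i j x p _ _ =>
        rw [tlift_tm]
        refine (coneTensorHom_tm f P (0, x) p).trans ?_
        simp
  exact ⟨Function.LeftInverse.injective h1, Function.RightInverse.surjective h2⟩

/-- Tensoring commutes with cones. Hence preserving acyclicity, which defines K-flatness, amounts to
preserving quasi-isomorphisms. -/
lemma acyclic_cone_tensor_iff :
    (tensor ι (cone f) P).Acyclic ↔ IsQI (tensorMap ι f (𝟙 P)) := by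
  rw [← acyclic_cone_iff]
  exact ⟨(IsQI.of_bijective (coneTensorHom_bijective f P)).acyclic',
    (IsQI.of_bijective (coneTensorHom_bijective f P)).acyclic⟩

end Cone

section KFlat

variable {f : CommDGRing.Hom A B}

lemma acyclic_swap_iff (M N : DGModule A) :
    (tensor (CommDGRing.Hom.id A) M N).Acyclic ↔ (tensor (CommDGRing.Hom.id A) N M).Acyclic :=
  ⟨(IsQI.of_bijective (swapHom_bijective M N)).acyclic',
    (IsQI.of_bijective (swapHom_bijective M N)).acyclic⟩

lemma isQI_swap_iff {M N M' N' : DGModule A} (φ : M ⟶ M') (ψ : N ⟶ N') :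
    IsQI (tensorMap (CommDGRing.Hom.id A) φ ψ) ↔ IsQI (tensorMap (CommDGRing.Hom.id A) ψ φ) := by
  have h1 := IsQI.of_bijective (swapHom_bijective M N)
  have h2 := IsQI.of_bijective (swapHom_bijective M' N')
  constructor
  · intro h
    exact IsQI.of_comp_left h1 (swapHom_natural M N φ ψ ▸ h.comp h2)
  · intro h
    exact IsQI.of_comp_right h2 (swapHom_natural M N φ ψ ▸ h1.comp h)

lemma KFlat.acyclic_tensor {P : DGModule A} (hP : P.KFlat) {N : DGModule B} (hN : N.Acyclic) :
    (tensor f N P).Acyclic := by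
  rw [← acyclic_res_tensor_iff]
  exact hP _ ((acyclic_res_iff f N).2 hN)

/-- Tensoring with a K-flat DG module preserves quasi-isomorphisms. -/
lemma KFlat.isQI_tensorMap_left {P : DGModule A} (hP : P.KFlat) {M N : DGModule B} {φ : M ⟶ N}
    (hφ : IsQI φ) : IsQI (tensorMap f φ (𝟙 P)) := by
  rw [← isQI_res_tensorMap_iff, ← acyclic_cone_tensor_iff]
  exact hP _ ((acyclic_cone_iff _).2 ((isQI_resMap_iff f φ).2 hφ))

lemma KFlat.isQI_tensorMap_right {P : DGModule A} (hP : P.KFlat) {M N : DGModule A} {φ : M ⟶ N}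
    (hφ : IsQI φ) : IsQI (tensorMap (CommDGRing.Hom.id A) (𝟙 P) φ) :=
  (isQI_swap_iff _ _).1 (hP.isQI_tensorMap_left hφ)

/-- By associativity, tensoring with `M ⊗ N` is tensoring first with `M` and then with `N`. The case
`M = B` gives K-flatness of base changes. -/
lemma kFlat_tensor {M : DGModule B} {N : DGModule A} (hM : M.KFlat) (hN : N.KFlat) :
    (tensor f M N).KFlat := fun X hX =>
  (IsQI.of_bijective (assocHom_bijective f (CommDGRing.Hom.id B) f X M N fun _ => rfl)).acyclic'
    (hN.acyclic_tensor (hM X hX))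

lemma kFlat_self : (self A).KFlat := fun X hX =>
  (IsQI.of_bijective (unitHom_bijective (CommDGRing.Hom.id A) X)).acyclic' hX

/-- Tensored with an acyclic `X`, source and target of `φ` become acyclic, and every homomorphism
between acyclic DG modules is a quasi-isomorphism. -/
lemma kFlat_cone {M N : DGModule A} (hM : M.KFlat) (hN : N.KFlat) (φ : M ⟶ N) :
    (cone φ).KFlat := fun X hX => by
  rw [acyclic_swap_iff, acyclic_cone_tensor_iff]
  have h1 := (acyclic_iff _).1 ((acyclic_swap_iff X M).1 (hM X hX))
  have h2 := (acyclic_iff _).1 ((acyclic_swap_iff X N).1 (hN X hX))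
  exact ⟨fun x hx _ => h1 x hx, fun y hy => ⟨0, map_zero _, by
    obtain ⟨w, hw⟩ := h2 y hy
    exact ⟨w, by rw [hw, map_zero, zero_add]⟩⟩⟩

end KFlat

end DGModule
end DG

/-! ### Free graded modules with prescribed differential, and their K-flatness. -/

namespace DG
open CategoryTheory
open scoped TensorProduct

namespace DGModule

variable {A B : CommDGRing.{u}}

lemma d_tm_signed {f : CommDGRing.Hom A B} {M : DGModule B} {N : DGModule A} (m : M) (n : N) :
    (tensor f M N).d (tm f M N m n)
      = tm f M N (M.d m) n + tm f M N (signed M.isInternal m) (N.d n) := by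
  induction m using graded_induction M.isInternal with
  | hz => simp
  | ha x y hx hy => simp only [map_add, AddMonoidHom.add_apply, hx, hy]; abel
  | hm i m hm => rw [d_tm hm, signed_of_mem _ hm, map_unit_smul, AddMonoidHom.smul_apply]

/-- The right action `x ⊗ a ↦ (-1) ^ (i * j) • a x`, as a map of `A`. -/
noncomputable def ract (f : CommDGRing.Hom A B) (X : DGModule B) : X →+ A →+ X :=
  (rightAction f X).compl₂ (ofRing A)

lemma ract_apply {f : CommDGRing.Hom A B} {X : DGModule B} {i j : ℤ} {x : X} {a : A}
    (hx : x ∈ X.grading i) (ha : a ∈ A.grading j) :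
    ract f X x a = (i * j).negOnePow • f.toRingHom a • x :=
  rightAction_apply f X hx ha

lemma ract_one {f : CommDGRing.Hom A B} {X : DGModule B} (x : X) : ract f X x 1 = x := by
  induction x using graded_induction X.isInternal with
  | hz => simp
  | ha x y hx hy => rw [map_add, AddMonoidHom.add_apply, hx, hy]
  | hm i x hx => rw [ract_apply hx A.one_mem]; simp

lemma tm_ract {f : CommDGRing.Hom A B} {M : DGModule B} {N : DGModule A} (m : M) (a : A) (n : N) :
    tm f M N (ract f M m a) n = tm f M N m (a • n) := by
  induction m using graded_induction M.isInternal with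
  | hz => simp
  | ha x y hx hy => simp only [map_add, AddMonoidHom.add_apply, hx, hy]
  | hm i m hm =>
    induction a using A.hom_induction with
    | hz => simp
    | ha x y hx hy => simp only [map_add, AddMonoidHom.add_apply, hx, hy, add_smul]
    | hm j a ha =>
      rw [ract_apply hm ha, tm_smul_right _ ha hm, map_unit_smul, AddMonoidHom.smul_apply,
        mul_comm]

lemma ract_smul {f : CommDGRing.Hom A B} {X : DGModule B} {i j k : ℤ} {x : X} {a b : A}
    (hx : x ∈ X.grading i) (ha : a ∈ A.grading j) (hb : b ∈ A.grading k) :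
    ract f X (f.toRingHom a • x) b = (j * i).negOnePow • ract f X x (a * b) := by
  have e : f.toRingHom b • f.toRingHom a • x = (j * k).negOnePow • f.toRingHom (a * b) • x := by
    rw [smul_smul, ← map_mul, A.mul_comm_sign ha hb, map_unit_smul, smul_assoc]
  rw [ract_apply (X.smul_mem (f.map_mem ha) hx) hb, ract_apply hx (A.mul_mem ha hb), e, smul_smul,
    smul_smul, ← Int.negOnePow_add, ← Int.negOnePow_add]
  exact sign_smul_congr (j * k - j * i) (by ring) _

/-- A set of generators with degrees and prescribed differentials. -/
structure FreeData (A : CommDGRing.{u}) : Type (u + 1) where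
  gen : Type u
  deg : gen → ℤ
  δ : gen → gen →₀ A

namespace FreeData

variable (F : FreeData A)

/-- The additive extension of `δ` to the free module by the Leibniz rule. -/
noncomputable def D : (F.gen →₀ A) →+ (F.gen →₀ A) :=
  Finsupp.liftAddHom fun e =>
    (Finsupp.singleAddHom e).comp A.d +
      ((AddMonoidHom.smul : A →+ (F.gen →₀ A) →+ (F.gen →₀ A)).flip (F.δ e)).comp
        (signed A.isInternal)

lemma D_single (e : F.gen) (a : A) :
    F.D (Finsupp.single e a) = Finsupp.single e (A.d a) + signed A.isInternal a • F.δ e := by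
  simp [D]

/-- The grading of the free module. -/
def grading (i : ℤ) : AddSubgroup (F.gen →₀ A) where
  carrier := {x | ∀ e, x e ∈ A.grading (i - F.deg e)}
  add_mem' hx hy e := add_mem (hx e) (hy e)
  zero_mem' _ := zero_mem _
  neg_mem' hx e := neg_mem (hx e)

variable {F}

lemma single_mem {i : ℤ} {e : F.gen} {a : A} (ha : a ∈ A.grading (i - F.deg e)) :
    Finsupp.single e a ∈ F.grading i := by
  classical
  intro e'
  rw [Finsupp.single_apply]
  split_ifs with h
  · rwa [← h]
  · exact zero_mem _

lemma smul_mem {i j : ℤ} {a : A} {x : F.gen →₀ A} (ha : a ∈ A.grading i) (hx : x ∈ F.grading j) :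
    a • x ∈ F.grading (i + j) := fun e => by
  rw [Finsupp.smul_apply, smul_eq_mul, add_sub_assoc]
  exact A.mul_mem ha (hx e)

lemma grading_ind {i : ℤ} {p : ∀ x, x ∈ F.grading i → Prop} (hz : p 0 (zero_mem _))
    (hs : ∀ e a ha, p (Finsupp.single e a) (single_mem ha))
    (ha : ∀ x y hx hy, p x hx → p y hy → p (x + y) (add_mem hx hy)) {x : F.gen →₀ A}
    (hx : x ∈ F.grading i) : p x hx := by
  have : ∃ h : x ∈ F.grading i, p x h := by
    rw [← Finsupp.sum_single x]
    refine Finset.sum_induction _ (fun x => ∃ h : x ∈ F.grading i, p x h) ?_ ⟨_, hz⟩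
      fun e _ => ⟨_, hs e _ (hx e)⟩
    rintro x y ⟨h1, h2⟩ ⟨h3, h4⟩
    exact ⟨_, ha x y h1 h3 h2 h4⟩
  exact this.2

variable (F) in
lemma isInternal : DirectSum.IsInternal F.grading := by
  refine isInternal_of_components
    (Finsupp.liftAddHom fun e => ((Finsupp.mapDomain.addMonoidHom fun i => i + F.deg e).comp
      (Finsupp.mapRange.addMonoidHom (Finsupp.singleAddHom e))).comp (components A.isInternal))
    ?_ ?_
  · intro i x hx
    induction hx using grading_ind with
    | hz => simp
    | ha x y _ _ hx hy => rw [map_add, hx, hy, Finsupp.single_add]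
    | hs e a ha => simp [components_of_mem A.isInternal ha, Finsupp.mapDomain_single]
  · rw [eq_top_iff]
    rintro x -
    induction x using Finsupp.induction_linear with
    | zero => exact zero_mem _
    | add x y hx hy => exact add_mem hx hy
    | single e a =>
      induction a using A.hom_induction with
      | hz => simp
      | ha a b ha hb => rw [Finsupp.single_add]; exact add_mem ha hb
      | hm i a ha =>
        exact AddSubgroup.mem_iSup_of_mem (i + F.deg e) (single_mem (by simpa using ha))

lemma D_smul {i : ℤ} {a : A} (ha : a ∈ A.grading i) (x : F.gen →₀ A) :
    F.D (a • x) = A.d a • x + i.negOnePow • (a • F.D x) := by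
  induction x using Finsupp.induction_linear with
  | zero => simp
  | add x y hx hy => simp only [smul_add, map_add, hx, hy]; abel
  | single e b =>
    rw [Finsupp.smul_single, D_single, D_single, smul_eq_mul, A.leibniz ha,
      show signed A.isInternal (a * b) = A.signedHom (a * b) from rfl, map_mul,
      CommDGRing.signedHom_of_mem ha, smul_add, smul_add, Finsupp.smul_single, Finsupp.smul_single,
      Finsupp.smul_single, Finsupp.single_add, smul_mul_assoc, smul_assoc, mul_smul, smul_eq_mul,
      smul_eq_mul, add_assoc]
    rfl

variable (F) in
/-- The conditions under which `D` is the differential of a DG module. -/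
structure IsDG : Prop where
  δ_mem : ∀ e, F.δ e ∈ F.grading (F.deg e + 1)
  D_δ : ∀ e, F.D (F.δ e) = 0

lemma IsDG.D_mem (h : F.IsDG) {i : ℤ} {x : F.gen →₀ A} (hx : x ∈ F.grading i) :
    F.D x ∈ F.grading (i + 1) := by
  induction hx using grading_ind with
  | hz => rw [map_zero]; exact zero_mem _
  | ha x y _ _ hx hy => rw [map_add]; exact add_mem hx hy
  | hs e a ha =>
    rw [D_single]
    refine add_mem (single_mem ?_) ?_
    · have := A.d_mem ha
      rwa [sub_add_eq_add_sub] at this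
    · have := smul_mem (signed_mem A.isInternal ha) (h.δ_mem e)
      rwa [← add_assoc, sub_add_cancel] at this

lemma IsDG.D_D (h : F.IsDG) (x : F.gen →₀ A) : F.D (F.D x) = 0 := by
  induction x using Finsupp.induction_linear with
  | zero => simp
  | add x y hx hy => rw [map_add, map_add, hx, hy, add_zero]
  | single e a =>
    induction a using A.hom_induction with
    | hz => simp
    | ha a b ha hb => rw [Finsupp.single_add, map_add, map_add, ha, hb, add_zero]
    | hm i a ha =>
      rw [D_single, map_add, D_single, A.d_d, signed_of_mem _ ha, signed_of_mem _ (A.d_mem ha),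
        smul_assoc, smul_assoc, map_unit_smul, D_smul ha, h.D_δ, smul_zero, smul_zero, add_zero,
        Int.negOnePow_succ, Finsupp.single_zero, zero_add, Units.neg_smul, neg_add_cancel]

end FreeData

/-- The DG module with free underlying graded module on the given generators. -/
noncomputable def free (F : FreeData A) (h : F.IsDG) : DGModule A where
  carrier := F.gen →₀ A
  grading := F.grading
  isInternal := F.isInternal
  smul_mem := FreeData.smul_mem
  d := F.D
  d_mem := h.D_mem
  d_d := h.D_D
  leibniz := FreeData.D_smul

section Free

variable {F : FreeData A} (h : F.IsDG)

/-- The element of a free DG module with given coordinates. -/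
noncomputable def freeMk : (F.gen →₀ A) ≃ₗ[A] free F h := LinearEquiv.refl _ _

lemma freeMk_mem {i : ℤ} {x : F.gen →₀ A} :
    freeMk h x ∈ (free F h).grading i ↔ x ∈ F.grading i := Iff.rfl

lemma d_freeMk (x : F.gen →₀ A) : (free F h).d (freeMk h x) = freeMk h (F.D x) := rfl

/-- A generator of a free DG module. -/
noncomputable def fgen (e : F.gen) : free F h := freeMk h (Finsupp.single e 1)

lemma fgen_mem (e : F.gen) : fgen h e ∈ (free F h).grading (F.deg e) :=
  FreeData.single_mem (by rw [sub_self]; exact A.one_mem)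

lemma d_fgen (e : F.gen) : (free F h).d (fgen h e) = freeMk h (F.δ e) := by
  rw [fgen, d_freeMk, FreeData.D_single, A.d_one, Finsupp.single_zero, zero_add,
    signed_of_mem _ A.one_mem]
  simp

lemma freeMk_single (e : F.gen) (a : A) : freeMk h (Finsupp.single e a) = a • fgen h e := by
  rw [fgen, ← map_smul, Finsupp.smul_single, smul_eq_mul, mul_one]

lemma free_ind {p : free F h → Prop} (hz : p 0) (hs : ∀ e (a : A), p (a • fgen h e))
    (ha : ∀ x y, p x → p y → p (x + y)) (x : free F h) : p x := by
  obtain ⟨x, rfl⟩ := (freeMk h).surjective x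
  induction x using Finsupp.induction_linear with
  | zero => rw [map_zero]; exact hz
  | add x y hx hy => rw [map_add]; exact ha _ _ hx hy
  | single e a => rw [freeMk_single]; exact hs e a

/-- The homomorphism from a free DG module given by the images of the generators. -/
noncomputable def freeDesc {N : DGModule A} (y : F.gen → N) (hy : ∀ e, y e ∈ N.grading (F.deg e))
    (hd : ∀ e, N.d (y e) = Finsupp.linearCombination A y (F.δ e)) : free F h ⟶ N where
  toLinearMap := (Finsupp.linearCombination A y).comp (freeMk h).symm.toLinearMap
  map_mem := by
    intro i x hx
    obtain ⟨x, rfl⟩ := (freeMk h).surjective x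
    change Finsupp.linearCombination A y x ∈ _
    rw [freeMk_mem] at hx
    induction hx using FreeData.grading_ind with
    | hz => rw [map_zero]; exact zero_mem _
    | ha x y _ _ hx hy => rw [map_add]; exact add_mem hx hy
    | hs e a ha =>
      rw [Finsupp.linearCombination_single]
      have := N.smul_mem ha (hy e)
      rwa [sub_add_cancel] at this
  map_d := by
    intro x
    obtain ⟨x, rfl⟩ := (freeMk h).surjective x
    change Finsupp.linearCombination A y (F.D x) = N.d (Finsupp.linearCombination A y x)
    induction x using Finsupp.induction_linear with
    | zero => simp
    | add x y hx hy => simp only [map_add, hx, hy]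
    | single e a =>
      rw [FreeData.D_single, map_add, map_smul, ← hd, Finsupp.linearCombination_single,
        Finsupp.linearCombination_single]
      induction a using A.hom_induction with
      | hz => simp
      | ha a b ha hb => simp only [map_add, add_smul, ← ha, ← hb]; abel
      | hm i a ha => rw [N.leibniz ha, signed_of_mem _ ha, smul_assoc]

lemma freeDesc_freeMk {N : DGModule A} (y : F.gen → N) (hy hd) (x : F.gen →₀ A) :
    (freeDesc h (N := N) y hy hd).toLinearMap (freeMk h x) = Finsupp.linearCombination A y x := rfl

lemma freeDesc_fgen {N : DGModule A} (y : F.gen → N) (hy hd) (e : F.gen) :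
    (freeDesc h (N := N) y hy hd).toLinearMap (fgen h e) = y e := by
  rw [fgen, freeDesc_freeMk, Finsupp.linearCombination_single, one_smul]

lemma free_hom_ext {N : DGModule A} {φ ψ : free F h ⟶ N}
    (hφ : ∀ e, φ.toLinearMap (fgen h e) = ψ.toLinearMap (fgen h e)) : φ = ψ :=
  hom_eq fun x => by
    induction x using free_ind with
    | hz => simp
    | ha x y hx hy => rw [map_add, map_add, hx, hy]
    | hs e a => rw [map_smul, map_smul, hφ]

section Tensor

variable (f : CommDGRing.Hom A B) (N : DGModule B)

/-- The map `(n_e) ↦ ∑ n_e ⊗ e`. -/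
noncomputable def fromFinsupp : (F.gen →₀ N) →+ tensor f N (free F h) :=
  Finsupp.liftAddHom fun e => (tm f N (free F h)).flip (fgen h e)

lemma fromFinsupp_single (e : F.gen) (n : N) :
    fromFinsupp h f N (Finsupp.single e n) = tm f N (free F h) n (fgen h e) := by
  simp [fromFinsupp]

/-- The coordinates of an element of `N ⊗_A free F`. -/
noncomputable def toFinsupp : tensor f N (free F h) →+ (F.gen →₀ N) :=
  tlift (AddMonoidHom.mk' (fun n => (Finsupp.mapRange.addMonoidHom (ract f N n)).comp
      (freeMk h).symm.toAddMonoidHom) fun x y => by ext z e; simp) (by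
    intro i j k a m x ha hm hx
    obtain ⟨x, rfl⟩ := (freeMk h).surjective x
    rw [freeMk_mem] at hx
    rw [← LinearEquiv.map_smul]
    ext e
    rw [Finsupp.smul_apply]
    change ract f N (f.toRingHom a • m) (x e) = (i * j).negOnePow • ract f N m ((a • x) e)
    rw [ract_smul hm ha (hx e)]
    rfl)

lemma toFinsupp_tm (n : N) (x : F.gen →₀ A) (e : F.gen) :
    toFinsupp h f N (tm f N (free F h) n (freeMk h x)) e = ract f N n (x e) := by
  rw [toFinsupp, tlift_tm]; rfl

lemma toFinsupp_fgen (n : N) (e : F.gen) :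
    toFinsupp h f N (tm f N (free F h) n (fgen h e)) = Finsupp.single e n := by
  classical
  ext e'
  rw [fgen, toFinsupp_tm, Finsupp.single_apply, Finsupp.single_apply]
  split_ifs
  · rw [ract_one]
  · rw [map_zero]

lemma toFinsupp_fromFinsupp (w : F.gen →₀ N) : toFinsupp h f N (fromFinsupp h f N w) = w := by
  induction w using Finsupp.induction_linear with
  | zero => simp
  | add x y hx hy => rw [map_add, map_add, hx, hy]
  | single e n => rw [fromFinsupp_single, toFinsupp_fgen]

lemma fromFinsupp_surjective : Function.Surjective (fromFinsupp h f N) := by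
  intro w
  induction w using tensor_ind with
  | hz => exact ⟨0, map_zero _⟩
  | ha x y hx hy =>
    obtain ⟨x, rfl⟩ := hx
    obtain ⟨y, rfl⟩ := hy
    exact ⟨x + y, map_add _ _ _⟩
  | ht i j n x _ hx =>
    clear hx
    induction x using free_ind with
    | hz => exact ⟨0, by simp⟩
    | ha x y hx hy =>
      obtain ⟨v, hx⟩ := hx
      obtain ⟨w, hy⟩ := hy
      exact ⟨v + w, by rw [map_add, map_add, hx, hy]⟩
    | hs e a => exact ⟨Finsupp.single e (ract f N n a), by rw [fromFinsupp_single, tm_ract]⟩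

lemma fromFinsupp_toFinsupp (w : tensor f N (free F h)) :
    fromFinsupp h f N (toFinsupp h f N w) = w := by
  obtain ⟨w, rfl⟩ := fromFinsupp_surjective h f N w
  rw [toFinsupp_fromFinsupp]

lemma fromFinsupp_injective : Function.Injective (fromFinsupp h f N) :=
  Function.LeftInverse.injective (toFinsupp_fromFinsupp h f N)

variable {N} in
lemma tensorMap_fromFinsupp {N' : DGModule B} (φ : N ⟶ N') (w : F.gen →₀ N) :
    (tensorMap f φ (𝟙 (free F h))).toLinearMap (fromFinsupp h f N w)
      = fromFinsupp h f N' (Finsupp.mapRange.addMonoidHom φ.toLinearMap.toAddMonoidHom w) := by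
  induction w using Finsupp.induction_linear with
  | zero => simp
  | add x y hx hy => simp only [map_add, hx, hy]
  | single e n =>
    rw [fromFinsupp_single, tensorMap_tm, id_toLinearMap,
      Finsupp.mapRange.addMonoidHom_apply, Finsupp.mapRange_single, fromFinsupp_single]
    rfl

variable {N} in
/-- Free DG modules are flat as graded modules. -/
lemma tensorMap_free_injective {N' : DGModule B} (φ : N ⟶ N')
    (hφ : Function.Injective φ.toLinearMap) :
    Function.Injective (tensorMap f φ (𝟙 (free F h))).toLinearMap := by
  intro x y hxy
  obtain ⟨x, rfl⟩ := fromFinsupp_surjective h f N x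
  obtain ⟨y, rfl⟩ := fromFinsupp_surjective h f N y
  rw [tensorMap_fromFinsupp, tensorMap_fromFinsupp] at hxy
  congr 1
  ext e
  exact hφ (DFunLike.congr_fun (fromFinsupp_injective h f N' hxy) e)

lemma d_fromFinsupp_single (e : F.gen) (n : N) :
    (tensor f N (free F h)).d (fromFinsupp h f N (Finsupp.single e n))
      = tm f N (free F h) (N.d n) (fgen h e)
        + tm f N (free F h) (signed N.isInternal n) (freeMk h (F.δ e)) := by
  rw [fromFinsupp_single, d_tm_signed, d_fgen]

variable {h f N}

/-- The terms coming from `δ e` with `lev e ≤ k` only reach levels below `k`. At levels from `k` on,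
the differential therefore acts coordinate by coordinate. -/
lemma toFinsupp_d_apply {lev : F.gen → ℕ} (hlev : ∀ e e', F.δ e e' ≠ 0 → lev e' < lev e) {k : ℕ}
    {w : F.gen →₀ N} (hw : ∀ e, k < lev e → w e = 0) {e₀ : F.gen} (he₀ : k ≤ lev e₀) :
    toFinsupp h f N ((tensor f N (free F h)).d (fromFinsupp h f N w)) e₀ = N.d (w e₀) := by
  have key : ∀ e, toFinsupp h f N ((tensor f N (free F h)).d
      (fromFinsupp h f N (Finsupp.single e (w e)))) e₀ = (Finsupp.single e (N.d (w e))) e₀ := by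
    intro e
    rw [d_fromFinsupp_single, map_add, Finsupp.add_apply, toFinsupp_fgen, toFinsupp_tm]
    by_cases he : k < lev e
    · simp [hw e he]
    · have : F.δ e e₀ = 0 := by
        by_contra hne
        have := hlev e e₀ hne
        omega
      rw [this, map_zero, add_zero]
  conv_lhs => rw [← Finsupp.sum_single w, Finsupp.sum, map_sum, map_sum, map_sum,
    Finsupp.finsetSum_apply]
  rw [Finset.sum_congr rfl fun e _ => key e]
  have : ∑ e ∈ w.support, (Finsupp.single e (N.d (w e))) e₀
      = (Finsupp.mapRange.addMonoidHom N.d w) e₀ := by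
    conv_rhs => rw [← Finsupp.sum_single w, Finsupp.sum, map_sum, Finsupp.finsetSum_apply]
    simp
  rw [this]
  rfl

variable (h) in
/-- A DG module with a filtered basis is K-flat. -/
lemma kFlat_free (lev : F.gen → ℕ) (hlev : ∀ e e', F.δ e e' ≠ 0 → lev e' < lev e) :
    (free F h).KFlat := by
  intro N hN
  rw [acyclic_iff] at *
  -- Induction on a strict upper bound `k` for the levels occurring in `w`.
  have key : ∀ (k : ℕ) (w : F.gen →₀ N), (∀ e, k ≤ lev e → w e = 0) →
      (tensor (CommDGRing.Hom.id A) N (free F h)).d (fromFinsupp h _ N w) = 0 →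
      ∃ v, (tensor (CommDGRing.Hom.id A) N (free F h)).d v = fromFinsupp h _ N w := by
    intro k
    induction k with
    | zero =>
      intro w hw _
      have : w = 0 := by ext e; exact hw e (Nat.zero_le _)
      exact ⟨0, by rw [this, map_zero, map_zero]⟩
    | succ k ih =>
      intro w hw hdw
      have hw' : ∀ e, k < lev e → w e = 0 := fun e he => hw e he
      have hex : ∀ e, k ≤ lev e → ∃ n, N.d n = w e := fun e he => hN _ (by
        rw [← toFinsupp_d_apply (h := h) (f := CommDGRing.Hom.id A) hlev hw' he, hdw]
        simp)
      classical
      let m : F.gen → N := fun e =>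
        if he : w e ≠ 0 ∧ k ≤ lev e then (hex e he.2).choose else 0
      have hm : ∀ e, k ≤ lev e → N.d (m e) = w e := by
        intro e he
        by_cases h0 : w e = 0
        · simp [m, h0]
        · simp only [m, ne_eq, h0, not_false_eq_true, he, and_self, ↓reduceDIte]
          exact (hex e he).choose_spec
      -- The coordinates of `w` in the highest level are cocycles of the acyclic `N`. Their chosen
      -- primitives form `v`, and subtracting the differential of `v` lowers the level bound by one.
      let v : F.gen →₀ N := Finsupp.onFinset w.support m fun e he => by
        by_contra h0
        rw [Finsupp.notMem_support_iff] at h0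
        exact he (by simp [m, h0])
      have hv : ∀ e, k < lev e → v e = 0 := fun e he => by
        change m e = 0
        simp [m, hw' e he]
      obtain ⟨u, hu⟩ := ih (w - toFinsupp h _ N
          ((tensor (CommDGRing.Hom.id A) N (free F h)).d (fromFinsupp h _ N v))) (by
        intro e he
        rw [Finsupp.sub_apply, toFinsupp_d_apply hlev hv he, sub_eq_zero]
        exact (hm e he).symm) (by
        rw [map_sub, map_sub, hdw, fromFinsupp_toFinsupp, d_d, sub_zero])
      refine ⟨u + fromFinsupp h _ N v, ?_⟩
      rw [map_add, hu, map_sub, fromFinsupp_toFinsupp, sub_add_cancel]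
  intro x hx
  obtain ⟨w, rfl⟩ := fromFinsupp_surjective h _ N x
  refine key ((w.support.sup lev) + 1) w (fun e he => ?_) hx
  by_contra hne
  have := Finset.le_sup (f := lev) (Finsupp.mem_support_iff.2 hne)
  omega

end Tensor

end Free

end DGModule
end DG

/-! ### Functorial semi-free resolutions. -/

namespace DG
open CategoryTheory
open scoped TensorProduct

namespace DGModule

variable {A B : CommDGRing.{u}}

section FreeMap

variable {F F' F'' : FreeData A} (h : F.IsDG) (h' : F'.IsDG) (m : F.gen → F'.gen)

/-- The homomorphism of free DG modules induced by a map of generators. -/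
noncomputable def freeMap (hdeg : ∀ e, F'.deg (m e) = F.deg e)
    (hδ : ∀ e, F'.δ (m e) = Finsupp.mapDomain m (F.δ e)) : free F h ⟶ free F' h' :=
  freeDesc h (N := free F' h') (fun e => fgen h' (m e)) (fun e => hdeg e ▸ fgen_mem h' (m e))
    (fun e => by
      rw [d_fgen, hδ]
      induction F.δ e using Finsupp.induction_linear with
      | zero => simp
      | add x y hx hy => rw [Finsupp.mapDomain_add, map_add, map_add, hx, hy]
      | single e a =>
        rw [Finsupp.mapDomain_single, Finsupp.linearCombination_single, freeMk_single])

lemma freeMap_fgen (hdeg hδ) (e : F.gen) :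
    (freeMap h h' m hdeg hδ).toLinearMap (fgen h e) = fgen h' (m e) :=
  freeDesc_fgen h _ _ _ e

end FreeMap

/-- Rewrites a finitely supported function as families indexed by `Fin r`, the shape in which the
constructor of `Gen` takes its data. -/
lemma exists_fin_sum {E R : Type*} [AddCommGroup R] (x : E →₀ R) :
    ∃ (r : ℕ) (t : Fin r → E) (a : Fin r → R), (∀ k, a k = x (t k)) ∧ (∀ k, t k ∈ x.support) ∧
      ∑ k, Finsupp.single (t k) (a k) = x := by
  let e := x.support.equivFin
  refine ⟨_, fun k => (e.symm k : E), fun k => x (e.symm k), fun _ => rfl,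
    fun k => (e.symm k).2, ?_⟩
  conv_rhs => rw [← Finsupp.sum_single x, Finsupp.sum, ← Finset.sum_coe_sort]
  exact Fintype.sum_equiv e.symm _ _ fun _ => rfl

variable (A) in
/-- Formal generators for a semi-free resolution of a DG module with underlying set `M`: a generator
consists of its degree, of a formal linear combination of generators that is its differential, and
of its image in `M`. -/
inductive Gen (M : Type u) : Type u
  | mk (i : ℤ) (r : ℕ) (a : Fin r → A) (t : Fin r → Gen M) (y : M) : Gen M

namespace Gen

variable {M M' M'' : DGModule A}

/-- The data of the free module on all formal generators. -/
@[reducible] noncomputable def raw (M : DGModule A) : FreeData A where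
  gen := Gen A M
  deg | mk i _ _ _ _ => i
  δ | mk _ _ a t _ => ∑ k, Finsupp.single (t k) (a k)

/-- The image of a formal generator. -/
def val : Gen A M → M
  | mk _ _ _ _ y => y

/-- The nesting depth of a formal generator. -/
def lev : Gen A M → ℕ
  | mk _ _ _ t _ => (Finset.univ.sup fun k => lev (t k)) + 1

/-- The action of a homomorphism on formal generators. -/
def map (ψ : M ⟶ M') : Gen A M → Gen A M'
  | mk i r a t y => mk i r a (fun k => map ψ (t k)) (ψ.toLinearMap y)

/-- The linear extension of `val`. -/
noncomputable def lin (M : DGModule A) : (Gen A M →₀ A) →ₗ[A] M :=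
  Finsupp.linearCombination A val

variable (p : ℤ → Prop)

/-- The consistent formal generators with degrees satisfying `p`. -/
inductive WF : Gen A M → Prop
  | mk (i : ℤ) (r : ℕ) (a : Fin r → A) (t : Fin r → Gen A M) (y : M)
      (hi : p i) (ht : ∀ k, WF (t k)) (hy : y ∈ M.grading i)
      (ha : ∑ k, Finsupp.single (t k) (a k) ∈ (raw M).grading (i + 1))
      (hD : (raw M).D (∑ k, Finsupp.single (t k) (a k)) = 0)
      (hl : lin M (∑ k, Finsupp.single (t k) (a k)) = M.d y) : WF (.mk i r a t y)

variable {p}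

lemma WF.deg {g : Gen A M} (h : WF p g) : p ((raw M).deg g) := by
  cases h; assumption

lemma WF.δ_mem {g : Gen A M} (h : WF p g) : (raw M).δ g ∈ (raw M).grading ((raw M).deg g + 1) := by
  cases h; assumption

lemma WF.D_δ {g : Gen A M} (h : WF p g) : (raw M).D ((raw M).δ g) = 0 := by
  cases h; assumption

lemma WF.lin_δ {g : Gen A M} (h : WF p g) : lin M ((raw M).δ g) = M.d g.val := by
  cases h; assumption

lemma WF.val_mem {g : Gen A M} (h : WF p g) : g.val ∈ M.grading ((raw M).deg g) := by
  cases h; assumption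

lemma exists_of_δ_ne_zero {g g' : Gen A M} (h : (raw M).δ g g' ≠ 0) :
    ∃ (i : ℤ) (r : ℕ) (a : Fin r → A) (t : Fin r → Gen A M) (y : M) (k : Fin r),
      g = mk i r a t y ∧ g' = t k := by
  obtain ⟨i, r, a, t, y⟩ := g
  change (∑ k, Finsupp.single (t k) (a k)) g' ≠ 0 at h
  rw [Finsupp.finsetSum_apply] at h
  obtain ⟨k, _, hk⟩ := Finset.exists_ne_zero_of_sum_ne_zero h
  exact ⟨i, r, a, t, y, k, rfl, by
    by_contra hne
    exact hk (Finsupp.single_eq_of_ne hne)⟩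

lemma WF.of_δ_ne_zero {g g' : Gen A M} (h : WF p g) (hg : (raw M).δ g g' ≠ 0) : WF p g' := by
  obtain ⟨i, r, a, t, y, k, rfl, rfl⟩ := exists_of_δ_ne_zero hg
  cases h with
  | mk _ _ _ _ _ _ ht => exact ht k

lemma lev_lt {g g' : Gen A M} (hg : (raw M).δ g g' ≠ 0) : lev g' < lev g := by
  obtain ⟨i, r, a, t, y, k, rfl, rfl⟩ := exists_of_δ_ne_zero hg
  rw [lev]
  exact Nat.lt_succ_of_le (Finset.le_sup (f := fun k => lev (t k)) (Finset.mem_univ k))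

lemma map_id (g : Gen A M) : map (𝟙 M) g = g := by
  induction g with
  | mk i r a t y ih => simp only [map, ih, id_toLinearMap]

lemma map_comp (φ : M ⟶ M') (ψ : M' ⟶ M'') (g : Gen A M) :
    map (φ ≫ ψ) g = map ψ (map φ g) := by
  induction g with
  | mk i r a t y ih => simp only [map, ih, comp_toLinearMap]

lemma deg_map (ψ : M ⟶ M') (g : Gen A M) : (raw M').deg (map ψ g) = (raw M).deg g := by
  cases g; rfl

lemma val_map (ψ : M ⟶ M') (g : Gen A M) : (map ψ g).val = ψ.toLinearMap g.val := by
  cases g; rfl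

lemma δ_map (ψ : M ⟶ M') (g : Gen A M) :
    (raw M').δ (map ψ g) = Finsupp.mapDomain (map ψ) ((raw M).δ g) := by
  obtain ⟨i, r, a, t, y⟩ := g
  change ∑ k, Finsupp.single (map ψ (t k)) (a k)
    = Finsupp.mapDomain (map ψ) (∑ k, Finsupp.single (t k) (a k))
  rw [Finsupp.mapDomain_finsetSum]
  simp only [Finsupp.mapDomain_single]

lemma mapDomain_D {F F' : FreeData A} (m : F.gen → F'.gen) (x : F.gen →₀ A)
    (hδ : ∀ e, F'.δ (m e) = Finsupp.mapDomain m (F.δ e)) :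
    F'.D (Finsupp.mapDomain m x) = Finsupp.mapDomain m (F.D x) := by
  induction x using Finsupp.induction_linear with
  | zero => simp
  | add x y hx hy => simp only [Finsupp.mapDomain_add, map_add, hx, hy]
  | single e a =>
    rw [Finsupp.mapDomain_single, FreeData.D_single, FreeData.D_single, hδ,
      Finsupp.mapDomain_add, Finsupp.mapDomain_single, Finsupp.mapDomain_smul]

lemma mapDomain_mem {F F' : FreeData A} (m : F.gen → F'.gen) {i : ℤ} {x : F.gen →₀ A}
    (hx : x ∈ F.grading i) (hdeg : ∀ e, F'.deg (m e) = F.deg e) :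
    Finsupp.mapDomain m x ∈ F'.grading i := by
  induction hx using FreeData.grading_ind with
  | hz => rw [Finsupp.mapDomain_zero]; exact zero_mem _
  | ha x y _ _ hx hy => rw [Finsupp.mapDomain_add]; exact add_mem hx hy
  | hs e a ha =>
    rw [Finsupp.mapDomain_single]
    exact FreeData.single_mem (by rwa [hdeg])

lemma lin_mapDomain (ψ : M ⟶ M') (x : Gen A M →₀ A) :
    lin M' (Finsupp.mapDomain (map ψ) x) = ψ.toLinearMap (lin M x) := by
  induction x using Finsupp.induction_linear with
  | zero => simp
  | add x y hx hy => simp only [Finsupp.mapDomain_add, LinearMap.map_add, hx, hy]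
  | single e a =>
    rw [Finsupp.mapDomain_single, lin, lin, Finsupp.linearCombination_single,
      Finsupp.linearCombination_single, val_map, LinearMap.map_smul]

lemma WF.map {g : Gen A M} (h : WF p g) (ψ : M ⟶ M') : WF p (map ψ g) := by
  induction h with
  | mk i r a t y hi ht hy ha hD hl ih =>
    have e : ∑ k, Finsupp.single (Gen.map ψ (t k)) (a k)
        = Finsupp.mapDomain (Gen.map ψ) (∑ k, Finsupp.single (t k) (a k)) := by
      rw [Finsupp.mapDomain_finsetSum]
      simp only [Finsupp.mapDomain_single]
    refine WF.mk i r a _ _ hi ih (ψ.map_mem hy) ?_ ?_ ?_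
    · rw [e]
      exact mapDomain_mem (F' := raw M') _ ha (deg_map ψ)
    · rw [e]
      refine (mapDomain_D (F := raw M) (F' := raw M') _ _ (δ_map ψ)).trans ?_
      rw [hD, Finsupp.mapDomain_zero]
    · rw [e, lin_mapDomain, hl, ψ.map_d]

end Gen

section Resolution

variable (p : ℤ → Prop) (M : DGModule A)

/-- The data of the semi-free resolution, with generators in degrees satisfying `p`. -/
@[reducible] noncomputable def resData : FreeData A where
  gen := {g : Gen A M // Gen.WF p g}
  deg g := (Gen.raw M).deg g.1
  δ g := Finsupp.subtypeDomain _ ((Gen.raw M).δ g.1)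

variable {p M}

lemma mapDomain_resData_δ (g : (resData p M).gen) :
    Finsupp.mapDomain Subtype.val ((resData p M).δ g) = (Gen.raw M).δ g.1 := by
  classical
  have := Finsupp.extendDomain_subtypeDomain (P := Gen.WF p) ((Gen.raw M).δ g.1)
    fun g' hg' => g.2.of_δ_ne_zero (Finsupp.mem_support_iff.1 hg')
  rw [Finsupp.extendDomain_eq_embDomain_subtype, Finsupp.embDomain_eq_mapDomain] at this
  exact this

lemma mapDomain_resData_D (x : (resData p M).gen →₀ A) :
    (Gen.raw M).D (Finsupp.mapDomain Subtype.val x)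
      = Finsupp.mapDomain Subtype.val ((resData p M).D x) :=
  Gen.mapDomain_D (F := resData p M) (F' := Gen.raw M) _ x
    fun e => (mapDomain_resData_δ e).symm

/-- The generators occurring in the differential of a well-formed generator are well-formed. The
identities hold in the span of all formal generators and are pulled back along an injection. -/
lemma resData_isDG : (resData p M).IsDG where
  δ_mem g e := g.2.δ_mem e.1
  D_δ g := by
    apply Finsupp.mapDomain_injective Subtype.val_injective
    rw [← mapDomain_resData_D, mapDomain_resData_δ, g.2.D_δ, Finsupp.mapDomain_zero]

lemma linearCombination_resData (x : (resData p M).gen →₀ A) :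
    Finsupp.linearCombination A (fun g : (resData p M).gen => g.1.val) x
      = Gen.lin M (Finsupp.mapDomain Subtype.val x) := by
  rw [Gen.lin, Finsupp.linearCombination_mapDomain]; rfl

variable (p M)

/-- The semi-free resolution with generators in degrees satisfying `p`. -/
noncomputable abbrev resolution : DGModule A := free (resData p M) resData_isDG

/-- The augmentation of the semi-free resolution. -/
noncomputable def aug : resolution p M ⟶ M :=
  freeDesc resData_isDG (fun g => g.1.val) (fun g => g.2.val_mem) fun g => by
    rw [linearCombination_resData, mapDomain_resData_δ, g.2.lin_δ]

lemma kFlat_resolution : (resolution p M).KFlat :=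
  kFlat_free _ (fun g => g.1.lev) fun e e' h => Gen.lev_lt (g := e.1) (g' := e'.1) h

variable {p M}

/-- The supply of generators is saturated: every cocycle `y` of `M` in an allowed degree is the
image of a generator with zero differential, and a cocycle `x` of the resolution with image `d w` is
the differential of a generator with image `w`, if the degree of `w` is allowed. The hypothesis
covers the excluded degrees: there `M` is exact, and all generators lie strictly below. -/
lemma isQI_aug (hp : ∀ i, ¬ p i → M.ExactAt i ∧ ∀ j, p j → j < i) : IsQI (aug p M) := by
  rw [← quasiIso_iff]
  refine fun i => ⟨(cohomologyMap_injective_iff _ i).2 ?_, (cohomologyMap_surjective_iff _ i).2 ?_⟩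
  · rintro x hx hdx ⟨w, hw⟩
    obtain ⟨w, hw', hw⟩ := M.exists_homogeneous_primitive ((aug p M).map_mem hx) hw
    obtain ⟨x, rfl⟩ := (freeMk resData_isDG).surjective x
    replace hx := (freeMk_mem _).1 hx
    by_cases hpi : p (i - 1)
    · replace hdx : (resData p M).D x = 0 := by
        rw [d_freeMk] at hdx
        exact (freeMk resData_isDG).injective (hdx.trans (map_zero (freeMk resData_isDG)).symm)
      obtain ⟨r, t, a, -, ht, hsum⟩ := exists_fin_sum (Finsupp.mapDomain Subtype.val x)
      have htw : ∀ k, Gen.WF p (t k) := by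
        classical
        intro k
        obtain ⟨g, _, hg⟩ := Finset.mem_image.1 (Finsupp.mapDomain_support (ht k))
        rw [← hg]; exact g.2
      -- The formal generator with differential `x` and image `w`; its degree is `i - 1`, which is
      -- why `p (i - 1)` is the case distinction.
      let g : (resData p M).gen := ⟨.mk (i - 1) r a t w, .mk _ _ _ _ _ hpi htw hw'
        (by
          rw [hsum, sub_add_cancel]
          exact Gen.mapDomain_mem (F := resData p M) (F' := Gen.raw M) _ hx fun _ => rfl)
        (by
          rw [hsum]
          exact (mapDomain_resData_D x).trans (by rw [hdx, Finsupp.mapDomain_zero]))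
        (by rw [hsum, ← linearCombination_resData, hw]; rfl)⟩
      refine ⟨fgen resData_isDG g, ?_⟩
      refine (d_fgen resData_isDG g).trans (congrArg _ ?_)
      apply Finsupp.mapDomain_injective Subtype.val_injective
      rw [mapDomain_resData_δ]
      exact hsum
    -- All generators have degree below `i - 1` and `A` has no positive degrees, so the resolution
    -- vanishes in degree `i`.
    · have : x = 0 := by
        ext e
        have h1 := hx e
        have h2 := (hp _ hpi).2 _ e.2.deg
        rw [A.nonpos (by linarith), AddSubgroup.mem_bot] at h1
        exact h1
      exact ⟨0, by rw [this, map_zero]; exact (map_zero (freeMk resData_isDG)).symm⟩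
  · intro y hy hdy
    by_cases hpi : p i
    · let g : (resData p M).gen := ⟨.mk i 0 Fin.elim0 Fin.elim0 y, .mk _ _ _ _ _ hpi
        (fun k => k.elim0) hy (by simp) (by simp) (by simp [hdy])⟩
      refine ⟨fgen resData_isDG g, fgen_mem resData_isDG g, ?_, 0, ?_⟩
      · refine (d_fgen resData_isDG g).trans ?_
        refine Eq.trans (congrArg _ ?_) (map_zero (freeMk resData_isDG))
        refine (Finsupp.mapDomain_injective Subtype.val_injective ?_)
        rw [mapDomain_resData_δ, Finsupp.mapDomain_zero]
        exact Fintype.sum_empty fun k : Fin 0 =>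
          Finsupp.single (Fin.elim0 k : Gen A M) (Fin.elim0 k : A)
      · rw [map_zero, add_zero]
        exact (freeDesc_fgen resData_isDG (N := M) (fun g => g.1.val) _ _ g).symm
    · obtain ⟨w, rfl⟩ := (hp _ hpi).1 y hy hdy
      exact ⟨0, zero_mem _, map_zero _, w, by simp⟩

lemma resolution_grading_eq_bot {n : ℤ} (hp : ∀ j, p j → j ≤ n) {i : ℤ} (hi : n < i) :
    (resolution p M).grading i = ⊥ := by
  rw [eq_bot_iff]
  intro x hx
  obtain ⟨x, rfl⟩ := (freeMk resData_isDG).surjective x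
  replace hx := (freeMk_mem _).1 hx
  have : x = 0 := by
    ext e
    have h1 := hx e
    have h2 := hp _ e.2.deg
    rw [A.nonpos (by linarith), AddSubgroup.mem_bot] at h1
    exact h1
  rw [AddSubgroup.mem_bot, this]
  exact map_zero (freeMk resData_isDG)

variable {M' M'' : DGModule A}

/-- The map of generators of semi-free resolutions induced by a homomorphism. -/
def resDataMap (ψ : M ⟶ M') (g : (resData p M).gen) : (resData p M').gen :=
  ⟨Gen.map ψ g.1, g.2.map ψ⟩

lemma resDataMap_δ (ψ : M ⟶ M') (g : (resData p M).gen) :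
    (resData p M').δ (resDataMap ψ g) = Finsupp.mapDomain (resDataMap ψ) ((resData p M).δ g) := by
  apply Finsupp.mapDomain_injective Subtype.val_injective
  rw [mapDomain_resData_δ, ← Finsupp.mapDomain_comp]
  refine (Gen.δ_map ψ g.1).trans ?_
  rw [← mapDomain_resData_δ, ← Finsupp.mapDomain_comp]
  rfl

/-- Functoriality of the semi-free resolution. -/
noncomputable def resolutionMap (ψ : M ⟶ M') : resolution p M ⟶ resolution p M' :=
  freeMap resData_isDG resData_isDG (resDataMap ψ) (fun g => Gen.deg_map ψ g.1) (resDataMap_δ ψ)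

lemma resolutionMap_fgen (ψ : M ⟶ M') (g : (resData p M).gen) :
    (resolutionMap ψ).toLinearMap (fgen resData_isDG g) = fgen resData_isDG (resDataMap ψ g) :=
  freeMap_fgen _ _ _ _ _ g

lemma aug_fgen (g : (resData p M).gen) :
    (aug p M).toLinearMap (fgen resData_isDG g) = g.1.val :=
  freeDesc_fgen _ _ _ _ g

lemma resolutionMap_aug (ψ : M ⟶ M') : resolutionMap ψ ≫ aug p M' = aug p M ≫ ψ :=
  free_hom_ext resData_isDG fun g => by
    rw [comp_toLinearMap, comp_toLinearMap, resolutionMap_fgen, aug_fgen, aug_fgen]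
    exact Gen.val_map ψ g.1

end Resolution

variable (A) in
/-- The functorial semi-free resolution. -/
noncomputable def resFunctor : DGModule A ⥤ DGModule A where
  obj M := resolution (fun _ => True) M
  map ψ := resolutionMap ψ
  map_id M := free_hom_ext resData_isDG fun g => by
    rw [resolutionMap_fgen, id_toLinearMap]
    congr 1
    exact Subtype.ext (Gen.map_id _)
  map_comp φ ψ := free_hom_ext resData_isDG fun g => by
    rw [resolutionMap_fgen, comp_toLinearMap, resolutionMap_fgen, resolutionMap_fgen]
    congr 1
    exact Subtype.ext (Gen.map_comp _ _ _)

/-- The augmentation of the functorial semi-free resolution. -/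
noncomputable def resAug (M : DGModule A) : (resFunctor A).obj M ⟶ M := aug _ M

lemma isQI_resAug (M : DGModule A) : IsQI (resAug M) := isQI_aug fun _ h => absurd trivial h

lemma kFlat_resFunctor (M : DGModule A) : ((resFunctor A).obj M).KFlat := kFlat_resolution _ M

lemma resAug_natural {M M' : DGModule A} (ψ : M ⟶ M') :
    (resFunctor A).map ψ ≫ resAug M' = resAug M ≫ ψ :=
  resolutionMap_aug ψ

lemma isQI_resFunctor_map {M M' : DGModule A} {ψ : M ⟶ M'} (hψ : IsQI ψ) :
    IsQI ((resFunctor A).map ψ) :=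
  IsQI.of_comp_right (isQI_resAug M') (resAug_natural ψ ▸ (isQI_resAug M).comp hψ)

/-- Tensoring preserves quasi-isomorphisms between K-flat DG modules. -/
lemma isQI_tensorMap_of_kFlat {f : CommDGRing.Hom A B} (M : DGModule B) {P P' : DGModule A}
    (hP : P.KFlat) (hP' : P'.KFlat) {ψ : P ⟶ P'} (hψ : IsQI ψ) :
    IsQI (tensorMap f (𝟙 M) ψ) := by
  have key : ∀ M : DGModule A, IsQI (tensorMap (CommDGRing.Hom.id A) (𝟙 M) ψ) := by
    intro M
    -- Replacing `M` by its K-flat resolution changes both tensor products only up to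
    -- quasi-isomorphism, because `P` and `P'` are K-flat; for a K-flat first factor every `ψ` is
    -- preserved.
    refine IsQI.of_comp_left (hP.isQI_tensorMap_left (isQI_resAug M)) ?_
    rw [← tensorMap_comp, Category.id_comp, Category.comp_id]
    have : tensorMap (CommDGRing.Hom.id A) (resAug M) ψ
        = tensorMap _ (𝟙 _) ψ ≫ tensorMap _ (resAug M) (𝟙 _) := by
      rw [← tensorMap_comp, Category.id_comp, Category.comp_id]
    rw [this]
    exact ((kFlat_resFunctor M).isQI_tensorMap_right hψ).comp
      (hP'.isQI_tensorMap_left (isQI_resAug M))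
  rw [← isQI_res_tensorMap_iff]
  exact key (res f M)

end DGModule
end DG

/-! ### The derived tensor product, and the derived Picard group as a group of units. -/

namespace DG
open CategoryTheory
open scoped TensorProduct

namespace DGModule

variable {A B C : CommDGRing.{u}}

/-- Isomorphism in the derived category. -/
def DEq (M N : DGModule A) : Prop := Nonempty (M.toDerived ≅ N.toDerived)

namespace DEq

lemma refl (M : DGModule A) : DEq M M := ⟨Iso.refl _⟩

variable {M N P : DGModule A}

lemma symm (h : DEq M N) : DEq N M := h.map Iso.symm

lemma trans (h : DEq M N) (h' : DEq N P) : DEq M P := h.elim fun e => h'.map fun e' => e ≪≫ e'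

lemma of_isQI {φ : M ⟶ N} (h : IsQI φ) : DEq M N := by
  have : IsIso ((quasiIso A).Q.map φ) := (quasiIso A).Q_inverts φ ((quasiIso_iff φ).2 h)
  exact ⟨asIso ((quasiIso A).Q.map φ)⟩

lemma of_bijective {φ : M ⟶ N} (h : Function.Bijective φ.toLinearMap) : DEq M N :=
  of_isQI (IsQI.of_bijective h)

/-- Such a functor descends to the localizations, so it carries arbitrary isomorphisms of `D(A)`,
not only quasi-isomorphisms, to isomorphisms of `D(B)`. -/
lemma map (h : DEq M N) (F : DGModule A ⥤ DGModule B)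
    (hF : ∀ ⦃M N : DGModule A⦄ (φ : M ⟶ N), IsQI φ → IsQI (F.map φ)) :
    DEq (F.obj M) (F.obj N) := by
  have hF' : (quasiIso A).IsInvertedBy (F ⋙ (quasiIso B).Q) := fun M N φ hφ =>
    (quasiIso B).Q_inverts _ ((quasiIso_iff _).2 (hF φ ((quasiIso_iff φ).1 hφ)))
  obtain ⟨e⟩ := h
  exact ⟨(Localization.Construction.lift _ hF').mapIso e⟩

end DEq

section LTensor

variable (f : CommDGRing.Hom A B)

/-- The derived tensor product, computed with the functorial resolution of the second factor. -/
noncomputable def ltensor (M : DGModule B) (N : DGModule A) : DGModule B :=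
  tensor f M ((resFunctor A).obj N)

variable {f}

lemma ltensor_congr {M M' : DGModule B} {N N' : DGModule A} (hM : DEq M M') (hN : DEq N N') :
    DEq (ltensor f M N) (ltensor f M' N') :=
  (hM.map (tensorLeftFunctor f ((resFunctor A).obj N))
    fun _ _ _ hφ => (kFlat_resFunctor N).isQI_tensorMap_left hφ).trans
  (hN.map (resFunctor A ⋙ tensorRightFunctor f M') fun _ _ _ hφ =>
    isQI_tensorMap_of_kFlat _ (kFlat_resFunctor _) (kFlat_resFunctor _) (isQI_resFunctor_map hφ))

lemma ltensor_of_kFlat (M : DGModule B) {N : DGModule A} (hN : N.KFlat) :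
    DEq (ltensor f M N) (tensor f M N) :=
  DEq.of_isQI (isQI_tensorMap_of_kFlat M (kFlat_resFunctor N) hN (isQI_resAug N))

lemma tensor_congr {M M' : DGModule B} {N N' : DGModule A} (hM : DEq M M') (hN : DEq N N')
    (h : N.KFlat) (h' : N'.KFlat) : DEq (tensor f M N) (tensor f M' N') :=
  (ltensor_of_kFlat M h).symm.trans ((ltensor_congr hM hN).trans (ltensor_of_kFlat M' h'))

lemma deq_resFunctor (M : DGModule A) : DEq ((resFunctor A).obj M) M :=
  DEq.of_isQI (isQI_resAug M)

/-- The derived tensor product does not depend on the K-flat resolution, so the existential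
definition can be traded for the fixed functorial resolution. -/
lemma isDerivedTensor_iff (M : DGModule B) (N : DGModule A) (T : DGModule B) :
    IsDerivedTensor f M N T ↔ DEq (ltensor f M N) T := by
  constructor
  · rintro ⟨N', s, hN', hs, h⟩
    refine DEq.trans ?_ h
    exact tensor_congr (DEq.refl M)
      ((deq_resFunctor N).trans (DEq.of_isQI ((quasiIso_iff s).1 hs)).symm)
      (kFlat_resFunctor N) hN'
  · intro h
    exact ⟨_, resAug N, kFlat_resFunctor N, (quasiIso_iff _).2 (isQI_resAug N), h⟩

lemma tensor_self (M : DGModule B) : DEq (tensor f M (self A)) M :=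
  (DEq.of_bijective (unitHom_bijective f M)).symm

lemma tensor_comm (M N : DGModule A) :
    DEq (tensor (CommDGRing.Hom.id A) M N) (tensor (CommDGRing.Hom.id A) N M) :=
  DEq.of_bijective (swapHom_bijective M N)

lemma tensor_assoc (f : CommDGRing.Hom A B) (g : CommDGRing.Hom B C) (h : CommDGRing.Hom A C)
    (hh : ∀ a, h.toRingHom a = g.toRingHom (f.toRingHom a))
    (X : DGModule C) (M : DGModule B) (N : DGModule A) :
    DEq (tensor h (tensor g X M) N) (tensor g X (tensor f M N)) :=
  DEq.of_bijective (assocHom_bijective f g h X M N hh)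

lemma tensor_baseChange (f : CommDGRing.Hom A B) (M : DGModule B) {N : DGModule A}
    (hN : N.KFlat) :
    DEq (tensor (CommDGRing.Hom.id B) M (tensor f (self B) N)) (tensor f M N) :=
  (tensor_assoc f (CommDGRing.Hom.id B) f (fun _ => rfl) M (self B) N).symm.trans
    (tensor_congr (tensor_self M) (DEq.refl N) hN hN)

lemma ltensor_comm (M N : DGModule A) :
    DEq (ltensor (CommDGRing.Hom.id A) M N) (ltensor (CommDGRing.Hom.id A) N M) :=
  (ltensor_congr (deq_resFunctor M).symm (DEq.refl N)).trans
    ((tensor_comm _ _).trans (ltensor_congr (deq_resFunctor N) (DEq.refl M)))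

lemma ltensor_assoc (M N P : DGModule A) :
    DEq (ltensor (CommDGRing.Hom.id A) (ltensor (CommDGRing.Hom.id A) M N) P)
      (ltensor (CommDGRing.Hom.id A) M (ltensor (CommDGRing.Hom.id A) N P)) := by
  refine (tensor_assoc _ (CommDGRing.Hom.id A) _ (fun _ => rfl) M _ _).trans ?_
  refine (ltensor_of_kFlat M (kFlat_tensor (kFlat_resFunctor N) (kFlat_resFunctor P))).symm.trans ?_
  exact ltensor_congr (DEq.refl M) (ltensor_congr (deq_resFunctor N) (DEq.refl P))

lemma ltensor_self (M : DGModule B) : DEq (ltensor f M (self A)) M :=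
  (ltensor_of_kFlat M kFlat_self).trans (tensor_self M)

/-- With K-flat representatives both sides reduce to `(B ⊗_A M) ⊗_A N` by associativity. This is the
multiplicativity of derived base change. -/
lemma ltensor_baseChange (f : CommDGRing.Hom A B) (M N : DGModule A) :
    DEq (ltensor f (self B) (ltensor (CommDGRing.Hom.id A) M N))
      (ltensor (CommDGRing.Hom.id B) (ltensor f (self B) M) (ltensor f (self B) N)) := by
  have hM := kFlat_resFunctor M
  have hN := kFlat_resFunctor N
  refine (ltensor_congr (DEq.refl _) (ltensor_congr (deq_resFunctor M).symm (DEq.refl N))).trans ?_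
  refine (ltensor_of_kFlat _ (kFlat_tensor hM hN)).trans ?_
  refine (tensor_assoc (CommDGRing.Hom.id A) f f (fun _ => rfl) (self B) _ _).symm.trans ?_
  exact (tensor_baseChange f _ hN).symm.trans
    (ltensor_of_kFlat _ (kFlat_tensor kFlat_self hN)).symm

end LTensor

variable (A) in
/-- Isomorphism in the derived category as an equivalence relation. -/
def deqSetoid : Setoid (DGModule A) where
  r := DEq
  iseqv := ⟨DEq.refl, DEq.symm, DEq.trans⟩

end DGModule

open DGModule

/-- The monoid of isomorphism classes in the derived category. -/
def DMon (A : CommDGRing.{u}) : Type (u + 1) := Quotient (deqSetoid A)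

namespace DMon

variable {A B : CommDGRing.{u}}

/-- The class of a DG module. -/
def mk (M : DGModule A) : DMon A := Quotient.mk (deqSetoid A) M

lemma mk_eq {M N : DGModule A} : mk M = mk N ↔ DEq M N :=
  ⟨fun h => Quotient.exact (s := deqSetoid A) h, fun h => Quotient.sound (s := deqSetoid A) h⟩

lemma mk_surjective : Function.Surjective (mk (A := A)) := Quotient.mk_surjective

noncomputable instance : Mul (DMon A) :=
  ⟨Quotient.map₂ (ltensor (CommDGRing.Hom.id A)) fun _ _ h _ _ h' => ltensor_congr h h'⟩

noncomputable instance : One (DMon A) := ⟨mk (self A)⟩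

lemma mk_mul (M N : DGModule A) : mk M * mk N = mk (ltensor (CommDGRing.Hom.id A) M N) := rfl

lemma one_def : (1 : DMon A) = mk (self A) := rfl

noncomputable instance : CommMonoid (DMon A) where
  mul_assoc x y z := by
    obtain ⟨x, rfl⟩ := mk_surjective x
    obtain ⟨y, rfl⟩ := mk_surjective y
    obtain ⟨z, rfl⟩ := mk_surjective z
    exact mk_eq.2 (ltensor_assoc x y z)
  mul_comm x y := by
    obtain ⟨x, rfl⟩ := mk_surjective x
    obtain ⟨y, rfl⟩ := mk_surjective y
    exact mk_eq.2 (ltensor_comm x y)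
  mul_one x := by
    obtain ⟨x, rfl⟩ := mk_surjective x
    exact mk_eq.2 (ltensor_self x)
  one_mul x := by
    obtain ⟨x, rfl⟩ := mk_surjective x
    exact mk_eq.2 ((ltensor_comm _ _).trans (ltensor_self x))

lemma mk_tensor (M : DGModule A) {N : DGModule A} (hN : N.KFlat) :
    mk (tensor (CommDGRing.Hom.id A) M N) = mk M * mk N :=
  mk_eq.2 (ltensor_of_kFlat M hN).symm

/-- Derived base change. -/
noncomputable def baseChange (f : CommDGRing.Hom A B) : DMon A →* DMon B where
  toFun := Quotient.map (ltensor f (self B)) fun _ _ h => ltensor_congr (DEq.refl _) h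
  map_one' := mk_eq.2 (ltensor_self (self B))
  map_mul' x y := by
    obtain ⟨x, rfl⟩ := mk_surjective x
    obtain ⟨y, rfl⟩ := mk_surjective y
    exact mk_eq.2 (ltensor_baseChange f x y)

lemma baseChange_mk_of_kFlat (f : CommDGRing.Hom A B) {M : DGModule A} (hM : M.KFlat) :
    baseChange f (mk M) = mk (tensor f (self B) M) :=
  mk_eq.2 (ltensor_of_kFlat _ hM)

/-- The monoid is commutative, so the one-sided inverse in the definition of tilting is an inverse.
-/
lemma isTilting_iff (P : DGModule A) : P.IsTilting ↔ IsUnit (mk P) := by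
  rw [isUnit_iff_exists_inv]
  constructor
  · rintro ⟨Q, hQ⟩
    exact ⟨mk Q, mk_eq.2 ((isDerivedTensor_iff _ _ _).1 hQ)⟩
  · rintro ⟨q, hq⟩
    obtain ⟨Q, rfl⟩ := mk_surjective q
    exact ⟨Q, (isDerivedTensor_iff _ _ _).2 (mk_eq.1 hq)⟩

end DMon

namespace DPic

variable {A B : CommDGRing.{u}}

/-- The class of a tilting DG module as a unit of the monoid of isomorphism classes. -/
noncomputable def toUnits (x : DPic A) : (DMon A)ˣ :=
  Quotient.lift (s := tiltingSetoid A)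
    (fun P => ((DMon.isTilting_iff P.1).1 P.2).unit)
    (fun _ _ h => Units.ext (DMon.mk_eq.2 h)) x

lemma val_toUnits_mk (P : DGModule A) (hP : P.IsTilting) :
    ((mk P hP).toUnits : DMon A) = DMon.mk P := rfl

lemma toUnits_bijective : Function.Bijective (toUnits (A := A)) := by
  constructor
  · intro x y h
    obtain ⟨⟨P, hP⟩, rfl⟩ := Quotient.mk_surjective (s := tiltingSetoid A) x
    obtain ⟨⟨Q, hQ⟩, rfl⟩ := Quotient.mk_surjective (s := tiltingSetoid A) y
    exact Quotient.sound (s := tiltingSetoid A) (DMon.mk_eq.1 (congrArg Units.val h))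
  · intro x
    obtain ⟨P, hP⟩ := DMon.mk_surjective (x : DMon A)
    have h : P.IsTilting := (DMon.isTilting_iff P).2 (hP ▸ x.isUnit)
    exact ⟨mk P h, Units.ext ((val_toUnits_mk P h).trans hP)⟩

variable (A) in
/-- The derived Picard group is the group of units of the monoid of isomorphism classes. -/
noncomputable def equivUnits : DPic A ≃ (DMon A)ˣ := Equiv.ofBijective toUnits toUnits_bijective

variable (A) in
/-- The group structure of the derived Picard group. -/
@[reducible]
noncomputable def commGroup : CommGroup (DPic A) := (equivUnits A).commGroup

variable (A) in
/-- The derived Picard group is isomorphic to the group of units of the monoid of isomorphism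
classes. -/
noncomputable def mulEquivUnits : letI := commGroup A; DPic A ≃* (DMon A)ˣ :=
  letI := commGroup A
  (equivUnits A).mulEquiv

lemma isDPicGroup (A : CommDGRing.{u}) : IsDPicGroup A (commGroup A) := by
  let := commGroup A
  refine ⟨fun P Q R hP hQ hR => ?_, fun P hP => ?_⟩
  · rw [isDerivedTensor_iff, ← DMon.mk_eq, ← DMon.mk_mul, ← (mulEquivUnits A).injective.eq_iff,
      map_mul, Units.ext_iff, Units.val_mul]
    rfl
  · rw [← (mulEquivUnits A).injective.eq_iff, map_one, Units.ext_iff, eq_comm]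
    exact DMon.mk_eq

/-- Derived base change induces an isomorphism of derived Picard groups as soon as it is bijective
on units. -/
lemma exists_mulEquiv (f : CommDGRing.Hom A B)
    (h : Function.Bijective (Units.map (DMon.baseChange f))) :
    ∃ (gA : CommGroup (DPic A)) (gB : CommGroup (DPic B)),
      IsDPicGroup A gA ∧ IsDPicGroup B gB ∧
      ∃ φ : DPic A ≃* DPic B,
        ∀ (P : DGModule A) (hP : P.IsTilting) (R : DGModule B) (hR : R.IsTilting),
          φ (DPic.mk P hP) = DPic.mk R hR ↔ IsDerivedTensor f (self B) P R := by
  let := commGroup A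
  let := commGroup B
  refine ⟨commGroup A, commGroup B, isDPicGroup A, isDPicGroup B,
    ((mulEquivUnits A).trans (MulEquiv.ofBijective _ h)).trans (mulEquivUnits B).symm,
    fun P hP R hR => ?_⟩
  rw [isDerivedTensor_iff, ← DMon.mk_eq, MulEquiv.trans_apply, MulEquiv.symm_apply_eq,
    Units.ext_iff]
  rfl

end DPic
end DG

/-! ### Cohomology, with degrees and multiplication by cocycles, as an invariant of `D(A)`. -/

namespace DG
open CategoryTheory
open scoped TensorProduct

namespace DGModule

variable {A B : CommDGRing.{u}}

/-- The total cohomology. -/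
abbrev Htot (M : DGModule A) : Type u := M.d.ker ⧸ M.d.range.addSubgroupOf M.d.ker

/-- The cohomology class of a cocycle. -/
def cls (M : DGModule A) : M.d.ker →+ Htot M := QuotientAddGroup.mk' _

lemma cls_surjective (M : DGModule A) : Function.Surjective M.cls :=
  QuotientAddGroup.mk'_surjective _

lemma cls_eq_zero {M : DGModule A} {x : M.d.ker} : M.cls x = 0 ↔ ∃ w, M.d w = x := by
  rw [cls, QuotientAddGroup.mk'_apply, QuotientAddGroup.eq_zero_iff]
  rfl

lemma cls_eq {M : DGModule A} {x y : M.d.ker} : M.cls x = M.cls y ↔ ∃ w, M.d w = x - y := by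
  rw [← sub_eq_zero, ← map_sub, cls_eq_zero]
  rfl

/-- The map on total cohomology induced by an additive map compatible with differentials. -/
def htotMap {M N : DGModule A} (φ : M →+ N) (h : ∀ x, M.d x = 0 → N.d (φ x) = 0)
    (h' : ∀ w, ∃ v, N.d v = φ (M.d w)) : Htot M →+ Htot N :=
  QuotientAddGroup.map _ _ ((φ.comp M.d.ker.subtype).codRestrict N.d.ker fun x => h x x.2) (by
    rintro ⟨x, hx⟩ ⟨w, hw⟩
    obtain ⟨v, hv⟩ := h' w
    exact ⟨v, hv.trans (congrArg φ hw)⟩)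

/-- The total cohomology functor. -/
def htotFunctor (A : CommDGRing.{u}) : DGModule A ⥤ AddCommGrpCat.{u} where
  obj M := AddCommGrpCat.of (Htot M)
  map φ := AddCommGrpCat.ofHom (htotMap φ.toLinearMap.toAddMonoidHom
    (fun x hx => by
      change _ = 0 at hx
      change DGModule.d _ (φ.toLinearMap x) = 0
      rw [← φ.map_d, hx, map_zero]) (fun w => ⟨φ.toLinearMap w, (φ.map_d w).symm⟩))
  map_id M := by
    ext x
    rfl
  map_comp φ ψ := by
    ext x
    rfl

lemma htotFunctor_isInvertedBy : (quasiIso A).IsInvertedBy (htotFunctor A) := by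
  intro M N φ hφ
  rw [quasiIso_iff] at hφ
  have hb : Function.Bijective ((htotFunctor A).map φ) := by
    constructor
    · refine (injective_iff_map_eq_zero ((htotFunctor A).map φ).hom).2 fun c hc => ?_
      obtain ⟨x, rfl⟩ := cls_surjective _ c
      obtain ⟨w, hw⟩ := cls_eq_zero.1 hc
      exact cls_eq_zero.2 (hφ.inj x x.2 ⟨w, hw⟩)
    · intro c
      obtain ⟨y, rfl⟩ := cls_surjective _ c
      obtain ⟨x, hx, w, hw⟩ := hφ.surj y y.2
      refine ⟨M.cls ⟨x, hx⟩, ?_⟩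
      exact Eq.symm (cls_eq.2 ⟨w, eq_sub_of_add_eq' hw.symm⟩)
  exact (ConcreteCategory.isIso_iff_bijective _).2 hb

/-- A family of additive endomorphisms of all DG modules that induces an endomorphism of the
total cohomology functor. -/
structure NatEndo (A : CommDGRing.{u}) where
  toFun : ∀ M : DGModule A, M →+ M
  cocycle : ∀ (M : DGModule A) (x : M), M.d x = 0 → M.d (toFun M x) = 0
  boundary : ∀ (M : DGModule A) (w : M), ∃ v, M.d v = toFun M (M.d w)
  natural : ∀ (M N : DGModule A) (φ : M ⟶ N) (x : M),
    φ.toLinearMap (toFun M x) = toFun N (φ.toLinearMap x)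

/-- The induced endomorphism of the total cohomology. -/
def NatEndo.map (θ : NatEndo A) (M : DGModule A) : Htot M →+ Htot M :=
  htotMap (θ.toFun M) (θ.cocycle M) (θ.boundary M)

/-- The induced endomorphism of the total cohomology functor on the derived category. -/
noncomputable def NatEndo.natTrans (θ : NatEndo A) :
    Localization.Construction.lift _ (htotFunctor_isInvertedBy (A := A)) ⟶
    Localization.Construction.lift _ (htotFunctor_isInvertedBy (A := A)) :=
  Localization.Construction.natTransExtension
    { app := fun M => AddCommGrpCat.ofHom (θ.map M)
      naturality := fun M N φ => by
        have h : (Localization.Construction.lift _ (htotFunctor_isInvertedBy (A := A))).map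
            ((quasiIso A).Q.map φ) = (htotFunctor A).map φ := by
          refine (Functor.congr_hom
            (Localization.Construction.fac _ (htotFunctor_isInvertedBy (A := A))) φ).trans ?_
          exact (Category.id_comp _).trans (Category.comp_id _)
        rw [Functor.comp_map, h]
        ext c
        obtain ⟨x, rfl⟩ := cls_surjective M c
        exact congrArg N.cls (Subtype.ext (θ.natural M N φ x).symm) }

/-- An isomorphism in `D(A)` need not come from a DG homomorphism. But total cohomology factors
through the localization, every `NatEndo` extends to a natural transformation of the factored
functor, and naturality at the isomorphism is the asserted compatibility. -/
lemma DEq.exists_htotEquiv {M N : DGModule A} (h : DEq M N) :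
    ∃ E : Htot M ≃+ Htot N, ∀ (θ : NatEndo A) (c : Htot M), E (θ.map M c) = θ.map N (E c) := by
  obtain ⟨e⟩ := h
  let e' := (Localization.Construction.lift _ (htotFunctor_isInvertedBy (A := A))).mapIso e
  refine ⟨e'.addCommGroupIsoToAddEquiv, fun θ c => ?_⟩
  have h := θ.natTrans.naturality e.hom
  exact (ConcreteCategory.congr_hom h c).symm

lemma d_smul (M : DGModule A) (a : A) (m : M) :
    M.d (a • m) = A.d a • m + signed A.isInternal a • M.d m := by
  induction a using graded_induction A.isInternal with
  | hz => simp
  | hm i a ha =>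
    rw [M.leibniz ha, signed_of_mem _ ha, Units.smul_def, Units.smul_def, smul_assoc]
  | ha a b ha hb => simp only [add_smul, map_add, ha, hb]; abel

lemma d_signed (a : A) : A.d (signed A.isInternal a) = - signed A.isInternal (A.d a) := by
  induction a using graded_induction A.isInternal with
  | hz => simp
  | hm i a ha =>
    rw [signed_of_mem _ ha, signed_of_mem _ (A.d_mem ha), map_unit_smul, Int.negOnePow_succ,
      Units.neg_smul, neg_neg]
  | ha a b ha hb => rw [map_add, map_add, ha, hb, map_add, map_add, neg_add]

/-- The projection to the component of degree `i`. -/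
noncomputable def compEndo (A : CommDGRing.{u}) (i : ℤ) : NatEndo A where
  toFun M := comp M.isInternal i
  cocycle M x hx := by rw [comp_d, hx, map_zero]
  boundary M w := ⟨comp M.isInternal (i - 1) w, by rw [comp_d, sub_add_cancel]⟩
  natural M N φ x := (comp_map φ i x).symm

/-- Multiplication by a cocycle. -/
noncomputable def smulEndo (a : A) (ha : A.d a = 0) : NatEndo A where
  toFun M := DistribSMul.toAddMonoidHom M a
  cocycle M x hx := by
    change M.d (a • x) = 0
    rw [d_smul, ha, hx, zero_smul, smul_zero, add_zero]
  boundary M w := ⟨signed A.isInternal a • w, by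
    change _ = a • M.d w
    rw [d_smul, d_signed, ha, signed_signed, map_zero, neg_zero, zero_smul, zero_add]⟩
  natural M N φ x := LinearMap.map_smul φ.toLinearMap a x

lemma exactAt_iff_compEndo {M : DGModule A} {i : ℤ} :
    M.ExactAt i ↔ ∀ c, (compEndo A i).map M c = 0 := by
  constructor
  · intro h c
    obtain ⟨x, rfl⟩ := cls_surjective _ c
    exact cls_eq_zero.2 (h _ (comp_mem _ _ _) ((compEndo A i).cocycle M x x.2))
  · intro h x hx hd
    obtain ⟨w, hw⟩ := cls_eq_zero.1 (h (M.cls ⟨x, hd⟩))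
    exact ⟨w, hw.trans (comp_of_mem _ hx)⟩

lemma DEq.exactAt {M N : DGModule A} (h : DEq M N) {i : ℤ} (hM : M.ExactAt i) : N.ExactAt i := by
  obtain ⟨E, hE⟩ := h.exists_htotEquiv
  rw [exactAt_iff_compEndo] at hM ⊢
  intro c
  obtain ⟨c, rfl⟩ := E.surjective c
  rw [← hE, hM, map_zero]

lemma DEq.acyclic {M N : DGModule A} (h : DEq M N) (hM : M.Acyclic) : N.Acyclic :=
  (acyclic_iff_exactAt N).2 fun i => h.exactAt ((acyclic_iff_exactAt M).1 hM i)

/-- The homomorphism `A → M` given by a cocycle of degree `0`. -/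
def fromSelf {M : DGModule A} {z : M} (hz : z ∈ M.grading 0) (hd : M.d z = 0) : self A ⟶ M where
  toLinearMap := LinearMap.toSpanSingleton A M z
  map_mem {i a} ha := by
    have := M.smul_mem (i := i) (a := a) ha hz
    rwa [add_zero] at this
  map_d a := by
    change A.d a • z = M.d ((show A from a) • z)
    rw [d_smul, hd, smul_zero, add_zero]

lemma fromSelf_ofRing {M : DGModule A} {z : M} (hz : z ∈ M.grading 0) (hd : M.d z = 0) (a : A) :
    (fromSelf hz hd).toLinearMap (ofRing A a) = a • z := rfl

/-- The identification of total cohomologies respects degrees and multiplication by cocycles. So a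
cocycle of degree `0` whose class corresponds to `1` freely generates `H(M)` over `H(A)`, and it
realizes the abstract isomorphism by a quasi-isomorphism out of `A`. -/
lemma DEq.exists_fromSelf {M : DGModule A} (h : DEq M (self A)) :
    ∃ (z : M) (hz : z ∈ M.grading 0) (hd : M.d z = 0), IsQI (fromSelf hz hd) := by
  obtain ⟨E, hE⟩ := h.exists_htotEquiv
  have h1 : (self A).d (ofRing A 1) = 0 := A.d_one
  obtain ⟨x, hx⟩ := cls_surjective _ (E.symm ((self A).cls ⟨ofRing A 1, h1⟩))
  have hx' : E (M.cls x) = (self A).cls ⟨ofRing A 1, h1⟩ := by rw [hx, E.apply_symm_apply]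
  -- Passing to the component of degree `0` is harmless: projections to components are compatible
  -- with `E`, and `1` has degree `0`.
  have hz : M.d (comp M.isInternal 0 x) = 0 := (compEndo A 0).cocycle M x x.2
  have hcz : E (M.cls ⟨_, hz⟩) = (self A).cls ⟨ofRing A 1, h1⟩ := by
    have h2 := hE (compEndo A 0) (M.cls x)
    rw [hx'] at h2
    refine h2.trans ?_
    exact congrArg (self A).cls (Subtype.ext (comp_of_mem (self A).isInternal A.one_mem))
  have hsm : ∀ a (ha : A.d a = 0) (h'), E (M.cls ⟨a • comp M.isInternal 0 (x : M), h'⟩)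
      = (self A).cls ⟨ofRing A a, ha⟩ := by
    intro a ha h'
    have h2 := hE (smulEndo a ha) (M.cls ⟨_, hz⟩)
    rw [hcz] at h2
    refine h2.trans ?_
    exact congrArg (self A).cls (Subtype.ext (mul_one a))
  have hda : ∀ a, A.d a = 0 → M.d (a • comp M.isInternal 0 (x : M)) = 0 := fun a ha =>
    (smulEndo a ha).cocycle M _ hz
  refine ⟨comp M.isInternal 0 (x : M), comp_mem _ _ _, hz, ⟨fun a ha hw => ?_, fun y hy => ?_⟩⟩
  · have h2 := hsm (unRing A a) ha (hda _ ha)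
    rw [cls_eq_zero.2 hw, map_zero] at h2
    exact cls_eq_zero.1 h2.symm
  · obtain ⟨a, ha⟩ := cls_surjective _ (E (M.cls ⟨y, hy⟩))
    refine ⟨a, a.2, ?_⟩
    have h2 := hsm (unRing A a) a.2 (hda _ a.2)
    have h3 := E.injective (ha.symm.trans h2.symm)
    obtain ⟨w, hw⟩ := cls_eq.1 h3
    exact ⟨w, by rw [hw]; exact (add_sub_cancel _ _).symm⟩

end DGModule
end DG

/-! ### Derived Nakayama along `A → Ā`. -/

namespace DG
open CategoryTheory
open scoped TensorProduct

namespace DGModule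

variable {A B : CommDGRing.{u}}

lemma exactAt_of_grading_eq_bot {M : DGModule A} {i : ℤ} (h : M.grading i = ⊥) :
    M.ExactAt i := fun x hx _ => ⟨0, by
  rw [h, AddSubgroup.mem_bot] at hx
  rw [hx, map_zero]⟩

/-- As `M` is exact above `n`, generators in degrees at most `n` suffice; as `A` is nonpositive, the
resolution they span vanishes above `n`. -/
lemma exists_bounded_resolution {M : DGModule A} {n : ℤ} (h : ∀ i, n < i → M.ExactAt i) :
    ∃ (M' : DGModule A) (s : M' ⟶ M), M'.KFlat ∧ IsQI s ∧ ∀ i, n < i → M'.grading i = ⊥ :=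
  ⟨resolution (· ≤ n) M, aug _ M, kFlat_resolution _ M,
    isQI_aug fun i hi => ⟨h i (not_le.1 hi), fun _ hj => hj.trans_lt (not_le.1 hi)⟩,
    fun _ hi => resolution_grading_eq_bot (fun _ hj => hj) hi⟩

/-- The ring underlying a commutative ring viewed as a DG ring. -/
def ringEquiv (R : Type u) [CommRing R] : R ≃+* CommDGRing.ofCommRing R := RingEquiv.refl R

lemma ofCommRing_grading_eq_bot {R : Type u} [CommRing R] {i : ℤ} (hi : i ≠ 0) :
    (CommDGRing.ofCommRing R).grading i = ⊥ := if_neg hi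

lemma ofCommRing_mem_zero {R : Type u} [CommRing R] (r : CommDGRing.ofCommRing R) :
    r ∈ (CommDGRing.ofCommRing R).grading 0 := AddSubgroup.mem_top _

lemma d_ofCommRing {R : Type u} [CommRing R] (r : CommDGRing.ofCommRing R) :
    (CommDGRing.ofCommRing R).d r = 0 := rfl

/-- The class in `Ā` of a cocycle of degree `0`. -/
def toH0 (A : CommDGRing.{u}) : A.Z0 →+* A.bar :=
  (ringEquiv A.H0).toRingHom.comp (Ideal.Quotient.mk A.B0)

lemma toH0_surjective : Function.Surjective (toH0 A) := Ideal.Quotient.mk_surjective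

section Top

variable (M : DGModule A) (k : ℤ)

/-- The elements whose component of degree `k` is a coboundary. -/
noncomputable def compBoundary : AddSubgroup M := M.d.range.comap (comp M.isInternal k)

variable {M k}

lemma mem_compBoundary {x : M} : x ∈ compBoundary M k ↔ ∃ w, M.d w = comp M.isInternal k x :=
  Iff.rfl

lemma smul_comp {j : ℤ} {a : A} (ha : a ∈ A.grading j) (x : M) :
    comp M.isInternal (k + j) (a • x) = a • comp M.isInternal k x :=
  map_comp M.isInternal M.isInternal (DistribSMul.toAddMonoidHom M a) j
    (fun i x hx => by simpa [add_comm] using M.smul_mem ha hx) k x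

lemma Z0_smul_mem_compBoundary (z : A.Z0) {x : M} (hx : x ∈ compBoundary M k) :
    (z : A) • x ∈ compBoundary M k := by
  obtain ⟨w, hw⟩ := hx
  refine ⟨(z : A) • w, ?_⟩
  have h := smul_comp (k := k) z.2.1 x
  rw [add_zero] at h
  rw [h, d_smul, z.2.2, zero_smul, zero_add, signed_of_mem _ z.2.1, hw]
  simp

/-- With nothing in degree `k + 1`, the component `x_k` is a cocycle, so `z = d b` gives `z x_k = d
(b x_k)`. This lets `Ā` act on the top cohomology. -/
lemma B0_smul_mem_compBoundary (hM : M.grading (k + 1) = ⊥) {z : A.Z0} (hz : z ∈ A.B0) (x : M) :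
    (z : A) • x ∈ compBoundary M k := by
  obtain ⟨b, hb, hbz⟩ := hz
  refine ⟨b • comp M.isInternal k x, ?_⟩
  have h := smul_comp (k := k) z.2.1 x
  rw [add_zero] at h
  have h0 : M.d (comp M.isInternal k x) = 0 := by
    have := M.d_mem (comp_mem M.isInternal k x)
    rwa [hM, AddSubgroup.mem_bot] at this
  rw [h, d_smul, h0, smul_zero, add_zero, hbz]

/-- The action of `Ā` on the top cohomology. -/
noncomputable def barAction (hM : M.grading (k + 1) = ⊥) : A.bar →+ M →+ M ⧸ compBoundary M k :=
  QuotientAddGroup.lift A.B0.toAddSubgroup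
    ((AddMonoidHom.compHom (QuotientAddGroup.mk' (compBoundary M k))).comp
      ((smulAddHom A M).comp A.Z0.subtype.toAddMonoidHom))
    (by
      intro z hz
      ext x
      exact (QuotientAddGroup.eq_zero_iff _).2 (B0_smul_mem_compBoundary hM hz x))

lemma barAction_mk (hM : M.grading (k + 1) = ⊥) (z : A.Z0) (x : M) :
    barAction hM (toH0 A z) x
      = QuotientAddGroup.mk' (compBoundary M k) ((z : A) • x) := rfl

lemma toBar_of_mem_zero {a : A} (ha : a ∈ A.grading 0) (hd : A.d a = 0) :
    A.toBar.toRingHom a = toH0 A ⟨a, ha, hd⟩ :=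
  congrArg (Ideal.Quotient.mk A.B0) (Subtype.ext (A.proj0_of_mem_zero ha))

lemma toBar_of_mem_ne {i : ℤ} (hi : i ≠ 0) {a : A} (ha : a ∈ A.grading i) :
    A.toBar.toRingHom a = 0 := by
  exact (AddSubgroup.mem_bot).1 (ofCommRing_grading_eq_bot (R := A.H0) hi ▸ A.toBar.map_mem ha)

lemma _root_.DG.CommDGRing.d_eq_zero_of_mem_zero {a : A} (ha : a ∈ A.grading 0) : A.d a = 0 := by
  have h1 := A.d_mem ha
  rwa [zero_add, A.nonpos one_pos, AddSubgroup.mem_bot] at h1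

/-- The action on the top cohomology as a map out of `Ā ⊗ M`. -/
noncomputable def barTensorLift (hM : ∀ i, k < i → M.grading i = ⊥) :
    tensor A.toBar (self A.bar) M →+ M ⧸ compBoundary M k :=
  tlift ((barAction (hM (k + 1) (lt_add_one k))).comp (unRing A.bar)) (by
    intro i j l a b m ha hb hm
    obtain ⟨b, rfl⟩ := ofRing_surjective b
    rw [ofRing_mem] at hb
    obtain ⟨z, rfl⟩ := toH0_surjective b
    have h0 := hM (k + 1) (lt_add_one k)
    change barAction h0 (A.toBar.toRingHom a * toH0 A z) m
      = _ • barAction h0 (toH0 A z) (a • m)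
    rw [barAction_mk]
    by_cases hi : i = 0
    · subst hi
      rw [toBar_of_mem_zero ha (CommDGRing.d_eq_zero_of_mem_zero ha), ← map_mul, mul_comm, barAction_mk, zero_mul, Int.negOnePow_zero, one_smul, smul_smul]
      rfl
    · rw [toBar_of_mem_ne hi ha, zero_mul, map_zero, AddMonoidHom.zero_apply]
      -- Here `a` maps to `0` in `Ā`, so the other side has to vanish too. A component in degree `k`
      -- would require `i + l = k`; then `i < 0` forces `l > k` and `m = 0`, while `i > 0` forces `a
      -- = 0`.
      have h2 : (z : A) • a • m ∈ compBoundary M k := by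
        have hmem : (z : A) • a • m ∈ M.grading (i + l) := by
          simpa using M.smul_mem z.2.1 (M.smul_mem ha hm)
        by_cases hl : i + l = k
        · rcases lt_or_gt_of_ne hi with hi | hi
          · rw [hM l (by omega), AddSubgroup.mem_bot] at hm
            rw [hm, smul_zero, smul_zero]; exact zero_mem _
          · rw [A.nonpos hi, AddSubgroup.mem_bot] at ha
            rw [ha, zero_smul, smul_zero]; exact zero_mem _
        · exact mem_compBoundary.2 ⟨0, by rw [map_zero, comp_of_mem_ne _ hmem hl]⟩
      rw [show QuotientAddGroup.mk' (compBoundary M k) ((z : A) • a • m) = 0 from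
        (QuotientAddGroup.eq_zero_iff _).2 h2, smul_zero])

lemma barTensorLift_tm (hM : ∀ i, k < i → M.grading i = ⊥) (z : A.Z0) (m : M) :
    barTensorLift hM (tm A.toBar (self A.bar) M (ofRing A.bar (toH0 A z)) m)
      = QuotientAddGroup.mk' (compBoundary M k) ((z : A) • m) := by
  rw [barTensorLift, tlift_tm]; rfl

lemma barTensorLift_d (hM : ∀ i, k < i → M.grading i = ⊥) (w : tensor A.toBar (self A.bar) M) :
    barTensorLift hM ((tensor A.toBar (self A.bar) M).d w) = 0 := by
  induction w using tensor_ind with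
  | hz => simp
  | ha x y hx hy => rw [map_add, map_add, hx, hy, add_zero]
  | ht i j b m hb hm =>
    obtain ⟨b, rfl⟩ := ofRing_surjective b
    obtain ⟨z, rfl⟩ := toH0_surjective b
    rw [d_tm hb, d_ofRing, d_ofCommRing, map_zero, map_zero, AddMonoidHom.zero_apply, zero_add, map_unit_smul, barTensorLift_tm]
    have h2 : (z : A) • M.d m ∈ compBoundary M k :=
      Z0_smul_mem_compBoundary z (mem_compBoundary.2 ⟨comp M.isInternal (k - 1) m, by
        rw [comp_d, sub_add_cancel]⟩)
    rw [show QuotientAddGroup.mk' (compBoundary M k) ((z : A) • M.d m) = 0 from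
      (QuotientAddGroup.eq_zero_iff _).2 h2, smul_zero]

/-- Derived Nakayama in the top degree. -/
lemma exactAt_of_tensor_toBar (hM : ∀ i, k < i → M.grading i = ⊥)
    (h : (tensor A.toBar (self A.bar) M).ExactAt k) : M.ExactAt k := by
  intro m hm hd
  have h1 : ofRing A.bar 1 ∈ (self A.bar).grading 0 := A.bar.one_mem
  obtain ⟨w, hw⟩ := h (tm A.toBar (self A.bar) M (ofRing A.bar 1) m)
    (tm_mem (zero_add k) h1 hm) (by
      rw [d_tm h1, hd, map_zero, smul_zero, add_zero, d_ofRing, A.bar.d_one, map_zero, map_zero,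
        AddMonoidHom.zero_apply])
  -- The lift kills the coboundary `1 ⊗ m` and sends it to the class of `m` in the top cohomology,
  -- so that class is zero.
  have h2 := barTensorLift_d hM w
  rw [hw] at h2
  have h3 := (barTensorLift_tm hM 1 m).symm.trans h2
  rw [show ((1 : A.Z0) : A) • m = m from one_smul _ _] at h3
  obtain ⟨v, hv⟩ := mem_compBoundary.1 ((QuotientAddGroup.eq_zero_iff _).1 h3)
  exact ⟨v, hv.trans (comp_of_mem _ hm)⟩

end Top

lemma exactAt_of_ltensor_toBar {M : DGModule A} {k : ℤ} (hM : ∀ i, k < i → M.ExactAt i)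
    (h : (ltensor A.toBar (self A.bar) M).ExactAt k) : M.ExactAt k := by
  obtain ⟨M', s, hM', hs, hb⟩ := exists_bounded_resolution hM
  refine (DEq.of_isQI hs).exactAt (exactAt_of_tensor_toBar hb ?_)
  exact (((ltensor_congr (DEq.refl _) (DEq.of_isQI hs).symm).trans
    (ltensor_of_kFlat _ hM')).exactAt h)

/-- A DG module with bounded above cohomology has no cohomology above degree `n` if its derived
base change to `Ā` has none. -/
lemma exactAbove_of_ltensor_toBar {M : DGModule A} {N n : ℤ} (hN : ∀ i, N < i → M.ExactAt i)
    (h : ∀ i, n < i → (ltensor A.toBar (self A.bar) M).ExactAt i) :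
    ∀ i, n < i → M.ExactAt i := by
  have key : ∀ m : ℕ, ∀ i, N - m < i → n < i → M.ExactAt i := by
    intro m
    induction m with
    | zero => intro i hi _; exact hN i (by simpa using hi)
    | succ m ih =>
      intro i hi hi'
      push_cast at hi
      exact exactAt_of_ltensor_toBar (fun j hj => ih j (by omega) (by omega)) (h i hi')
  intro i hi
  exact key (N - i + 1).toNat i (by omega) hi

/-- `Ā` sits in degree `0` and its elements lift to cocycles of `A`, which can be moved to the right
factor. -/
lemma exists_tm_of_mem_zero {M : DGModule A}
    {x : tensor A.toBar (self A.bar) M} (hx : x ∈ (tensor A.toBar (self A.bar) M).grading 0) :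
    ∃ m ∈ M.grading 0, x = tm A.toBar (self A.bar) M (ofRing A.bar 1) m := by
  induction hx using tensor_grading_ind with
  | hz => exact ⟨0, zero_mem _, by rw [map_zero]⟩
  | ha x y _ _ hx hy =>
    obtain ⟨m, hm, rfl⟩ := hx
    obtain ⟨m', hm', rfl⟩ := hy
    exact ⟨m + m', add_mem hm hm', by rw [map_add]⟩
  | hn x _ hx =>
    obtain ⟨m, hm, rfl⟩ := hx
    exact ⟨-m, neg_mem hm, by rw [map_neg]⟩
  | ht i j b m hij hb hm =>
    obtain ⟨b, rfl⟩ := ofRing_surjective b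
    rw [ofRing_mem] at hb
    by_cases hi : i = 0
    · subst hi
      obtain ⟨z, rfl⟩ := toH0_surjective b
      obtain rfl : j = 0 := by omega
      refine ⟨(z : A) • m, by simpa using M.smul_mem z.2.1 hm, ?_⟩
      have h1 : ofRing A.bar 1 ∈ (self A.bar).grading 0 := A.bar.one_mem
      rw [tm_smul_right m z.2.1 h1, toBar_of_mem_zero z.2.1 z.2.2, smul_ofRing, mul_one, mul_zero,
        Int.negOnePow_zero, one_smul]
    · rw [ofCommRing_grading_eq_bot hi, AddSubgroup.mem_bot] at hb
      exact ⟨0, zero_mem _, by rw [hb, map_zero, map_zero, AddMonoidHom.zero_apply, map_zero]⟩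

lemma acyclic_tensor_cone {f : CommDGRing.Hom A B} {M N : DGModule A} {φ : M ⟶ N} {X : DGModule B}
    (h : IsQI (tensorMap f (𝟙 X) φ)) : (tensor f X (cone φ)).Acyclic := by
  rw [← acyclic_res_tensor_iff, acyclic_swap_iff, acyclic_cone_tensor_iff, isQI_swap_iff]
  exact (isQI_res_tensorMap_iff f (𝟙 X) φ).2 h

/-- A DG module with bounded above cohomology is isomorphic to `A` if its derived base change
to `Ā` is isomorphic to `Ā`. -/
lemma deq_self_of_ltensor_toBar {M : DGModule A} {N : ℤ} (hN : ∀ i, N < i → M.ExactAt i)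
    (h : DEq (ltensor A.toBar (self A.bar) M) (self A.bar)) : DEq M (self A) := by
  have h0 : ∀ i, 0 < i → M.ExactAt i := exactAbove_of_ltensor_toBar hN fun i hi =>
    h.symm.exactAt (exactAt_of_grading_eq_bot (A.bar.nonpos hi))
  obtain ⟨M', s, hM', hs, hb⟩ := exists_bounded_resolution h0
  have hbar : DEq (tensor A.toBar (self A.bar) M') (self A.bar) :=
    (ltensor_of_kFlat _ hM').symm.trans
      ((ltensor_congr (DEq.refl _) (DEq.of_isQI hs)).trans h)
  obtain ⟨x, hx, hdx, hq⟩ := hbar.exists_fromSelf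
  obtain ⟨z, hz, rfl⟩ := exists_tm_of_mem_zero hx
  -- `M'` has no elements of degree `1`, so the lift `z` is a cocycle for degree reasons.
  have hdz : M'.d z = 0 := by
    have := M'.d_mem hz
    rwa [zero_add, hb 1 one_pos, AddSubgroup.mem_bot] at this
  -- Under `Ā ≅ Ā ⊗ A`, the base change of `A → M'` given by `z` is the map given by `1 ⊗ z`, a
  -- quasi-isomorphism by the choice of `z`.
  have hq' : IsQI (tensorMap A.toBar (𝟙 (self A.bar)) (fromSelf hz hdz)) := by
    refine IsQI.of_comp_left (IsQI.of_bijective (unitHom_bijective A.toBar (self A.bar))) ?_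
    convert hq using 1
    refine hom_eq fun b => ?_
    obtain ⟨b, rfl⟩ := ofRing_surjective b
    rw [comp_toLinearMap, unitHom_apply, tensorMap_tm, fromSelf_ofRing, fromSelf_ofRing, one_smul,
      smul_tm, smul_ofRing, mul_one]
    rfl
  have hC : (cone (fromSelf hz hdz)).Acyclic := by
    have hb' : ∀ i, 0 < i → (cone (fromSelf hz hdz)).ExactAt i := fun i hi =>
      exactAt_of_grading_eq_bot (by
        rw [eq_bot_iff]
        intro c hc
        obtain ⟨⟨y, x⟩, rfl⟩ := (coneMk_bijective _).2 c
        obtain ⟨h1, h2⟩ := (coneMk_mem _ _).1 hc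
        dsimp only at h1 h2
        rw [hb i hi, AddSubgroup.mem_bot] at h1
        rw [show (self A).grading (i + 1) = ⊥ from A.nonpos (by omega), AddSubgroup.mem_bot] at h2
        rw [h1, h2, AddSubgroup.mem_bot]
        exact map_zero _)
    rw [acyclic_iff_exactAt]
    intro i
    -- The base change of the cone is acyclic, so the bound `n` is arbitrary; `n = i - 1` gives
    -- exactness in degree `i`.
    refine exactAbove_of_ltensor_toBar (n := i - 1) hb' (fun j _ => ?_) i (by omega)
    refine (ltensor_of_kFlat _ (kFlat_cone kFlat_self hM' _)).symm.exactAt ?_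
    exact (acyclic_iff_exactAt _).1 (acyclic_tensor_cone hq') j
  exact (DEq.of_isQI hs).symm.trans (DEq.of_isQI ((acyclic_cone_iff _).1 hC)).symm

end DGModule
end DG

/-! ### Invertible DG modules have finitely generated, bounded above cohomology. -/

namespace DG
open CategoryTheory
open scoped TensorProduct

namespace DGModule

variable {A B : CommDGRing.{u}}

/-- Surjectivity on cohomology, elementwise. -/
def HSurj {M N : DGModule A} (f : M ⟶ N) : Prop :=
  ∀ y, N.d y = 0 → ∃ x, M.d x = 0 ∧ ∃ w, y = f.toLinearMap x + N.d w

section HSurj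

variable {M N P : DGModule A} {f : M ⟶ N} {g : N ⟶ P}

lemma IsQI.hSurj (h : IsQI f) : HSurj f := h.surj

lemma HSurj.comp (hf : HSurj f) (hg : HSurj g) : HSurj (f ≫ g) := fun y hy => by
  obtain ⟨x, hx, w, rfl⟩ := hg y hy
  obtain ⟨x', hx', v, rfl⟩ := hf x hx
  exact ⟨x', hx', g.toLinearMap v + w, by
    rw [map_add, map_add, comp_toLinearMap, g.map_d, add_assoc]⟩

lemma HSurj.of_comp (h : HSurj (f ≫ g)) : HSurj g := fun y hy => by
  obtain ⟨x, hx, w, hw⟩ := h y hy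
  exact ⟨f.toLinearMap x, by rw [← f.map_d, hx, map_zero], w, hw⟩

lemma HSurj.of_comp_isQI (h : HSurj (f ≫ g)) (hg : IsQI g) : HSurj f := fun y hy => by
  obtain ⟨x, hx, w, hw⟩ := h (g.toLinearMap y) (by rw [← g.map_d, hy, map_zero])
  obtain ⟨v, hv⟩ := hg.inj (y - f.toLinearMap x)
    (by rw [map_sub, ← f.map_d, hy, hx, map_zero, sub_zero])
    ⟨w, by rw [map_sub, hw]; exact (add_sub_cancel_left _ _).symm⟩
  exact ⟨x, hx, v, by rw [hv]; abel⟩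

end HSurj

lemma assocHom_natural {C : CommDGRing.{u}} (f : CommDGRing.Hom A B) (g : CommDGRing.Hom B C)
    (h : CommDGRing.Hom A C) (hh : ∀ a, h.toRingHom a = g.toRingHom (f.toRingHom a))
    {X X' : DGModule C} {M M' : DGModule B} {N N' : DGModule A} (φ : X ⟶ X') (ψ : M ⟶ M')
    (χ : N ⟶ N') :
    tensorMap h (tensorMap g φ ψ) χ ≫ assocHom f g h X' M' N' hh
      = assocHom f g h X M N hh ≫ tensorMap g φ (tensorMap f ψ χ) :=
  tensor_dgHom_ext fun i j m n hm _ => by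
    clear hm
    induction m using tensor_ind with
    | hz => simp
    | ha x y hx hy => simp only [map_add, AddMonoidHom.add_apply, hx, hy]
    | ht k l x m _ _ =>
      rw [comp_toLinearMap, comp_toLinearMap, tensorMap_tm, tensorMap_tm, assocHom_tm,
        assocHom_tm, tensorMap_tm, tensorMap_tm]

section Sub

variable (M : DGModule A) (S : Submodule A M) (hd : ∀ x ∈ S, M.d x ∈ S)
  (hc : ∀ (i : ℤ), ∀ x ∈ S, comp M.isInternal i x ∈ S)

/-- A homogeneous submodule stable under the differential, as a DG module. -/
def sub : DGModule A where
  carrier := S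
  grading i := (M.grading i).comap S.subtype.toAddMonoidHom
  isInternal := isInternal_of_injective M.isInternal S.subtype.toAddMonoidHom
    Subtype.val_injective (fun _ _ h => h) (by
      rw [eq_top_iff]
      rintro ⟨x, hx⟩ -
      have h : (⟨x, hx⟩ : S) = (components M.isInternal x).support.sum
          fun i => (⟨comp M.isInternal i x, hc i x hx⟩ : S) := by
        refine Subtype.ext ?_
        rw [← S.subtype_apply, ← S.subtype_apply, map_sum]
        exact (sum_components M.isInternal x).symm
      rw [h]
      exact sum_mem fun i _ => AddSubgroup.mem_iSup_of_mem i (comp_mem _ _ _))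
  smul_mem ha hm := M.smul_mem ha hm
  d := (M.d.comp S.subtype.toAddMonoidHom).codRestrict S.toAddSubgroup fun x => hd x x.2
  d_mem hm := M.d_mem hm
  d_d m := Subtype.ext (M.d_d _)
  leibniz {i} {a} ha m := Subtype.ext (by
    refine (M.leibniz ha (m : M)).trans ?_
    rcases Int.units_eq_one_or i.negOnePow with h | h <;> rw [h] <;> simp <;> rfl)

/-- The inclusion of a DG submodule. -/
def subIncl : sub M S hd hc ⟶ M where
  toLinearMap := S.subtype
  map_mem h := h
  map_d _ := rfl

lemma subIncl_injective : Function.Injective (subIncl M S hd hc).toLinearMap :=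
  Subtype.val_injective

lemma exists_subIncl {x : M} (hx : x ∈ S) : ∃ y, (subIncl M S hd hc).toLinearMap y = x :=
  ⟨⟨x, hx⟩, rfl⟩

lemma subIncl_mem (y : sub M S hd hc) : (subIncl M S hd hc).toLinearMap y ∈ S := y.2

end Sub

/-- The set of a family of homogeneous elements together with their differentials. -/
def withD (M : DGModule A) (s : Set M) : Set M := s ∪ M.d '' s

lemma span_withD_d {M : DGModule A} {s : Set M} {x : M}
    (hx : x ∈ Submodule.span A (withD M s)) : M.d x ∈ Submodule.span A (withD M s) := by
  induction hx using Submodule.span_induction with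
  | zero => rw [map_zero]; exact zero_mem _
  | add x y _ _ hx hy => rw [map_add]; exact add_mem hx hy
  | smul a x hx' hx =>
    rw [d_smul]
    exact add_mem (Submodule.smul_mem _ _ hx') (Submodule.smul_mem _ _ hx)
  | mem x hx =>
    rcases hx with hx | ⟨y, -, rfl⟩
    · exact Submodule.subset_span (Or.inr ⟨x, hx, rfl⟩)
    · rw [M.d_d]; exact zero_mem _

lemma span_comp_mem {M : DGModule A} {t : Set M} (ht : ∀ x ∈ t, ∃ i, x ∈ M.grading i) (i : ℤ)
    {x : M} (hx : x ∈ Submodule.span A t) : comp M.isInternal i x ∈ Submodule.span A t := by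
  induction hx using Submodule.span_induction generalizing i with
  | zero => rw [map_zero]; exact zero_mem _
  | add x y _ _ hx hy => rw [map_add]; exact add_mem (hx i) (hy i)
  | mem x hx =>
    obtain ⟨j, hj⟩ := ht x hx
    by_cases h : j = i
    · rw [comp_of_mem _ (h ▸ hj)]; exact Submodule.subset_span hx
    · rw [comp_of_mem_ne _ hj h]; exact zero_mem _
  | smul a x _ hx =>
    induction a using A.hom_induction with
    | hz => rw [zero_smul, map_zero]; exact zero_mem _
    | ha a b ha hb => rw [add_smul, map_add]; exact add_mem ha hb
    | hm j a ha =>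
      have h := smul_comp (k := i - j) ha x
      rw [sub_add_cancel] at h
      rw [h]
      exact Submodule.smul_mem _ _ (hx _)

lemma withD_homogeneous {M : DGModule A} {s : Set M} (hs : ∀ x ∈ s, ∃ i, x ∈ M.grading i) :
    ∀ x ∈ withD M s, ∃ i, x ∈ M.grading i := by
  rintro x (hx | ⟨y, hy, rfl⟩)
  · exact hs x hx
  · obtain ⟨i, hi⟩ := hs y hy
    exact ⟨i + 1, M.d_mem hi⟩

/-- A tensor is a finite sum of pure tensors, so it lifts along any homomorphism that hits the left
factors occurring in them. -/
lemma exists_finset_tensor {f : CommDGRing.Hom A B} {M : DGModule B} {N : DGModule A}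
    (z : tensor f M N) :
    ∃ s : Set M, s.Finite ∧ (∀ x ∈ s, ∃ i, x ∈ M.grading i) ∧
      ∀ (M' : DGModule B) (φ : M' ⟶ M), (∀ x ∈ s, ∃ y, φ.toLinearMap y = x) →
        ∃ z', (tensorMap f φ (𝟙 N)).toLinearMap z' = z := by
  induction z using tensor_ind with
  | hz => exact ⟨∅, Set.finite_empty, by simp, fun _ _ _ => ⟨0, map_zero _⟩⟩
  | ha x y hx hy =>
    obtain ⟨s, hs, hs', h⟩ := hx
    obtain ⟨t, ht, ht', h'⟩ := hy
    refine ⟨s ∪ t, hs.union ht, ?_, fun M' φ hφ => ?_⟩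
    · rintro x (hx | hx)
      exacts [hs' x hx, ht' x hx]
    · obtain ⟨z, rfl⟩ := h M' φ fun x hx => hφ x (Or.inl hx)
      obtain ⟨z', rfl⟩ := h' M' φ fun x hx => hφ x (Or.inr hx)
      exact ⟨z + z', map_add _ _ _⟩
  | ht i j m n hm hn =>
    refine ⟨{m}, Set.finite_singleton m, by rintro x rfl; exact ⟨i, hm⟩, fun M' φ hφ => ?_⟩
    obtain ⟨m, rfl⟩ := hφ m rfl
    exact ⟨tm f M' N m n, by rw [tensorMap_tm, id_toLinearMap]⟩

/-- The cohomology of an invertible DG module is finitely generated in the appropriate sense. -/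
lemma exists_finite_generation {M : DGModule A} (hM : IsUnit (DMon.mk M)) :
    ∃ t : Set M, t.Finite ∧ (∀ x ∈ t, ∃ i, x ∈ M.grading i) ∧
      ∀ x, M.d x = 0 → ∃ y ∈ Submodule.span A t, ∃ w, x = y + M.d w := by
  obtain ⟨n, hn⟩ := isUnit_iff_exists_inv.1 hM
  obtain ⟨N, rfl⟩ := DMon.mk_surjective n
  let Q := (resFunctor A).obj N
  let P := (resFunctor A).obj M
  have hQ : Q.KFlat := kFlat_resFunctor N
  have hP : P.KFlat := kFlat_resFunctor M
  have eQ : DMon.mk Q = DMon.mk N := DMon.mk_eq.2 (deq_resFunctor N)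
  have eP : DMon.mk P = DMon.mk M := DMon.mk_eq.2 (deq_resFunctor M)
  let ι := CommDGRing.Hom.id A
  have h1 : DEq (tensor ι M Q) (self A) := DMon.mk_eq.1 (by
    rw [DMon.mk_tensor M hQ, eQ, hn, DMon.one_def])
  have h2 : DEq (tensor ι Q P) (self A) := DMon.mk_eq.1 (by
    rw [DMon.mk_tensor Q hP, eQ, eP, mul_comm, hn, DMon.one_def])
  have hK : (tensor ι Q P).KFlat := kFlat_tensor hQ hP
  obtain ⟨z, hz, hdz, hzq⟩ := h1.exists_fromSelf
  obtain ⟨s, hs, hs', hsz⟩ := exists_finset_tensor z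
  -- The DG submodule generated by the finitely many elements of `M` that occur in the generator `z`
  -- of the cohomology of `M ⊗ Q`.
  let S := Submodule.span A (withD M s)
  have hSd : ∀ x ∈ S, M.d x ∈ S := fun _ => span_withD_d
  have hSc : ∀ i, ∀ x ∈ S, comp M.isInternal i x ∈ S := fun i _ =>
    span_comp_mem (withD_homogeneous hs') i
  let j := subIncl M S hSd hSc
  obtain ⟨y, hy⟩ := hsz _ j fun x hx => exists_subIncl M S hSd hSc
    (Submodule.subset_span (Or.inl hx))
  -- `Q` is free as a graded module, so `S ⊗ Q` embeds in `M ⊗ Q`; the lift `y` of `z` thereby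
  -- inherits degree `0` and the cocycle condition.
  have hinj : Function.Injective (tensorMap ι j (𝟙 Q)).toLinearMap :=
    tensorMap_free_injective resData_isDG ι j (subIncl_injective M S hSd hSc)
  have hy0 : y ∈ (tensor ι (sub M S hSd hSc) Q).grading 0 := by
    have : comp (tensor ι (sub M S hSd hSc) Q).isInternal 0 y = y := hinj (by
      rw [← comp_map, hy, comp_of_mem _ hz])
    rw [← this]
    exact comp_mem _ _ _
  have hdy : (tensor ι (sub M S hSd hSc) Q).d y = 0 := hinj (by
    rw [DGModule.Hom.map_d, hy, hdz, map_zero])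
  have e1 : fromSelf hz hdz = fromSelf hy0 hdy ≫ tensorMap ι j (𝟙 Q) := hom_eq fun a => by
    obtain ⟨a, rfl⟩ := ofRing_surjective a
    rw [comp_toLinearMap, fromSelf_ofRing, fromSelf_ofRing, LinearMap.map_smul, hy]
  -- The quasi-isomorphism `A → M ⊗ Q` factors through `S ⊗ Q`. After tensoring with the K-flat `P`,
  -- the second factor is still surjective on cohomology.
  have s1 : HSurj (tensorMap ι (tensorMap ι j (𝟙 Q)) (𝟙 P)) := by
    have h := (hP.isQI_tensorMap_left (f := ι) hzq).hSurj
    rw [e1, ← Category.comp_id (𝟙 P), tensorMap_comp] at h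
    exact h.of_comp
  have s2 : HSurj (tensorMap ι j (𝟙 (tensor ι Q P))) := by
    have h := s1.comp (IsQI.of_bijective (assocHom_bijective ι ι ι M Q P fun _ => rfl)).hSurj
    have e := assocHom_natural ι ι ι (fun _ => rfl) j (𝟙 Q) (𝟙 P)
    rw [tensorMap_id] at e
    exact HSurj.of_comp (f := assocHom ι ι ι (sub M S hSd hSc) Q P fun _ => rfl) (e ▸ h)
  obtain ⟨k, hk, hdk, hkq⟩ := h2.exists_fromSelf
  -- Since `Q ⊗ P ≅ A` in `D(A)`, tensoring with `P` has undone tensoring with `Q`: surjectivity is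
  -- transported along `A → Q ⊗ P`, then to `S → M` itself.
  have s3 : HSurj (tensorMap ι j (𝟙 (self A))) := by
    have h := (isQI_tensorMap_of_kFlat (f := ι) (sub M S hSd hSc) kFlat_self hK hkq).hSurj.comp s2
    rw [← tensorMap_comp, Category.id_comp, Category.comp_id] at h
    have e : tensorMap ι j (fromSelf hk hdk)
        = tensorMap ι j (𝟙 _) ≫ tensorMap ι (𝟙 M) (fromSelf hk hdk) := by
      rw [← tensorMap_comp, Category.id_comp, Category.comp_id]
    rw [e] at h
    exact h.of_comp_isQI (isQI_tensorMap_of_kFlat M kFlat_self hK hkq)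
  have s4 : HSurj j := by
    have h := (IsQI.of_bijective (unitHom_bijective ι (sub M S hSd hSc))).hSurj.comp s3
    rw [unitHom_natural] at h
    exact h.of_comp_isQI (IsQI.of_bijective (unitHom_bijective ι M))
  refine ⟨withD M s, hs.union (hs.image _), withD_homogeneous hs', fun x hx => ?_⟩
  obtain ⟨x', -, w, hw⟩ := s4 x hx
  exact ⟨_, subIncl_mem M S hSd hSc x', w, hw⟩

/-- Scalars have degree at most `0`, so taking the span cannot raise the top degree. -/
lemma comp_eq_zero_of_mem_span {M : DGModule A} {t : Set M} {N : ℤ}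
    (ht : ∀ x ∈ t, ∀ i, N < i → comp M.isInternal i x = 0) {x : M}
    (hx : x ∈ Submodule.span A t) {i : ℤ} (hi : N < i) : comp M.isInternal i x = 0 := by
  induction hx using Submodule.span_induction generalizing i with
  | zero => rw [map_zero]
  | add x y _ _ hx hy => rw [map_add, hx hi, hy hi, add_zero]
  | mem x hx => exact ht x hx i hi
  | smul a x _ hx =>
    induction a using A.hom_induction with
    | hz => rw [zero_smul, map_zero]
    | ha a b ha hb => rw [add_smul, map_add, ha, hb, add_zero]
    | hm j a ha =>
      by_cases hj : 0 < j
      · rw [A.nonpos hj, AddSubgroup.mem_bot] at ha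
        rw [ha, zero_smul, map_zero]
      have h := smul_comp (k := i - j) ha x
      rw [sub_add_cancel] at h
      rw [h, hx (by omega), smul_zero]

/-- Invertible DG modules have bounded above cohomology. -/
lemma exists_exactAt_of_isUnit {M : DGModule A} (hM : IsUnit (DMon.mk M)) :
    ∃ N : ℤ, ∀ i, N < i → M.ExactAt i := by
  obtain ⟨t, ht, hh, h⟩ := exists_finite_generation hM
  choose! deg hdeg using hh
  obtain ⟨N, hN⟩ := (ht.image deg).bddAbove
  refine ⟨N, fun i hi x hx hd => ?_⟩
  obtain ⟨y, hy, w, hw⟩ := h x hd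
  refine ⟨comp M.isInternal (i - 1) w, ?_⟩
  rw [comp_d, sub_add_cancel]
  have h1 := congrArg (comp M.isInternal i) hw
  rw [map_add, comp_of_mem _ hx, comp_eq_zero_of_mem_span (N := N) ?_ hy hi, zero_add] at h1
  · exact h1.symm
  · intro z hz k hk
    exact comp_of_mem_ne _ (hdeg z hz) (by have := hN ⟨z, hz, rfl⟩; omega)

end DGModule
end DG

/-! ### Invertible DG modules over a commutative ring: top cohomology and the local case. -/

namespace DG
open CategoryTheory
open scoped TensorProduct

namespace DGModule

section Ring

variable {S : Type u} [CommRing S]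

/-- A DG module over a commutative ring is in particular a module. -/
instance (M : DGModule (CommDGRing.ofCommRing S)) : Module S M :=
  Module.compHom M (ringEquiv S).toRingHom

variable {M N : DGModule (CommDGRing.ofCommRing S)}

lemma ring_smul_def (s : S) (x : M) : s • x = ringEquiv S s • x := rfl

lemma ring_smul_mem (s : S) {x : M} {i : ℤ} (hx : x ∈ M.grading i) : s • x ∈ M.grading i := by
  rw [ring_smul_def]
  simpa using M.smul_mem (ofCommRing_mem_zero (ringEquiv S s)) hx

lemma ring_d_smul (s : S) (x : M) : M.d (s • x) = s • M.d x := by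
  rw [ring_smul_def, M.leibniz (ofCommRing_mem_zero _), d_ofCommRing, zero_smul, zero_add,
    Int.negOnePow_zero, one_smul, ring_smul_def]

lemma ring_comp_smul (i : ℤ) (s : S) (x : M) :
    comp M.isInternal i (s • x) = s • comp M.isInternal i x := by
  have h := smul_comp (k := i) (ofCommRing_mem_zero (ringEquiv S s)) x
  rwa [add_zero] at h

lemma ring_map_smul (φ : M ⟶ N) (s : S) (x : M) :
    φ.toLinearMap (s • x) = s • φ.toLinearMap x := φ.toLinearMap.map_smul _ _

/-- The elements whose component of degree `n` is a coboundary, as a submodule. -/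
noncomputable def compBoundarySubmodule (M : DGModule (CommDGRing.ofCommRing S)) (n : ℤ) :
    Submodule S M :=
  { compBoundary M n with
    smul_mem' := by
      rintro s x ⟨w, hw⟩
      exact ⟨s • w, by rw [ring_d_smul, ring_comp_smul, hw]⟩ }

lemma mem_compBoundarySubmodule {n : ℤ} {x : M} :
    x ∈ compBoundarySubmodule M n ↔ ∃ w, M.d w = comp M.isInternal n x := Iff.rfl

lemma d_mem_compBoundarySubmodule (n : ℤ) (w : M) : M.d w ∈ compBoundarySubmodule M n :=
  ⟨comp M.isInternal (n - 1) w, by rw [comp_d, sub_add_cancel]⟩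

lemma sub_comp_mem_compBoundarySubmodule (n : ℤ) (x : M) :
    x - comp M.isInternal n x ∈ compBoundarySubmodule M n :=
  ⟨0, by rw [map_zero, map_sub, comp_of_mem _ (comp_mem _ _ _), sub_self]⟩

lemma span_le_ring_span (t : Set M) {x : M}
    (hx : x ∈ Submodule.span (CommDGRing.ofCommRing S) t) : x ∈ Submodule.span S t := by
  induction hx using Submodule.span_induction with
  | zero => exact zero_mem _
  | add x y _ _ hx hy => exact add_mem hx hy
  | mem x hx => exact Submodule.subset_span hx
  | smul a x _ hx => exact Submodule.smul_mem _ ((ringEquiv S).symm a) hx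

/-- As `M` vanishes above degree `n`, the quotient is `H^n(M)`, and the finite generation of the
cohomology of an invertible DG module descends to it. -/
lemma finite_top_cohomology {n : ℤ} (hb : ∀ i, n < i → M.grading i = ⊥)
    (hu : IsUnit (DMon.mk M)) : Module.Finite S (M ⧸ compBoundarySubmodule M n) := by
  obtain ⟨t, ht, -, h⟩ := exists_finite_generation hu
  refine ⟨⟨(ht.image (compBoundarySubmodule M n).mkQ).toFinset, ?_⟩⟩
  rw [Set.Finite.coe_toFinset, ← Submodule.map_span, eq_top_iff]
  rintro x -
  obtain ⟨x, rfl⟩ := Submodule.mkQ_surjective _ x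
  have hd : M.d (comp M.isInternal n x) = 0 := by
    have := M.d_mem (comp_mem M.isInternal n x)
    rwa [hb _ (lt_add_one n), AddSubgroup.mem_bot] at this
  obtain ⟨y, hy, w, hw⟩ := h _ hd
  refine ⟨y, span_le_ring_span t hy, ?_⟩
  rw [← sub_eq_zero, ← map_sub, Submodule.mkQ_apply, Submodule.Quotient.mk_eq_zero]
  have h1 : y - x = -(x - comp M.isInternal n x) - M.d w := by rw [hw]; abel
  rw [h1]
  exact sub_mem (neg_mem (sub_comp_mem_compBoundarySubmodule n x))
    (d_mem_compBoundarySubmodule n w)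

/-- The top cohomology of an invertible DG module has a simple quotient. -/
lemma exists_residue_functional {n : ℤ} (hb : ∀ i, n < i → M.grading i = ⊥)
    (hu : IsUnit (DMon.mk M)) (hne : ¬ M.ExactAt n) :
    ∃ (I : Ideal S) (_ : I.IsMaximal) (φ : M →ₗ[S] S ⧸ I), (∀ w, φ (M.d w) = 0) ∧
      ∃ p ∈ M.grading n, φ p ≠ 0 := by
  have := finite_top_cohomology hb hu
  have hnt : Nontrivial (M ⧸ compBoundarySubmodule M n) := by
    rw [Submodule.Quotient.nontrivial_iff]
    rintro h
    refine hne fun x hx _ => ?_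
    obtain ⟨w, hw⟩ := mem_compBoundarySubmodule.1 (h.symm ▸ Submodule.mem_top (x := x))
    exact ⟨w, hw.trans (comp_of_mem _ hx)⟩
  -- A nonzero finite module has a maximal proper submodule; the corresponding simple quotient is `S
  -- ⧸ I` for a maximal ideal `I`.
  obtain ⟨K, hK, -⟩ := (eq_top_or_exists_le_coatom
    (⊥ : Submodule S (M ⧸ compBoundarySubmodule M n))).resolve_left bot_ne_top
  obtain ⟨I, hI, ⟨e⟩⟩ := isSimpleModule_iff_quot_maximal.1 (isSimpleModule_iff_isCoatom.2 hK)
  let φ : M →ₗ[S] S ⧸ I := e.toLinearMap ∘ₗ K.mkQ ∘ₗ (compBoundarySubmodule M n).mkQ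
  have h0 : ∀ x ∈ compBoundarySubmodule M n, φ x = 0 := fun x hx => by
    change e (K.mkQ ((compBoundarySubmodule M n).mkQ x)) = 0
    rw [(Submodule.Quotient.mk_eq_zero _).2 hx |> (Submodule.mkQ_apply _ x).trans, map_zero,
      map_zero]
  have hs : Function.Surjective φ :=
    e.surjective.comp ((Submodule.mkQ_surjective _).comp (Submodule.mkQ_surjective _))
  refine ⟨I, hI, φ, fun w => h0 _ (d_mem_compBoundarySubmodule n w), ?_⟩
  have := hI
  obtain ⟨x, hx⟩ := hs 1
  refine ⟨_, comp_mem M.isInternal n x, ?_⟩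
  have h1 := h0 _ (sub_comp_mem_compBoundarySubmodule n x)
  rw [map_sub, sub_eq_zero] at h1
  rw [← h1, hx]
  have : Nontrivial (S ⧸ I) := Ideal.Quotient.nontrivial_iff.2 hI.ne_top
  exact one_ne_zero

lemma exists_top {M : DGModule (CommDGRing.ofCommRing S)} {N : ℤ} (hN : ∀ i, N < i → M.ExactAt i)
    (h : ¬ M.Acyclic) : ∃ n, ¬ M.ExactAt n ∧ ∀ i, n < i → M.ExactAt i := by
  rw [acyclic_iff_exactAt, not_forall] at h
  obtain ⟨n, hn, hn'⟩ := Int.exists_greatest_of_bdd (P := fun i => ¬ M.ExactAt i)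
    ⟨N, fun i hi => not_lt.1 fun h' => hi (hN i h')⟩ h
  exact ⟨n, hn, fun i hi => by_contra fun h' => (hn' i h').not_gt hi⟩

lemma exactAt_tensor_of_mul_eq_one {i : ℤ} (hi : i ≠ 0) (hN : N.KFlat)
    (h : DMon.mk M * DMon.mk N = 1) : (tensor (CommDGRing.Hom.id _) M N).ExactAt i := by
  rw [← DMon.mk_tensor M hN, DMon.one_def, DMon.mk_eq] at h
  exact h.symm.exactAt (exactAt_of_grading_eq_bot (ofCommRing_grading_eq_bot hi))

lemma not_acyclic_of_isUnit [Nontrivial S] (hu : IsUnit (DMon.mk M)) : ¬ M.Acyclic := by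
  intro h
  obtain ⟨n, hn⟩ := isUnit_iff_exists_inv.1 hu
  obtain ⟨N, rfl⟩ := DMon.mk_surjective n
  have h1 : (ltensor (CommDGRing.Hom.id _) M N).Acyclic := (kFlat_resFunctor N).acyclic_tensor h
  have h2 := (DMon.mk_eq.1 hn).acyclic h1
  obtain ⟨w, hw⟩ := (acyclic_iff _).1 h2 (ofRing _ 1) rfl
  have h3 : ofRing (CommDGRing.ofCommRing S) 1 = 0 := hw.symm
  have h4 : (1 : S) = 0 := h3
  exact one_ne_zero h4

/-- Over a local ring, mutually inverse DG modules have cocycles whose product does not vanish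
modulo the maximal ideal. -/
lemma exists_cocycles_of_isLocalRing [IsLocalRing S] (hN : N.KFlat)
    (h : DMon.mk M * DMon.mk N = 1) :
    ∃ n, ∃ p ∈ M.grading n, M.d p = 0 ∧ ∃ q ∈ N.grading (-n), N.d q = 0 ∧
      ∀ m ∈ IsLocalRing.maximalIdeal S, ∀ w v : tensor (CommDGRing.Hom.id _) M N,
        DGModule.d _ w = 0 → tm (CommDGRing.Hom.id _) M N p q ≠ m • w + DGModule.d _ v := by
  have huM : IsUnit (DMon.mk M) := isUnit_iff_exists_inv.2 ⟨_, h⟩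
  have huN : IsUnit (DMon.mk N) := isUnit_iff_exists_inv.2 ⟨_, (mul_comm _ _).trans h⟩
  obtain ⟨bM, hbM⟩ := exists_exactAt_of_isUnit huM
  obtain ⟨bN, hbN⟩ := exists_exactAt_of_isUnit huN
  obtain ⟨n, hn, hn'⟩ := exists_top hbM (not_acyclic_of_isUnit huM)
  obtain ⟨m, hm, hm'⟩ := exists_top hbN (not_acyclic_of_isUnit huN)
  -- Resolutions that vanish above the top degrees `n` and `m` of the cohomology; on them the
  -- functionals on top cohomology are defined on all elements.
  obtain ⟨M', s, hM', hs, hMb⟩ := exists_bounded_resolution hn'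
  obtain ⟨N', t, hN', ht, hNb⟩ := exists_bounded_resolution hm'
  have eM : DMon.mk M' = DMon.mk M := DMon.mk_eq.2 (DEq.of_isQI hs)
  have eN : DMon.mk N' = DMon.mk N := DMon.mk_eq.2 (DEq.of_isQI ht)
  obtain ⟨I, hI, φ, hφ, p, hp, hφp⟩ := exists_residue_functional hMb (eM ▸ huM)
    fun h' => hn ((DEq.of_isQI hs).exactAt h')
  obtain ⟨J, hJ, ψ, hψ, q, hq, hψq⟩ := exists_residue_functional hNb (eN ▸ huN)
    fun h' => hm ((DEq.of_isQI ht).exactAt h')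
  obtain rfl := IsLocalRing.eq_maximalIdeal hI
  obtain rfl := IsLocalRing.eq_maximalIdeal hJ
  have hdp : M'.d p = 0 := by
    have := M'.d_mem hp
    rwa [hMb _ (lt_add_one n), AddSubgroup.mem_bot] at this
  have hdq : N'.d q = 0 := by
    have := N'.d_mem hq
    rwa [hNb _ (lt_add_one m), AddSubgroup.mem_bot] at this
  -- The product of the two functionals. It detects `p ⊗ q`, because the residue ring is a field,
  -- and vanishes on coboundaries and on multiples of the maximal ideal.
  let Φ : tensor (CommDGRing.Hom.id _) M' N' →+ S ⧸ IsLocalRing.maximalIdeal S :=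
    tlift ((AddMonoidHom.mul.comp φ.toAddMonoidHom).compl₂ ψ.toAddMonoidHom) (by
      intro i j k a x y ha _ _
      by_cases hi : i = 0
      · subst hi
        rw [zero_mul, Int.negOnePow_zero, one_smul]
        change φ ((ringEquiv S).symm a • x) * ψ y = φ x * ψ ((ringEquiv S).symm a • y)
        rw [map_smul, map_smul, smul_mul_assoc, mul_smul_comm]
      · rw [ofCommRing_grading_eq_bot hi, AddSubgroup.mem_bot] at ha
        rw [ha, map_zero, zero_smul, zero_smul, map_zero, map_zero, smul_zero,
          AddMonoidHom.zero_apply])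
  have hΦ : ∀ x y, Φ (tm _ M' N' x y) = φ x * ψ y := fun x y => tlift_tm _ _ _ _
  have hΦd : ∀ x, Φ (DGModule.d _ x) = 0 := by
    intro x
    induction x using tensor_ind with
    | hz => simp
    | ha x y hx hy => rw [map_add, map_add, hx, hy, add_zero]
    | ht i j x y hx hy => rw [d_tm hx, map_add, map_unit_smul, hΦ, hΦ, hφ, hψ]; simp
  have hΦm : ∀ r ∈ IsLocalRing.maximalIdeal S, ∀ x : tensor (CommDGRing.Hom.id _) M' N',
      Φ (r • x) = 0 := by
    intro r hr x
    induction x using tensor_ind with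
    | hz => simp
    | ha x y hx hy => rw [smul_add, map_add, hx, hy, add_zero]
    | ht i j x y hx hy =>
      change Φ (tm _ M' N' (r • x) y) = 0
      rw [hΦ, map_smul, Algebra.smul_def, Ideal.Quotient.algebraMap_eq,
        Ideal.Quotient.eq_zero_iff_mem.2 hr, zero_mul, zero_mul]
  have hΦpq : Φ (tm _ M' N' p q) ≠ 0 := by
    rw [hΦ]; exact mul_ne_zero hφp hψq
  have hdpq : DGModule.d _ (tm (CommDGRing.Hom.id _) M' N' p q) = 0 := by
    rw [d_tm hp, hdp, hdq]; simp
  -- The cohomology of `M' ⊗ N'` is concentrated in degree `0`, so in any other degree `p ⊗ q` would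
  -- be a coboundary.
  have hnm : n + m = 0 := by
    by_contra hne
    obtain ⟨w, hw⟩ := exactAt_tensor_of_mul_eq_one (M := M') hne hN' (by rw [eM, eN, h])
      _ (tm_mem rfl hp hq) hdpq
    exact hΦpq (hw ▸ hΦd w)
  obtain rfl : m = -n := by omega
  have hst : IsQI (tensorMap (CommDGRing.Hom.id _) s t) := by
    have := (hN'.isQI_tensorMap_left (f := CommDGRing.Hom.id _) hs).comp
      (isQI_tensorMap_of_kFlat (f := CommDGRing.Hom.id _) M hN' hN ht)
    rwa [← tensorMap_comp, Category.id_comp, Category.comp_id] at this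
  refine ⟨n, _, s.map_mem hp, by rw [← s.map_d, hdp, map_zero], _, t.map_mem hq,
    by rw [← t.map_d, hdq, map_zero], fun r hr w v hw hv => ?_⟩
  -- A relation in `M ⊗ N` that contradicts the claim is pulled back along the quasi-isomorphism `s
  -- ⊗ t` to `M' ⊗ N'`, where `Φ` rules it out.
  obtain ⟨w', hw', u, rfl⟩ := hst.surj w hw
  obtain ⟨u', hu'⟩ := hst.inj (tm _ M' N' p q - r • w')
    (by rw [map_sub, hdpq, ring_d_smul, hw', smul_zero, sub_zero])
    ⟨r • u + v, by
      rw [map_sub, tensorMap_tm, hv, ring_map_smul, map_add, ring_d_smul, smul_add]; abel⟩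
  apply hΦpq
  rw [← sub_add_cancel (tm _ M' N' p q) (r • w'), map_add, ← hu', hΦd, hΦm r hr, add_zero]

end Ring

end DGModule
end DG

/-! ### Localization, and the unit class as a sum of products of cocycles. -/

namespace DG
open CategoryTheory
open scoped TensorProduct

/-- A homomorphism of commutative rings, as a homomorphism of DG rings. -/
def CommDGRing.ofRingHom {R S : Type u} [CommRing R] [CommRing S] (g : R →+* S) :
    CommDGRing.Hom (CommDGRing.ofCommRing R) (CommDGRing.ofCommRing S) where
  toRingHom := (DGModule.ringEquiv S).toRingHom.comp (g.comp (DGModule.ringEquiv R).symm.toRingHom)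
  map_mem {i a} ha := by
    by_cases hi : i = 0
    · subst hi; exact DGModule.ofCommRing_mem_zero _
    · rw [DGModule.ofCommRing_grading_eq_bot hi, AddSubgroup.mem_bot] at ha
      rw [ha, map_zero]
      exact zero_mem _
  map_d a := by rw [DGModule.d_ofCommRing, DGModule.d_ofCommRing, map_zero]

lemma CommDGRing.ofRingHom_apply {R S : Type u} [CommRing R] [CommRing S] (g : R →+* S) (r : R) :
    (CommDGRing.ofRingHom g).toRingHom (DGModule.ringEquiv R r) = DGModule.ringEquiv S (g r) := rfl

namespace DGModule

section BaseChangeRing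

variable {R S : Type u} [CommRing R] [CommRing S] (g : R →+* S)

/-- The base change of a DG module along a homomorphism of commutative rings. -/
noncomputable abbrev ringBaseChange (M : DGModule (CommDGRing.ofCommRing R)) :
    DGModule (CommDGRing.ofCommRing S) :=
  tensor (CommDGRing.ofRingHom g) (self _) M

variable (M : DGModule (CommDGRing.ofCommRing R))

/-- The canonical map to the base change. -/
noncomputable def toBaseChange : M →+ ringBaseChange g M := tm _ _ M (ofRing _ 1)

lemma toBaseChange_apply (m : M) : toBaseChange g M m = tm _ _ M (ofRing _ 1) m := rfl

variable {M}

lemma ofRing_one_mem (A : CommDGRing.{u}) : ofRing A 1 ∈ (self A).grading 0 := A.one_mem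

lemma toBaseChange_smul (r : R) (m : M) : toBaseChange g M (r • m) = g r • toBaseChange g M m := by
  rw [toBaseChange_apply, toBaseChange_apply, ring_smul_def, ring_smul_def, smul_tm,
    tm_smul_right m (ofCommRing_mem_zero _) (ofRing_one_mem _), mul_zero, Int.negOnePow_zero,
    one_smul, CommDGRing.ofRingHom_apply]

lemma toBaseChange_mem {i : ℤ} {m : M} (hm : m ∈ M.grading i) :
    toBaseChange g M m ∈ (ringBaseChange g M).grading i :=
  tm_mem (zero_add i) (ofRing_one_mem _) hm

lemma d_toBaseChange (m : M) :
    (ringBaseChange g M).d (toBaseChange g M m) = toBaseChange g M (M.d m) := by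
  rw [toBaseChange_apply, d_tm (ofRing_one_mem _), d_ofRing, d_ofCommRing, map_zero, map_zero,
    AddMonoidHom.zero_apply, zero_add, Int.negOnePow_zero, one_smul, toBaseChange_apply]

lemma tm_eq_smul_toBaseChange (s : S) (m : M) :
    tm (CommDGRing.ofRingHom g) (self _) M (ofRing _ (ringEquiv S s)) m
      = s • toBaseChange g M m := by
  rw [ring_smul_def, toBaseChange_apply, smul_tm, smul_ofRing, mul_one]

variable {N : DGModule (CommDGRing.ofCommRing R)}

/-- The comparison of tensor products under base change. -/
noncomputable def tensorToBaseChange : tensor (CommDGRing.Hom.id _) M N →+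
    tensor (CommDGRing.Hom.id _) (ringBaseChange g M) (ringBaseChange g N) :=
  tlift (((tm (CommDGRing.Hom.id _) (ringBaseChange g M) (ringBaseChange g N)).compl₂
    (toBaseChange g N)).comp (toBaseChange g M)) (by
      intro i j k a x y ha hx hy
      by_cases hi : i = 0
      · subst hi
        change tm _ _ _ (toBaseChange g M ((ringEquiv R).symm a • x)) (toBaseChange g N y)
          = _ • tm _ _ _ (toBaseChange g M x) (toBaseChange g N ((ringEquiv R).symm a • y))
        rw [toBaseChange_smul, toBaseChange_smul, ring_smul_def, ring_smul_def,
          tm_smul_right _ (ofCommRing_mem_zero _) (toBaseChange_mem g hx), smul_smul,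
          Int.units_mul_self, one_smul]
        rfl
      · rw [ofCommRing_grading_eq_bot hi, AddSubgroup.mem_bot] at ha
        rw [ha, map_zero, zero_smul, zero_smul, map_zero, map_zero, smul_zero,
          AddMonoidHom.zero_apply])

lemma tensorToBaseChange_tm (x : M) (y : N) :
    tensorToBaseChange g (tm _ M N x y) = tm _ _ _ (toBaseChange g M x) (toBaseChange g N y) :=
  tlift_tm _ _ _ _

lemma tensorToBaseChange_d (w : tensor (CommDGRing.Hom.id _) M N) :
    tensorToBaseChange g (DGModule.d _ w) = DGModule.d _ (tensorToBaseChange g w) := by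
  induction w using tensor_ind with
  | hz => simp
  | ha x y hx hy => simp only [map_add, hx, hy]
  | ht i j x y hx hy =>
    rw [d_tm hx, map_add, map_unit_smul, tensorToBaseChange_tm, tensorToBaseChange_tm,
      tensorToBaseChange_tm, d_tm (toBaseChange_mem g hx), d_toBaseChange, d_toBaseChange]

lemma tensorToBaseChange_smul (r : R) (w : tensor (CommDGRing.Hom.id _) M N) :
    tensorToBaseChange g (r • w) = g r • tensorToBaseChange g w := by
  induction w using tensor_ind with
  | hz => simp
  | ha x y hx hy => simp only [map_add, smul_add, hx, hy]
  | ht i j x y hx hy =>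
    have h1 : r • tm (CommDGRing.Hom.id _) M N x y = tm _ M N (r • x) y := rfl
    rw [h1, tensorToBaseChange_tm, tensorToBaseChange_tm, toBaseChange_smul]
    rfl

end BaseChangeRing

section Localization

variable {R : Type u} [CommRing R] (T : Submonoid R) {M : DGModule (CommDGRing.ofCommRing R)}

lemma exists_smul_eq_toBaseChange
    (y : ringBaseChange (algebraMap R (Localization T)) M) :
    ∃ t ∈ T, ∃ p, algebraMap R (Localization T) t • y = toBaseChange _ M p := by
  induction y using tensor_ind with
  | hz => exact ⟨1, one_mem _, 0, by simp⟩
  | ha x y hx hy =>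
    obtain ⟨t, ht, p, hp⟩ := hx
    obtain ⟨s, hs, q, hq⟩ := hy
    refine ⟨t * s, mul_mem ht hs, s • p + t • q, ?_⟩
    rw [map_add, toBaseChange_smul, toBaseChange_smul, ← hp, ← hq, map_mul, smul_add, smul_smul,
      smul_smul, mul_comm]
  | ht i j b m hb hm =>
    obtain ⟨b, rfl⟩ := ofRing_surjective b
    obtain ⟨b, rfl⟩ := (ringEquiv _).surjective b
    obtain ⟨⟨r, t⟩, h⟩ := IsLocalization.surj T b
    refine ⟨t, t.2, r • m, ?_⟩
    rw [tm_eq_smul_toBaseChange, toBaseChange_smul, smul_smul, mul_comm, h]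

/-- The comparison of the base change to a localization with the localized module. -/
noncomputable def baseChangeToLocalized :
    ringBaseChange (algebraMap R (Localization T)) M →+ LocalizedModule T M :=
  tlift (((smulAddHom (Localization T) (LocalizedModule T M)).compl₂
    (LocalizedModule.mkLinearMap T M).toAddMonoidHom).comp
      ((ringEquiv (Localization T)).symm.toRingHom.toAddMonoidHom.comp (unRing _))) (by
      intro i j k a x y ha hx hy
      by_cases hi : i = 0
      · subst hi
        rw [zero_mul, Int.negOnePow_zero, one_smul]
        obtain ⟨x, rfl⟩ := ofRing_surjective x
        obtain ⟨x, rfl⟩ := (ringEquiv _).surjective x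
        obtain ⟨a, rfl⟩ := (ringEquiv _).surjective a
        change (algebraMap R (Localization T) a * x) • LocalizedModule.mkLinearMap T M y
          = x • LocalizedModule.mkLinearMap T M (a • y)
        rw [map_smul, mul_comm, ← smul_smul, algebraMap_smul]
      · rw [ofCommRing_grading_eq_bot hi, AddSubgroup.mem_bot] at ha
        have h0 : ∀ (Y : Type u) [AddCommGroup Y] (e : ℤˣ), e • (0 : Y) = 0 := fun _ _ e => smul_zero e
        rw [ha, map_zero, zero_smul, zero_smul, map_zero, map_zero, AddMonoidHom.zero_apply]
        exact (h0 _ _).symm)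

lemma baseChangeToLocalized_toBaseChange (m : M) :
    baseChangeToLocalized T (toBaseChange _ M m) = LocalizedModule.mkLinearMap T M m := by
  rw [toBaseChange_apply, baseChangeToLocalized, tlift_tm]
  exact one_smul (Localization T) _

/-- The comparison with `LocalizedModule` need not be shown bijective: applying it already transfers
the criterion for an element to become zero. -/
lemma exists_smul_eq_zero {m : M} (h : toBaseChange (algebraMap R (Localization T)) M m = 0) :
    ∃ t ∈ T, t • m = 0 := by
  have h1 := baseChangeToLocalized_toBaseChange T m
  rw [h, map_zero] at h1
  obtain ⟨t, ht⟩ := (IsLocalizedModule.eq_zero_iff T (LocalizedModule.mkLinearMap T M)).1 h1.symm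
  exact ⟨t, t.2, ht⟩

/-- Two denominators are needed: `t` moves `y` into the image of `M`, and `s` kills the differential
of the representative, which is known to vanish only after localization. -/
lemma exists_cocycle_smul_eq {n : ℤ} {y : ringBaseChange (algebraMap R (Localization T)) M}
    (hy : y ∈ (ringBaseChange (algebraMap R (Localization T)) M).grading n)
    (hd : DGModule.d _ y = 0) :
    ∃ t ∈ T, ∃ p ∈ M.grading n, M.d p = 0 ∧
      algebraMap R (Localization T) t • y = toBaseChange _ M p := by
  obtain ⟨t, ht, p, hp⟩ := exists_smul_eq_toBaseChange T y
  have hp' : toBaseChange (algebraMap R (Localization T)) M (comp M.isInternal n p)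
      = algebraMap R (Localization T) t • y := by
    have h1 := map_comp_zero M.isInternal
      (ringBaseChange (algebraMap R (Localization T)) M).isInternal
      (toBaseChange (algebraMap R (Localization T)) M) (fun _ _ h => toBaseChange_mem _ h) n p
    rw [← h1, ← hp, comp_of_mem _ (ring_smul_mem _ hy)]
  have h0 : toBaseChange (algebraMap R (Localization T)) M (M.d (comp M.isInternal n p)) = 0 := by
    rw [← d_toBaseChange, hp', ring_d_smul, hd, smul_zero]
  obtain ⟨s, hs, hs'⟩ := exists_smul_eq_zero T h0
  refine ⟨s * t, mul_mem hs ht, s • comp M.isInternal n p, ring_smul_mem _ (comp_mem _ _ _),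
    by rw [ring_d_smul, hs'], ?_⟩
  rw [toBaseChange_smul, hp', smul_smul, map_mul]

end Localization

section Decomposition

variable {R : Type u} [CommRing R] {M N : DGModule (CommDGRing.ofCommRing R)}

variable (M N) in
/-- The products of cocycles of opposite degrees. -/
def cocycleProducts : Set (tensor (CommDGRing.Hom.id _) M N) :=
  {w | ∃ n, ∃ p ∈ M.grading n, M.d p = 0 ∧ ∃ q ∈ N.grading (-n), N.d q = 0 ∧ w = tm _ M N p q}

/-- The differential as a linear map. -/
def ringD (M : DGModule (CommDGRing.ofCommRing R)) : M →ₗ[R] M where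
  toFun := M.d
  map_add' := map_add _
  map_smul' := ring_d_smul

/-- A local-global argument: modulo coboundaries, products of cocycles are multiples `r z`, and the
local case yields one with `r` outside any given maximal ideal. So the ideal of all `r` with `r z`
in the submodule is the whole ring. -/
lemma mem_span_cocycleProducts (hM : M.KFlat) (hN : N.KFlat) (h : DMon.mk M * DMon.mk N = 1)
    (z : tensor (CommDGRing.Hom.id _) M N) (hz : DGModule.d _ z = 0)
    (hg : ∀ w : tensor (CommDGRing.Hom.id _) M N, DGModule.d _ w = 0 →
      ∃ (r : R) (v : _), w = r • z + DGModule.d _ v) :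
    z ∈ Submodule.span R (cocycleProducts M N) ⊔ LinearMap.range (ringD _) := by
  set D := Submodule.span R (cocycleProducts M N) ⊔ LinearMap.range (ringD _) with hD
  let I : Ideal R := D.comap (LinearMap.toSpanSingleton R _ z)
  have hI : ∀ r, r ∈ I ↔ r • z ∈ D := fun _ => Iff.rfl
  suffices I = ⊤ by simpa [hI] using (Ideal.eq_top_iff_one I).1 this
  by_contra hne
  obtain ⟨m, hm, hIm⟩ := Ideal.exists_le_maximal I hne
  have := hm.isPrime
  let g := algebraMap R (Localization.AtPrime m)
  let f := CommDGRing.ofRingHom g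
  have hMS : DMon.mk (ringBaseChange g M) = DMon.baseChange f (DMon.mk M) :=
    (DMon.baseChange_mk_of_kFlat f hM).symm
  have hNS : DMon.mk (ringBaseChange g N) = DMon.baseChange f (DMon.mk N) :=
    (DMon.baseChange_mk_of_kFlat f hN).symm
  obtain ⟨n, p, hp, hdp, q, hq, hdq, key⟩ := exists_cocycles_of_isLocalRing
    (M := ringBaseChange g M) (N := ringBaseChange g N) (kFlat_tensor kFlat_self hN)
    (by rw [hMS, hNS, ← map_mul, h, map_one])
  obtain ⟨t, ht, x, hx, hdx, htx⟩ := exists_cocycle_smul_eq m.primeCompl hp hdp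
  obtain ⟨s, hs, y, hy, hdy, hsy⟩ := exists_cocycle_smul_eq m.primeCompl hq hdq
  -- `x` and `y` are the local cocycles with denominators cleared. Their product is a multiple of
  -- `z` over `R`, whose coefficient lies in `I` and therefore in `m`.
  obtain ⟨r, v, hv⟩ := hg (tm _ M N x y) (by rw [d_tm hx, hdx, hdy]; simp)
  have hr : r ∈ m := hIm ((hI r).2 (by
    rw [eq_sub_of_add_eq hv.symm]
    exact sub_mem (Submodule.mem_sup_left (Submodule.subset_span ⟨n, x, hx, hdx, y, hy, hdy, rfl⟩))
      (Submodule.mem_sup_right ⟨v, rfl⟩)))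
  obtain ⟨u, hu⟩ := isUnit_iff_exists_inv'.1
    (IsLocalization.map_units (Localization.AtPrime m) (⟨s * t, mul_mem hs ht⟩ : m.primeCompl))
  have hv' := congrArg (tensorToBaseChange g) hv
  rw [tensorToBaseChange_tm, map_add, tensorToBaseChange_smul, tensorToBaseChange_d, ← htx,
    ← hsy] at hv'
  have h1 : tm (CommDGRing.Hom.id _) (ringBaseChange g M) (ringBaseChange g N) (g t • p) (g s • q)
      = g (s * t) • tm _ _ _ p q := by
    rw [ring_smul_def _ q, tm_smul_right _ (ofCommRing_mem_zero _) (ring_smul_mem _ hp), zero_mul,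
      Int.negOnePow_zero, one_smul, map_mul, mul_smul]
    rfl
  rw [h1] at hv'
  -- Dividing the localized relation by `s * t` puts `p ⊗ q` in the maximal ideal times a cocycle
  -- plus a coboundary, which the choice of `p` and `q` excludes.
  refine key (u * g r) (Ideal.mul_mem_left _ _ ?_) (tensorToBaseChange g z)
    (u • tensorToBaseChange g v) (by rw [← tensorToBaseChange_d, hz, map_zero]) ?_
  · exact (IsLocalization.AtPrime.to_map_mem_maximal_iff _ m r).2 hr
  · rw [mul_smul, ring_d_smul, ← smul_add, ← hv', smul_smul]
    have hu' : u * g (s * t) = 1 := hu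
    rw [hu', one_smul]

/-- The unit is a sum of products of cocycles. -/
lemma exists_sum_cocycleProducts (hM : M.KFlat) (hN : N.KFlat) (h : DMon.mk M * DMon.mk N = 1)
    (z : tensor (CommDGRing.Hom.id _) M N) (hz : DGModule.d _ z = 0)
    (hg : ∀ w : tensor (CommDGRing.Hom.id _) M N, DGModule.d _ w = 0 →
      ∃ (r : R) (v : _), w = r • z + DGModule.d _ v) :
    ∃ (n : ℕ) (deg : Fin n → ℤ) (x : Fin n → M) (y : Fin n → N),
      (∀ k, x k ∈ M.grading (deg k) ∧ M.d (x k) = 0) ∧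
      (∀ k, y k ∈ N.grading (-deg k) ∧ N.d (y k) = 0) ∧
      ∃ v, z = ∑ k, tm _ M N (x k) (y k) + DGModule.d _ v := by
  obtain ⟨a, ha, _, ⟨v, rfl⟩, hav⟩ :=
    Submodule.mem_sup.1 (mem_span_cocycleProducts hM hN h z hz hg)
  obtain ⟨n, c, w, hw⟩ := Submodule.mem_span_set'.1 ha
  choose deg x hx hdx y hy hdy hxy using fun k => (w k).2
  refine ⟨n, deg, fun k => c k • x k, y, fun k => ⟨ring_smul_mem _ (hx k), by
    rw [ring_d_smul, hdx, smul_zero]⟩, fun k => ⟨hy k, hdy k⟩, v, ?_⟩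
  rw [← hav, ← hw]
  refine congrArg₂ (· + ·) (Finset.sum_congr rfl fun k _ => ?_) rfl
  rw [hxy]
  rfl

end Decomposition

end DGModule
end DG

/-! ### The dual basis argument. -/

namespace DG
open CategoryTheory
open scoped TensorProduct

namespace DGModule

section DualBasis

variable {R : Type u} [CommRing R]

lemma IsQI.exists_homogeneous {A : CommDGRing.{u}} {M N : DGModule A} {φ : M ⟶ N} (h : IsQI φ)
    {i : ℤ} {y : N} (hy : y ∈ N.grading i) (hd : N.d y = 0) :
    ∃ x ∈ M.grading i, M.d x = 0 ∧ ∃ w, y = φ.toLinearMap x + N.d w := by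
  obtain ⟨x, hx, w, hw⟩ := h.surj y hd
  refine ⟨DG.comp M.isInternal i x, comp_mem _ _ _, by rw [comp_d, hx, map_zero],
    DG.comp N.isInternal (i - 1) w, ?_⟩
  rw [← comp_map, comp_d, sub_add_cancel, ← map_add, ← hw, comp_of_mem _ hy]

/-- A generator of the cohomology of a DG module isomorphic to the base ring. -/
lemma DEq.exists_generator {M : DGModule (CommDGRing.ofCommRing R)}
    (h : DEq M (self (CommDGRing.ofCommRing R))) :
    ∃ (z : M) (hz : z ∈ M.grading 0) (hd : M.d z = 0), IsQI (fromSelf hz hd) ∧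
      (∀ w, M.d w = 0 → ∃ (r : R) (v : M), w = r • z + M.d v) ∧
      ∀ (r : R) (v : M), r • z = M.d v → r = 0 := by
  obtain ⟨z, hz, hd, hq⟩ := h.exists_fromSelf
  refine ⟨z, hz, hd, hq, fun w hw => ?_, fun r v hv => ?_⟩
  · obtain ⟨r, -, v, hv⟩ := hq.surj w hw
    exact ⟨r, v, hv⟩
  · obtain ⟨w, hw⟩ := hq.inj (ofRing _ (ringEquiv R r)) rfl ⟨v, hv.symm⟩
    exact hw.symm

variable {M N : DGModule (CommDGRing.ofCommRing R)}

lemma d_tm_eq_zero {A B : CommDGRing.{u}} {f : CommDGRing.Hom A B} {M : DGModule B}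
    {N : DGModule A} {x : M} {y : N} (hx : M.d x = 0) (hy : N.d y = 0) :
    (tensor f M N).d (tm f M N x y) = 0 := by
  rw [d_tm_signed, hx, hy, map_zero, map_zero, AddMonoidHom.zero_apply, add_zero]

lemma d_signed_apply {A : CommDGRing.{u}} (M : DGModule A) (x : M) :
    M.d (signed M.isInternal x) = -signed M.isInternal (M.d x) := by
  induction x using graded_induction M.isInternal with
  | hz => simp
  | hm i a ha =>
    rw [signed_of_mem _ ha, signed_of_mem _ (M.d_mem ha), map_unit_smul, Int.negOnePow_succ,
      Units.neg_smul, neg_neg]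
  | ha a b ha hb => rw [map_add, map_add, ha, hb, map_add, map_add, neg_add]

lemma tm_d_right {A B : CommDGRing.{u}} {f : CommDGRing.Hom A B} {M : DGModule B}
    {N : DGModule A} {x : M} (hx : M.d x = 0) (v : N) :
    tm f M N x (N.d v) = (tensor f M N).d (tm f M N (signed M.isInternal x) v) := by
  have h : M.d (signed M.isInternal x) = 0 := by rw [d_signed_apply, hx, map_zero, neg_zero]
  rw [d_tm_signed, h, signed_signed, map_zero, AddMonoidHom.zero_apply, zero_add]

lemma tm_d_left {A B : CommDGRing.{u}} {f : CommDGRing.Hom A B} {M : DGModule B}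
    {N : DGModule A} (v : M) {y : N} (hy : N.d y = 0) :
    tm f M N (M.d v) y = (tensor f M N).d (tm f M N v y) := by
  rw [d_tm_signed, hy, map_zero, add_zero]

lemma tm_ring_smul (r : R) (x : M) (y : N) :
    tm (CommDGRing.Hom.id _) M N (r • x) y = r • tm _ M N x y := rfl

/-- A finite presentation of the cohomology of an invertible DG module over a commutative ring by
a matrix that acts as the identity on it. -/
structure Projector (M : DGModule (CommDGRing.ofCommRing R)) where
  n : ℕ
  deg : Fin n → ℤ
  gen : Fin n → M
  gen_mem : ∀ k, gen k ∈ M.grading (deg k)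
  d_gen : ∀ k, M.d (gen k) = 0
  mat : Fin n → Fin n → R
  mat_eq_zero : ∀ k l, deg k ≠ deg l → mat k l = 0
  exists_coeff : ∀ x, M.d x = 0 → ∃ (c : Fin n → R) (w : M), x = ∑ k, c k • gen k + M.d w
  sum_mul_mat : ∀ (c : Fin n → R) (w : M), ∑ k, c k • gen k = M.d w → ∀ l, ∑ k, c k * mat k l = 0
  exists_gen_eq : ∀ k, ∃ w, gen k = ∑ l, mat k l • gen l + M.d w

/-- A dual basis lemma on cohomology. With `z' ∼ ∑ q_k ⊗ x_k`, the pairings of a cocycle `y` with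
the `q_k`, measured in multiples of `z`, are its coordinates. The triangle identity between `z` and
`z'` is avoided by replacing the `x_k` by suitable `p_k`. -/
lemma exists_projector (hM : M.KFlat) (hu : IsUnit (DMon.mk M)) : Nonempty (Projector M) := by
  obtain ⟨y, hy⟩ := isUnit_iff_exists_inv.1 hu
  obtain ⟨N', rfl⟩ := DMon.mk_surjective y
  obtain ⟨N, hN, hMN⟩ : ∃ N : DGModule (CommDGRing.ofCommRing R), N.KFlat ∧
      DMon.mk M * DMon.mk N = 1 :=
    ⟨_, kFlat_resFunctor N', by rwa [DMon.mk_eq.2 (deq_resFunctor N')]⟩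
  clear hy N'
  have hNM : DMon.mk N * DMon.mk M = 1 := (mul_comm _ _).trans hMN
  obtain ⟨z, hz, hdz, -, hzg, hzi⟩ := DEq.exists_generator (R := R)
    (M := tensor (CommDGRing.Hom.id _) M N)
    (DMon.mk_eq.1 (by rw [DMon.mk_tensor M hN, hMN, DMon.one_def]))
  obtain ⟨z', hz', hdz', hq', hzg', -⟩ := DEq.exists_generator (R := R)
    (M := tensor (CommDGRing.Hom.id _) N M)
    (DMon.mk_eq.1 (by rw [DMon.mk_tensor N hM, hNM, DMon.one_def]))
  obtain ⟨n, deg, q, x, hq, hx, v', hv'⟩ := exists_sum_cocycleProducts hN hM hNM z' hdz' hzg'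
  let ι := CommDGRing.Hom.id (CommDGRing.ofCommRing R)
  let a := assocHom ι ι ι M N M fun _ => rfl
  -- The map `y ↦ y ⊗ z'`, a quasi-isomorphism because `z'` generates the cohomology of `N ⊗ M`.
  let β : M ⟶ tensor ι M (tensor ι N M) :=
    unitHom ι M ≫ tensorMap ι (𝟙 M) (fromSelf hz' hdz')
  have hβ : IsQI β := (IsQI.of_bijective (unitHom_bijective ι M)).comp
    (isQI_tensorMap_of_kFlat M kFlat_self (kFlat_tensor hN hM) hq')
  have hβa : ∀ y, β.toLinearMap y = tm ι M (tensor ι N M) y z' := fun y => by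
    rw [comp_toLinearMap, unitHom_apply, tensorMap_tm, fromSelf_ofRing, one_smul, id_toLinearMap]
  have ha : ∀ y k, a.toLinearMap (tm ι (tensor ι M N) M (tm ι M N y (q k)) (x k))
      = tm ι M (tensor ι N M) y (tm ι N M (q k) (x k)) := fun y k =>
    assocHom_tm ι ι ι _ _ _ (fun _ => rfl) y (q k) (x k)
  -- `p k` is the class with `p k ⊗ z' ∼ z ⊗ x k`; it differs from `x k` by the discrepancy between
  -- `z` and `z'`.
  have hp : ∀ k, ∃ p ∈ M.grading (-deg k), M.d p = 0 ∧
      ∃ w, a.toLinearMap (tm ι (tensor ι M N) M z (x k)) = β.toLinearMap p + DGModule.d _ w :=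
    fun k => hβ.exists_homogeneous (a.map_mem (tm_mem (zero_add _) hz (hx k).1))
      (by rw [← a.map_d, d_tm_eq_zero hdz (hx k).2, map_zero])
  choose p hp hdp w hw using hp
  -- If `y ⊗ q_k ∼ c_k z` for all `k`, then `y ⊗ z' ∼ ∑ c_k z ⊗ x_k ∼ ∑ c_k p_k ⊗ z'`, and `β` is
  -- injective on cohomology.
  have hcoeff : ∀ (y : M) (c : Fin n → R), M.d y = 0 →
      (∀ k, ∃ v, tm ι M N y (q k) = c k • z + DGModule.d _ v) →
      ∃ v, y = ∑ k, c k • p k + M.d v := by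
    intro y c hy hc
    choose v hv using hc
    have h1 : β.toLinearMap (y - ∑ k, c k • p k) = DGModule.d _
        (∑ k, (c k • w k + a.toLinearMap (tm ι (tensor ι M N) M (v k) (x k)))
          + tm ι M (tensor ι N M) (signed M.isInternal y) v') := by
      have h2 : β.toLinearMap y = ∑ k, (c k • (β.toLinearMap (p k) + DGModule.d _ (w k))
          + DGModule.d _ (a.toLinearMap (tm ι (tensor ι M N) M (v k) (x k))))
          + DGModule.d _ (tm ι M (tensor ι N M) (signed M.isInternal y) v') := by
        rw [hβa, ← tm_d_right hy]
        conv_lhs => rw [hv', map_add, map_sum]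
        refine congrArg₂ (· + ·) (Finset.sum_congr rfl fun k _ => ?_) rfl
        rw [← ha, hv, ← hw, ← ring_map_smul, ← a.map_d, ← tm_d_left _ (hx k).2, ← map_add,
          map_add, AddMonoidHom.add_apply, tm_ring_smul]
      rw [map_sub, h2, map_sum, map_add, map_sum]
      simp only [ring_map_smul, map_add, ring_d_smul, smul_add, Finset.sum_add_distrib]
      abel
    obtain ⟨u, hu⟩ := hβ.inj (y - ∑ k, c k • p k)
      (by rw [map_sub, hy, map_sum]; simp [ring_d_smul, hdp]) ⟨_, h1.symm⟩
    exact ⟨u, by rw [hu]; abel⟩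
  have hex : ∀ (y : M), M.d y = 0 → ∃ c : Fin n → R,
      ∀ k, ∃ v, tm ι M N y (q k) = c k • z + DGModule.d _ v := fun y hy => by
    choose c v hv using fun k => hzg (tm ι M N y (q k)) (d_tm_eq_zero hy (hq k).2)
    exact ⟨c, fun k => ⟨v k, hv k⟩⟩
  -- The matrix of pairings: `p_k ⊗ q_l ∼ E_kl z`.
  choose E hE using fun k => hex (p k) (hdp k)
  refine ⟨⟨n, fun k => -deg k, p, hp, hdp, E, fun k l hkl => ?_, fun y hy => ?_,
    fun c u hu l => ?_, fun k => hcoeff (p k) (E k) (hdp k) (hE k)⟩⟩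
  -- If the degrees differ, `p_k ⊗ q_l` has no component in degree `0`, so `E_kl z` is a coboundary
  -- and `E_kl = 0`.
  · obtain ⟨v, hv⟩ := hE k l
    have h1 := congrArg (comp (tensor ι M N).isInternal 0) hv
    rw [comp_of_mem_ne _ (tm_mem rfl (hp k) (hq l).1) (by omega), map_add,
      comp_of_mem _ (ring_smul_mem _ hz)] at h1
    refine hzi (E k l) (-comp (tensor ι M N).isInternal (-1) v) ?_
    rw [map_neg, comp_d, neg_add_cancel]
    exact eq_neg_of_add_eq_zero_left h1.symm
  · obtain ⟨c, hc⟩ := hex y hy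
    obtain ⟨v, hv⟩ := hcoeff y c hy hc
    exact ⟨c, v, hv⟩
  -- Pairing the relation `∑ c_k p_k = d u` with the cocycle `q_l` makes `(∑ c_k E_kl) z` a
  -- coboundary, and `z` has no annihilator modulo coboundaries.
  · choose v hv using fun k => hE k l
    refine hzi _ (tm ι M N u (q l) - ∑ k, c k • v k) ?_
    rw [map_sub, ← tm_d_left u (hq l).2, ← hu, map_sum, AddMonoidHom.finsetSum_apply, map_sum,
      ← Finset.sum_sub_distrib, Finset.sum_smul]
    refine Finset.sum_congr rfl fun k _ => ?_
    rw [tm_ring_smul, hv, ring_d_smul, smul_add, add_sub_cancel_right, mul_smul]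

end DualBasis

end DGModule
end DG

/-! ### Telescopes: base change and cohomology. -/

namespace DG
open CategoryTheory
open scoped TensorProduct

/-- The generators of the telescope of an endomorphism of a finite free graded module. -/
inductive TelescopeIndex (n : ℕ) : Type u
  | obj (s : ℕ) (k : Fin n)
  | rel (s : ℕ) (k : Fin n)

namespace DGModule

variable {A B : CommDGRing.{u}} {n : ℕ}

/-- The telescope of the endomorphism of a finite free graded module given by a matrix. -/
noncomputable abbrev telescopeData (deg : Fin n → ℤ) (E : Fin n → Fin n → A) : FreeData A where
  gen := TelescopeIndex.{u} n
  deg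
    | .obj _ k => deg k
    | .rel _ k => deg k - 1
  δ
    | .obj _ _ => 0
    | .rel s k => Finsupp.single (.obj s k) 1 - ∑ l, Finsupp.single (.obj (s + 1) l) (E k l)

/-- The conditions on a matrix to give a homomorphism of graded modules. -/
structure IsDegreewise (deg : Fin n → ℤ) (E : Fin n → Fin n → A) : Prop where
  mem : ∀ k l, E k l ∈ A.grading 0
  eq_zero : ∀ k l, deg k ≠ deg l → E k l = 0

variable {deg : Fin n → ℤ} {E : Fin n → Fin n → A}

lemma telescopeData_isDG (hE : IsDegreewise deg E) : (telescopeData deg E).IsDG where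
  δ_mem e := by
    rcases e with ⟨s, k⟩ | ⟨s, k⟩
    · exact zero_mem _
    · refine sub_mem (FreeData.single_mem ?_) (sum_mem fun l _ => ?_)
      · rw [show (telescopeData deg E).deg (TelescopeIndex.rel s k) + 1 - (telescopeData deg E).deg (TelescopeIndex.obj s k) = 0
          from by simp]
        exact A.one_mem
      · by_cases h : deg k = deg l
        · refine FreeData.single_mem ?_
          rw [show (telescopeData deg E).deg (TelescopeIndex.rel s k) + 1
            - (telescopeData deg E).deg (TelescopeIndex.obj (s + 1) l) = 0 from by simp [h]]
          exact hE.mem k l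
        · rw [hE.eq_zero k l h, Finsupp.single_zero]
          exact zero_mem _
  D_δ e := by
    have hD : ∀ s k (a : A), A.d a = 0 →
        (telescopeData deg E).D (Finsupp.single (TelescopeIndex.obj s k) a) = 0 := fun s k a ha => by
      rw [FreeData.D_single, ha, Finsupp.single_zero, zero_add]
      exact smul_zero _
    rcases e with ⟨s, k⟩ | ⟨s, k⟩
    · exact map_zero _
    · change (telescopeData deg E).D (Finsupp.single (TelescopeIndex.obj s k) 1
        - ∑ l, Finsupp.single (TelescopeIndex.obj (s + 1) l) (E k l)) = 0
      rw [map_sub, map_sum, hD s k 1 A.d_one, zero_sub, neg_eq_zero]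
      exact Finset.sum_eq_zero fun l _ =>
        hD _ _ _ (CommDGRing.d_eq_zero_of_mem_zero (hE.mem k l))

/-- The telescope as a DG module. -/
noncomputable abbrev telescope (hE : IsDegreewise deg E) : DGModule A :=
  free (telescopeData deg E) (telescopeData_isDG hE)

variable (hE : IsDegreewise deg E)

/-- The generators of the telescope in the degrees of the original module. -/
noncomputable def telObj (s : ℕ) (k : Fin n) : telescope hE :=
  fgen (telescopeData_isDG hE) (TelescopeIndex.obj s k)

/-- The generators of the telescope that identify the different levels. -/
noncomputable def telRel (s : ℕ) (k : Fin n) : telescope hE :=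
  fgen (telescopeData_isDG hE) (TelescopeIndex.rel s k)

lemma telObj_mem (s : ℕ) (k : Fin n) : telObj hE s k ∈ (telescope hE).grading (deg k) :=
  fgen_mem (telescopeData_isDG hE) (TelescopeIndex.obj s k)

lemma telRel_mem (s : ℕ) (k : Fin n) : telRel hE s k ∈ (telescope hE).grading (deg k - 1) :=
  fgen_mem (telescopeData_isDG hE) (TelescopeIndex.rel s k)

lemma d_telObj (s : ℕ) (k : Fin n) : (telescope hE).d (telObj hE s k) = 0 :=
  (d_fgen (telescopeData_isDG hE) (TelescopeIndex.obj s k)).trans (map_zero _)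

lemma d_telRel (s : ℕ) (k : Fin n) : (telescope hE).d (telRel hE s k)
    = telObj hE s k - ∑ l, E k l • telObj hE (s + 1) l := by
  refine (d_fgen (telescopeData_isDG hE) (TelescopeIndex.rel s k)).trans ?_
  change freeMk _ (Finsupp.single (TelescopeIndex.obj s k) 1
    - ∑ l, Finsupp.single (TelescopeIndex.obj (s + 1) l) (E k l)) = _
  rw [map_sub, map_sum]
  exact congrArg₂ _ rfl (Finset.sum_congr rfl fun l _ => freeMk_single _ _ _)

lemma kFlat_telescope : (telescope hE).KFlat :=
  kFlat_free _ (fun e => match e with | .obj _ _ => 0 | .rel _ _ => 1) (by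
    rintro (⟨s, k⟩ | ⟨s, k⟩) e h
    · exact absurd rfl h
    · rcases e with ⟨t, l⟩ | ⟨t, l⟩
      · exact zero_lt_one
      · refine absurd ?_ h
        simp)

lemma exists_telescope_grading_eq_bot :
    ∃ N : ℤ, ∀ i, N < i → (telescope hE).grading i = ⊥ := by
  obtain ⟨N, hN⟩ := (Set.finite_range deg).bddAbove
  refine ⟨N, fun i hi => ?_⟩
  rw [eq_bot_iff]
  intro x hx
  obtain ⟨x, rfl⟩ := (freeMk (telescopeData_isDG hE)).surjective x
  replace hx := (freeMk_mem _).1 hx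
  have : x = 0 := by
    ext e
    have h1 := hx e
    have h2 : (telescopeData deg E).deg e ≤ N := by
      rcases e with ⟨s, k⟩ | ⟨s, k⟩
      · exact hN ⟨k, rfl⟩
      · have := hN ⟨k, rfl⟩
        change deg k - 1 ≤ N
        omega
    rw [A.nonpos (by omega), AddSubgroup.mem_bot] at h1
    exact h1
  rw [this, map_zero]
  exact zero_mem _

/-- A function on the generators of a telescope. -/
def telescopeImage {X : Type*} (y w : ℕ → Fin n → X) : TelescopeIndex.{u} n → X
  | .obj s k => y s k
  | .rel s k => w s k

/-- The homomorphism from a telescope given by the images of the generators. -/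
noncomputable def telescopeDesc {N : DGModule A} (y w : ℕ → Fin n → N)
    (hy : ∀ s k, y s k ∈ N.grading (deg k)) (hw : ∀ s k, w s k ∈ N.grading (deg k - 1))
    (hdy : ∀ s k, N.d (y s k) = 0)
    (hdw : ∀ s k, N.d (w s k) = y s k - ∑ l, E k l • y (s + 1) l) : telescope hE ⟶ N :=
  freeDesc (telescopeData_isDG hE) (telescopeImage y w)
    (by rintro (⟨s, k⟩ | ⟨s, k⟩); exacts [hy s k, hw s k])
    (by
      rintro (⟨s, k⟩ | ⟨s, k⟩)
      · exact (hdy s k).trans (map_zero _).symm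
      · refine (hdw s k).trans ?_
        change _ = Finsupp.linearCombination A (telescopeImage y w) (Finsupp.single (TelescopeIndex.obj s k) 1
          - ∑ l, Finsupp.single (TelescopeIndex.obj (s + 1) l) (E k l))
        rw [map_sub, map_sum, Finsupp.linearCombination_single, one_smul]
        exact congrArg₂ _ rfl (Finset.sum_congr rfl fun l _ =>
          (Finsupp.linearCombination_single (v := telescopeImage y w) A (E k l) (TelescopeIndex.obj (s + 1) l)).symm))

section Desc

variable {N : DGModule A} {y w : ℕ → Fin n → N}
    (hy : ∀ s k, y s k ∈ N.grading (deg k)) (hw : ∀ s k, w s k ∈ N.grading (deg k - 1))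
    (hdy : ∀ s k, N.d (y s k) = 0)
    (hdw : ∀ s k, N.d (w s k) = y s k - ∑ l, E k l • y (s + 1) l)

lemma telescopeDesc_telObj (s : ℕ) (k : Fin n) :
    (telescopeDesc hE y w hy hw hdy hdw).toLinearMap (telObj hE s k) = y s k :=
  freeDesc_fgen _ _ _ _ _

lemma telescopeDesc_telRel (s : ℕ) (k : Fin n) :
    (telescopeDesc hE y w hy hw hdy hdw).toLinearMap (telRel hE s k) = w s k :=
  freeDesc_fgen _ _ _ _ _

end Desc

section BaseChange

variable (f : CommDGRing.Hom A B)

lemma IsDegreewise.map (hE : IsDegreewise deg E) :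
    IsDegreewise deg fun k l => f.toRingHom (E k l) where
  mem k l := f.map_mem (hE.mem k l)
  eq_zero k l h := by rw [hE.eq_zero k l h, map_zero]

/-- The comparison of the telescope of the base change with the base change of the telescope. -/
noncomputable def telescopeBaseChange :
    telescope (hE.map f) ⟶ tensor f (self B) (telescope hE) :=
  telescopeDesc (hE.map f) (fun s k => tm f (self B) _ (ofRing B 1) (telObj hE s k))
    (fun s k => tm f (self B) _ (ofRing B 1) (telRel hE s k))
    (fun s k => tm_mem (zero_add _) (ofRing_one_mem B) (telObj_mem hE s k))
    (fun s k => tm_mem (zero_add _) (ofRing_one_mem B) (telRel_mem hE s k))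
    (fun s k => by
      rw [d_tm (ofRing_one_mem B), d_telObj, d_ofRing, B.d_one]; simp)
    (fun s k => by
      rw [d_tm (ofRing_one_mem B), d_telRel, d_ofRing, B.d_one, map_zero, map_zero,
        AddMonoidHom.zero_apply, zero_add, Int.negOnePow_zero, one_smul, map_sub, map_sum]
      refine congrArg₂ _ rfl (Finset.sum_congr rfl fun l _ => ?_)
      rw [tm_smul_right _ (hE.mem k l) (ofRing_one_mem B), mul_zero, Int.negOnePow_zero, one_smul,
        smul_tm])

lemma telescopeBaseChange_freeMk (x : TelescopeIndex.{u} n →₀ B) :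
    (telescopeBaseChange hE f).toLinearMap (freeMk (telescopeData_isDG (hE.map f)) x)
      = fromFinsupp (telescopeData_isDG hE) f (self B)
          (Finsupp.mapRange.addMonoidHom (ofRing B) x) := by
  induction x using Finsupp.induction_linear with
  | zero => rw [map_zero, map_zero, map_zero, map_zero]
  | add x y hx hy => rw [map_add, map_add, map_add, map_add, hx, hy]
  | single e b =>
    rw [Finsupp.mapRange.addMonoidHom_apply, Finsupp.mapRange_single, fromFinsupp_single,
      freeMk_single, LinearMap.map_smul]
    have h : b • tm f (self B) _ (ofRing B 1) (fgen (telescopeData_isDG hE) e)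
        = tm f (self B) _ (ofRing B b) (fgen (telescopeData_isDG hE) e) := by
      rw [smul_tm, smul_ofRing, mul_one]
    rw [← h]
    congr 1
    rcases e with ⟨s, k⟩ | ⟨s, k⟩
    · exact telescopeDesc_telObj _ _ _ _ _ _ _
    · exact telescopeDesc_telRel _ _ _ _ _ _ _

/-- Both sides are free on the same generators, and in coordinates the map is the identification of
`B` with `self B`. -/
lemma telescopeBaseChange_bijective : Function.Bijective (telescopeBaseChange hE f).toLinearMap := by
  have hb : Function.Bijective (Finsupp.mapRange.addMonoidHom (ι := TelescopeIndex.{u} n)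
      (ofRing B)) :=
    (Finsupp.mapRange.addEquiv (ι := TelescopeIndex.{u} n)
      (AddEquiv.ofBijective (ofRing B) ⟨ofRing_injective, ofRing_surjective⟩)).bijective
  constructor
  · intro x y hxy
    obtain ⟨x, rfl⟩ := (freeMk (telescopeData_isDG (hE.map f))).surjective x
    obtain ⟨y, rfl⟩ := (freeMk (telescopeData_isDG (hE.map f))).surjective y
    rw [telescopeBaseChange_freeMk, telescopeBaseChange_freeMk] at hxy
    rw [hb.1 (fromFinsupp_injective _ _ _ hxy)]
  · intro y
    obtain ⟨y, rfl⟩ := fromFinsupp_surjective (telescopeData_isDG hE) f (self B) y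
    obtain ⟨x, rfl⟩ := hb.2 y
    exact ⟨_, telescopeBaseChange_freeMk hE f x⟩

end BaseChange

section Ring

variable {R : Type u} [CommRing R] {M : DGModule (CommDGRing.ofCommRing R)}

lemma signed_ofCommRing (a : CommDGRing.ofCommRing R) :
    signed (CommDGRing.ofCommRing R).isInternal a = a := by
  rw [signed_of_mem _ (ofCommRing_mem_zero a), Int.negOnePow_zero, one_smul]

variable {n : ℕ} {deg : Fin n → ℤ} {E : Fin n → Fin n → CommDGRing.ofCommRing R}

lemma telescope_D_obj_zero (x : TelescopeIndex.{u} n →₀ CommDGRing.ofCommRing R) (l : Fin n) :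
    (telescopeData deg E).D x (TelescopeIndex.obj 0 l) = x (TelescopeIndex.rel 0 l) := by
  classical
  induction x using Finsupp.induction_linear with
  | zero => simp
  | add x y hx hy => rw [map_add, Finsupp.add_apply, Finsupp.add_apply, hx, hy]
  | single e a =>
    rw [FreeData.D_single, d_ofCommRing, Finsupp.single_zero, zero_add, signed_ofCommRing,
      Finsupp.smul_apply]
    rcases e with ⟨s, k⟩ | ⟨s, k⟩
    · simp
    · simp [Finsupp.single_apply]

lemma telescope_D_obj_succ (x : TelescopeIndex.{u} n →₀ CommDGRing.ofCommRing R) (s : ℕ)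
    (l : Fin n) : (telescopeData deg E).D x (TelescopeIndex.obj (s + 1) l)
      = x (TelescopeIndex.rel (s + 1) l) - ∑ k, x (TelescopeIndex.rel s k) * E k l := by
  classical
  induction x using Finsupp.induction_linear with
  | zero => simp
  | add x y hx hy =>
    rw [map_add, Finsupp.add_apply, Finsupp.add_apply, hx, hy]
    simp only [Finsupp.add_apply, add_mul, Finset.sum_add_distrib]
    abel
  | single e a =>
    rw [FreeData.D_single, d_ofCommRing, Finsupp.single_zero, zero_add, signed_ofCommRing,
      Finsupp.smul_apply]
    rcases e with ⟨t, k⟩ | ⟨t, k⟩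
    · simp
    · by_cases hts : t = s
      · subst hts
        simp [Finsupp.single_apply]
      · simp [Finsupp.single_apply, hts]

/-- The coordinate of `d x` at `obj 0` is that of `x` at `rel 0`, and the one at `obj (s + 1)` is
that of `x` at `rel (s + 1)` up to terms from `rel s`. So a cocycle has no `rel` part, by induction
on `s`; the cohomology is a plain colimit of the levels. -/
lemma telescope_cocycle_rel {x : TelescopeIndex.{u} n →₀ CommDGRing.ofCommRing R}
    (hx : (telescopeData deg E).D x = 0) (s : ℕ) (l : Fin n) :
    x (TelescopeIndex.rel s l) = 0 := by
  induction s generalizing l with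
  | zero => rw [← telescope_D_obj_zero (deg := deg) (E := E), hx, Finsupp.zero_apply]
  | succ s ih =>
    have h := telescope_D_obj_succ (deg := deg) (E := E) x s l
    rw [hx, Finsupp.zero_apply] at h
    simpa [ih] using h.symm

variable (hE : IsDegreewise deg E)

/-- Modulo coboundaries, a vector `c` at level `s` equals the vector `c E` at level `s + 1`. -/
lemma telescope_push (s : ℕ) (c : Fin n → CommDGRing.ofCommRing R) :
    ∑ k, c k • telObj hE s k = ∑ l, (∑ k, c k * E k l) • telObj hE (s + 1) l
      + (telescope hE).d (∑ k, c k • telRel hE s k) := by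
  have h : (telescope hE).d (∑ k, c k • telRel hE s k)
      = ∑ k, c k • (telObj hE s k - ∑ l, E k l • telObj hE (s + 1) l) := by
    rw [map_sum]
    refine Finset.sum_congr rfl fun k _ => ?_
    rw [← d_telRel]
    exact ring_d_smul (S := R) ((ringEquiv R).symm (c k)) _
  rw [h]
  simp only [smul_sub, Finset.sum_sub_distrib, Finset.smul_sum, Finset.sum_smul, mul_smul]
  rw [Finset.sum_comm (γ := Fin n)]
  abel

/-- Every cocycle of the telescope is cohomologous to one at a single level. -/
lemma exists_level {x : telescope hE} (hx : (telescope hE).d x = 0) :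
    ∃ (s : ℕ) (c : Fin n → CommDGRing.ofCommRing R) (w : _),
      x = ∑ k, c k • telObj hE s k + (telescope hE).d w := by
  -- Allowing every sufficiently high level makes the claim stable under sums: both summands are
  -- pushed to a common level.
  suffices ∃ s₀, ∀ s, s₀ ≤ s → ∃ (c : Fin n → CommDGRing.ofCommRing R) (w : _),
      x = ∑ k, c k • telObj hE s k + (telescope hE).d w by
    obtain ⟨s, hs⟩ := this
    exact ⟨s, hs s le_rfl⟩
  obtain ⟨x, rfl⟩ := (freeMk (telescopeData_isDG hE)).surjective x
  have hx0 : (telescopeData deg E).D x = 0 := hx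
  have hx' := telescope_cocycle_rel hx0
  have hsum : freeMk (telescopeData_isDG hE) x
      = ∑ e ∈ x.support, x e • fgen (telescopeData_isDG hE) e := by
    conv_lhs => rw [← Finsupp.sum_single x, Finsupp.sum, map_sum]
    exact Finset.sum_congr rfl fun e _ => freeMk_single _ _ _
  rw [hsum]
  refine Finset.sum_induction _ (fun y => ∃ s₀, ∀ s, s₀ ≤ s →
    ∃ (c : Fin n → CommDGRing.ofCommRing R) (w : _),
      y = ∑ k, c k • telObj hE s k + (telescope hE).d w) ?_ ?_ ?_
  · rintro y z ⟨s, hs⟩ ⟨t, ht⟩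
    refine ⟨max s t, fun r hr => ?_⟩
    obtain ⟨c, w, rfl⟩ := hs r (le_of_max_le_left hr)
    obtain ⟨c', w', rfl⟩ := ht r (le_of_max_le_right hr)
    refine ⟨c + c', w + w', ?_⟩
    simp only [Pi.add_apply, add_smul, Finset.sum_add_distrib, map_add]
    abel
  · exact ⟨0, fun s _ => ⟨0, 0, by simp⟩⟩
  · rintro (⟨t, l⟩ | ⟨t, l⟩) -
    · refine ⟨t, fun s hs => ?_⟩
      induction s, hs using Nat.le_induction with
      | base =>
        classical
        refine ⟨Pi.single l (x (TelescopeIndex.obj t l)), 0, ?_⟩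
        rw [map_zero, add_zero, Finset.sum_eq_single l]
        · rw [Pi.single_eq_same]; rfl
        · intro k _ hk
          rw [Pi.single_eq_of_ne hk, zero_smul]
        · simp
      | succ s _ ih =>
        obtain ⟨c, w, h⟩ := ih
        rw [telescope_push] at h
        exact ⟨_, _, by rw [h, add_assoc, ← map_add]⟩
    · exact ⟨0, fun s _ => ⟨0, 0, by rw [hx', zero_smul]; simp⟩⟩

/-- The projector matrix of an invertible DG module. -/
def Projector.ringMat (p : Projector M) (k l : Fin p.n) : CommDGRing.ofCommRing R :=
  ringEquiv R (p.mat k l)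

lemma Projector.isDegreewise (p : Projector M) : IsDegreewise p.deg p.ringMat where
  mem _ _ := ofCommRing_mem_zero _
  eq_zero k l h := by rw [Projector.ringMat, p.mat_eq_zero k l h, map_zero]

/-- An invertible DG module over a commutative ring is the telescope of a projector. -/
lemma Projector.deq_telescope (p : Projector M) : DEq (telescope p.isDegreewise) M := by
  have hw : ∀ k, ∃ w ∈ M.grading (p.deg k - 1),
      M.d w = p.gen k - ∑ l, p.ringMat k l • p.gen l := by
    intro k
    obtain ⟨w, hw⟩ := p.exists_gen_eq k
    refine M.exists_homogeneous_primitive (w := w) ?_ (eq_sub_of_add_eq' hw.symm)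
    refine sub_mem (p.gen_mem k) (sum_mem fun l _ => ?_)
    by_cases h : p.deg k = p.deg l
    · exact ring_smul_mem _ (h ▸ p.gen_mem l)
    · rw [p.isDegreewise.eq_zero k l h, zero_smul]; exact zero_mem _
  choose w hw hdw using hw
  -- Every level is sent to the same generators of `M`; the `rel` generators go to the primitives
  -- `w` showing that the matrix fixes these generators up to coboundaries.
  let φ : telescope p.isDegreewise ⟶ M := telescopeDesc p.isDegreewise (fun _ => p.gen)
    (fun _ => w) (fun _ => p.gen_mem) (fun _ => hw) (fun _ => p.d_gen) (fun _ => hdw)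
  have hφ : ∀ s k, φ.toLinearMap (telObj _ s k) = p.gen k := fun s k =>
    telescopeDesc_telObj _ _ _ _ _ s k
  have hφs : ∀ s (c : Fin p.n → CommDGRing.ofCommRing R),
      φ.toLinearMap (∑ k, c k • telObj _ s k) = ∑ k, (ringEquiv R).symm (c k) • p.gen k := by
    intro s c
    rw [map_sum]
    exact Finset.sum_congr rfl fun k _ => by rw [LinearMap.map_smul, hφ]; rfl
  refine DEq.of_isQI (φ := φ) ⟨fun x hx hw => ?_, fun y hy => ?_⟩
  · obtain ⟨s, c, v, rfl⟩ := exists_level _ hx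
    obtain ⟨u, hu⟩ := hw
    rw [map_add, hφs, φ.map_d] at hu
    have h := p.sum_mul_mat _ (u - φ.toLinearMap v) (by rw [map_sub, hu, add_sub_cancel_right])
    -- The vector `c` is a relation between the generators of `H(M)`, so `c E = 0`, and pushing up
    -- one level turns the cocycle into a coboundary.
    refine ⟨_, (?_ : (telescope p.isDegreewise).d (∑ k, c k • telRel _ s k + v) = _)⟩
    rw [telescope_push, map_add]
    have h0 : ∀ l, ∑ k, c k * p.ringMat k l = 0 := fun l => h l
    simp [h0]
  · obtain ⟨c, v, hv⟩ := p.exists_coeff y hy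
    -- The generators of `H(M)` are hit already from level `0`.
    refine ⟨∑ k, ringEquiv R (c k) • telObj _ 0 k, ?_, v, ?_⟩
    · rw [map_sum]
      refine Finset.sum_eq_zero fun k _ => ?_
      rw [← ring_smul_def, ring_d_smul, d_telObj, smul_zero]
    · rw [hφs, hv]
      simp

end Ring

end DGModule
end DG

/-! ### Lifting invertible DG modules from `Ā` to `A`, and the conclusion. -/

namespace DG
open CategoryTheory
open scoped TensorProduct

open DGModule

namespace DMon

variable {A : CommDGRing.{u}}

/-- Invertible DG modules over `Ā` lift to K-flat bounded above DG modules over `A`. -/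
lemma exists_lift {M : DGModule A.bar} (hM : IsUnit (mk M)) :
    ∃ T : DGModule A, T.KFlat ∧ (∃ N : ℤ, ∀ i, N < i → T.grading i = ⊥) ∧
      baseChange A.toBar (mk T) = mk M := by
  have hr : mk ((resFunctor A.bar).obj M) = mk M := mk_eq.2 (deq_resFunctor M)
  obtain ⟨p⟩ := exists_projector (kFlat_resFunctor M) (hr ▸ hM)
  -- Entrywise lifts to cocycles of degree `0`. They satisfy the relations of the projector only
  -- modulo coboundaries, which does not matter since the telescope exists for any degreewise
  -- matrix.
  choose E hE using fun k l => toH0_surjective (A := A) (p.ringMat k l)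
  classical
  -- Entries between different degrees are reset to `0`: the chosen lift of a zero entry may be a
  -- nonzero coboundary.
  let E' : Fin p.n → Fin p.n → A := fun k l => if p.deg k = p.deg l then (E k l : A) else 0
  have hE' : IsDegreewise p.deg E' :=
    { mem := fun k l => by
        by_cases h : p.deg k = p.deg l
        · simp only [E', if_pos h]; exact (E k l).2.1
        · simp only [E', if_neg h]; exact zero_mem _
      eq_zero := fun k l h => if_neg h }
  have hbar : (fun k l => A.toBar.toRingHom (E' k l)) = p.ringMat := by
    funext k l
    by_cases h : p.deg k = p.deg l
    · simp only [E', if_pos h]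
      rw [← hE k l]
      exact toBar_of_mem_zero (E k l).2.1 (E k l).2.2
    · simp only [E', if_neg h]
      rw [map_zero, p.isDegreewise.eq_zero k l h]
  -- Stated for a variable matrix `m`, because the type of the telescope depends on the matrix and
  -- the equality `hbar` has to be substituted.
  have key : ∀ (m : Fin p.n → Fin p.n → A.bar) (hm : IsDegreewise p.deg m), m = p.ringMat →
      DEq (telescope hm) ((resFunctor A.bar).obj M) := by
    rintro m hm rfl
    exact p.deq_telescope
  refine ⟨telescope hE', kFlat_telescope hE', exists_telescope_grading_eq_bot hE', ?_⟩
  rw [baseChange_mk_of_kFlat _ (kFlat_telescope hE'), ← hr]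
  exact mk_eq.2 ((DEq.of_bijective (telescopeBaseChange_bijective hE' A.toBar)).symm.trans
    (key _ (hE'.map A.toBar) hbar))

lemma eq_one_of_baseChange_eq_one {M : DGModule A} {N : ℤ} (hN : ∀ i, N < i → M.ExactAt i)
    (h : baseChange A.toBar (mk M) = 1) : mk M = 1 :=
  mk_eq.2 (deq_self_of_ltensor_toBar hN (mk_eq.1 h))

lemma tensor_grading_eq_bot {M N : DGModule A} {m n : ℤ} (hM : ∀ i, m < i → M.grading i = ⊥)
    (hN : ∀ i, n < i → N.grading i = ⊥) {i : ℤ} (hi : m + n < i) :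
    (tensor (CommDGRing.Hom.id A) M N).grading i = ⊥ := by
  rw [eq_bot_iff]
  intro x hx
  rw [AddSubgroup.mem_bot]
  induction hx using tensor_grading_ind with
  | hz => rfl
  | ha x y _ _ hx hy => rw [hx, hy, add_zero]
  | hn x _ hx => rw [hx, neg_zero]
  | ht j k x y hjk hx hy =>
    by_cases hj : m < j
    · rw [hM j hj, AddSubgroup.mem_bot] at hx
      rw [hx, map_zero, AddMonoidHom.zero_apply]
    · rw [hN k (by omega), AddSubgroup.mem_bot] at hy
      rw [hy, map_zero]

-- Both halves rest on one criterion: a DG module with bounded above cohomology that reduces to `Ā`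
-- is isomorphic to `A`. For surjectivity it is applied to the tensor product of lifts of a unit and
-- of its inverse.
variable (A) in
lemma units_baseChange_bijective : Function.Bijective (Units.map (baseChange A.toBar)) := by
  constructor
  · refine (injective_iff_map_eq_one _).2 fun x hx => Units.ext ?_
    obtain ⟨M, hM⟩ := mk_surjective (x : DMon A)
    obtain ⟨N, hN⟩ := exists_exactAt_of_isUnit (hM ▸ x.isUnit : IsUnit (mk M))
    rw [← hM, Units.val_one]
    exact eq_one_of_baseChange_eq_one hN (hM ▸ congrArg Units.val hx)
  · intro y
    obtain ⟨P, hP⟩ := mk_surjective (y : DMon A.bar)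
    obtain ⟨Q, hQ⟩ := mk_surjective ((y⁻¹ : (DMon A.bar)ˣ) : DMon A.bar)
    obtain ⟨T, hT, ⟨m, hm⟩, eT⟩ := exists_lift (hP ▸ y.isUnit : IsUnit (mk P))
    obtain ⟨U, hU, ⟨n, hn⟩, eU⟩ := exists_lift (hQ ▸ y⁻¹.isUnit : IsUnit (mk Q))
    -- `T` and `U` are not yet known to be invertible, so the boundedness of `T ⊗ U` comes from that
    -- of the two telescopes.
    have h : mk T * mk U = 1 := by
      rw [← mk_tensor T hU]
      refine eq_one_of_baseChange_eq_one (N := m + n)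
        (fun i hi => exactAt_of_grading_eq_bot (tensor_grading_eq_bot hm hn hi)) ?_
      rw [mk_tensor T hU, map_mul, eT, eU, hP, hQ, Units.mul_inv]
    exact ⟨⟨mk T, mk U, h, (mul_comm _ _).trans h⟩, Units.ext (eT.trans hP)⟩

end DMon
end DG

theorem theorem0p3 (A : DG.CommDGRing.{u})
    (hA : Finite (ConnectedComponents (PrimeSpectrum A.H0))) :
    ∃ (gA : CommGroup (DG.DPic A)) (gAbar : CommGroup (DG.DPic A.bar)),
      DG.IsDPicGroup A gA ∧ DG.IsDPicGroup A.bar gAbar ∧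
      ∃ φ : DG.DPic A ≃* DG.DPic A.bar,
        ∀ (P : DG.DGModule A) (hP : P.IsTilting) (R : DG.DGModule A.bar) (hR : R.IsTilting),
          φ (DG.DPic.mk P hP) = DG.DPic.mk R hR ↔
            DG.DGModule.IsDerivedTensor A.toBar (DG.DGModule.self A.bar) P R :=
  DG.DPic.exists_mulEquiv A.toBar (DG.DMon.units_baseChange_bijective A)
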